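/- **Path-loss model.** Let $N\ge 1$ and $0=d_0<d_1<\dots<d_{N-1}<d_N=+\infty$. For $Path\in\{\mathrm L,\mathrm{NL}\}$ and $n=1,\dots,N$ let $\zeta_n^{Path}(r)=A_n^{Path}r^{-\alpha_n^{Path}}$ with $A_n^{Path},\alpha_n^{Path}>0$, and let $\mathrm{Pr}^{\mathrm L}_n$ be a measurable function with values in $[0,1]$ on $(d_{n-1},d_n]$. Let $\zeta^{Path}$ and $\mathrm{Pr}^{\mathrm L}$ be the functions on $(0,\infty)$ that coincide with $\zeta_n^{Path}$ and $\mathrm{Pr}^{\mathrm L}_n$ on $(d_{n-1},d_n]$. Assume that $\zeta^{\mathrm L}$ and $\zeta^{\mathrm{NL}}$ are strictly decreasing on $(0,\infty)$, and that for every $n$ and $r\in(d_{n-1},d_n]$ there are $r_1=r_1(r)>0$ and $r_2=r_2(r)>0$ with $$\zeta^{\mathrm{NL}}(r_1)=\zeta_n^{\mathrm L}(r),\qquad \zeta^{\mathrm{L}}(r_2)=\zeta_n^{\mathrm{NL}}(r)$$ (this holds, for instance, if $\zeta^{\mathrm L},\zeta^{\mathrm{NL}}$ are continuous). **Network.** Let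 $\lambda>0$, $0\le\tilde\lambda\le\lambda$, $P>0$, $P_{\mathrm N}\ge0$, $\gamma>0$. Base stations (BSs) form a homogeneous Poisson point process $\Phi$ of intensity $\lambda$ in $\mathbb R^2$; the typical user is at the origin. Given $\Phi$, the following are independent, for all BSs jointly: the link of a BS at distance $u$ from the origin is LoS with probability $\mathrm{Pr}^{\mathrm L}(u)$ and NLoS otherwise; its channel gain is exponential with mean $1$ (Rayleigh fading); and the BS is activated with probability $\tilde\lambda/\lambda$, so that the activated BSs form a homogeneous Poisson point process $\tilde\Phi$ of intensity $\tilde\lambda$. For a BS at distance $u$ put $\zeta=\zeta^{\mathrm L}(u)$ if its link is LoS and $\zeta=\zeta^{\mathrm{NL}}(u)$ otherwise. The user is served by the BS $b_o$ with the smallest path loss, i.e. the largest $\zeta$. Let $R$ be the distance of $b_o$ and $h$ its channel gain, let $I_{\mathrm{agg}}=\sum_{b_i\in\tilde\Phi\setminus b_o}P\beta_ig_i\in[0,\infty]$, where $\beta_i$ and $g_i$ are the value of $\zeta$ and the channel gain of $b_i$, let $\mathrm{SINR}=P\zeta_{b_o}h/(I_{\mathrm{agg}}+P_{\mathrm N})$,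 and let $p^{\mathrm{cov}}(\lambda,\gamma)=\Pr[\mathrm{SINR}>\gamma]$. **Theorem.** Almost surely exactly one BS has the largest $\zeta$, and $$p^{\mathrm{cov}}(\lambda,\gamma)=\sum_{n=1}^N\left(T_n^{\mathrm L}+T_n^{\mathrm{NL}}\right),\qquad T_n^{Path}=\int_{d_{n-1}}^{d_n}p_n^{Path}(r)\,f_{R,n}^{Path}(r)\,dr,$$ where, with the convention $e^{-\infty}=0$, $$f_{R,n}^{\mathrm L}(r)=e^{-\int_0^{r_1}(1-\mathrm{Pr}^{\mathrm L}(u))2\pi u\lambda\,du}\;e^{-\int_0^{r}\mathrm{Pr}^{\mathrm L}(u)2\pi u\lambda\,du}\;\mathrm{Pr}^{\mathrm L}_n(r)\,2\pi r\lambda,$$ $$f_{R,n}^{\mathrm{NL}}(r)=e^{-\int_0^{r_2}\mathrm{Pr}^{\mathrm L}(u)2\pi u\lambda\,du}\;e^{-\int_0^{r}(1-\mathrm{Pr}^{\mathrm L}(u))2\pi u\lambda\,du}\;(1-\mathrm{Pr}^{\mathrm L}_n(r))\,2\pi r\lambda,$$ $$p_n^{Path}(r)=\exp\left(-\frac{\gamma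 P_{\mathrm N}}{P\zeta_n^{Path}(r)}\right)\mathscr L^{Path}\left(\frac{\gamma}{P\zeta_n^{Path}(r)}\right),$$ $$\mathscr L^{\mathrm L}(s)=\exp\left(-2\pi\tilde\lambda\int_r^\infty\frac{\mathrm{Pr}^{\mathrm L}(u)\,u}{1+(sP\zeta^{\mathrm L}(u))^{-1}}du\right)\exp\left(-2\pi\tilde\lambda\int_{r_1}^\infty\frac{[1-\mathrm{Pr}^{\mathrm L}(u)]\,u}{1+(sP\zeta^{\mathrm{NL}}(u))^{-1}}du\right),$$ $$\mathscr L^{\mathrm{NL}}(s)=\exp\left(-2\pi\tilde\lambda\int_{r_2}^\infty\frac{\mathrm{Pr}^{\mathrm L}(u)\,u}{1+(sP\zeta^{\mathrm L}(u))^{-1}}du\right)\exp\left(-2\pi\tilde\lambda\int_{r}^\infty\frac{[1-\mathrm{Pr}^{\mathrm L}(u)]\,u}{1+(sP\zeta^{\mathrm{NL}}(u))^{-1}}du\right).$$ Moreover these ingredients have the following meaning. For $Path\in\{\mathrm L,\mathrm{NL}\}$ and each $n$, $f_{R,n}^{Path}$ is the density on $(d_{n-1},d_n]$ of the serving distance $R$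 on the event that the serving link is of type $Path$; $p_n^{Path}(r)$ is the conditional probability of $\mathrm{SINR}>\gamma$, and $\mathscr L^{Path}(s)$, for every $s>0$, is the conditional Laplace transform $\mathbb E[e^{-sI_{\mathrm{agg}}}]$, given that the serving link is of type $Path$ and $R=r$. That is, for every Borel set $A\subseteq(d_{n-1},d_n]$, the integrals over $A$ of $f_{R,n}^{Path}$, of $p_n^{Path}f_{R,n}^{Path}$ and of $\mathscr L^{Path}(s)f_{R,n}^{Path}$ equal, respectively, the probability of $E_A=\{\text{the serving link is of type }Path,\ R\in A\}$, the probability of $E_A\cap\{\mathrm{SINR}>\gamma\}$, and $\mathbb E[e^{-sI_{\mathrm{agg}}}\mathbf 1_{E_A}]$. -/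

import Mathlib

open MeasureTheory ProbabilityTheory Set
open scoped ENNReal NNReal

noncomputable section

/-- The plane; the typical user sits at the origin `0`. -/
abbrev Plane : Type := EuclideanSpace ℝ (Fin 2)

/-! ### The piecewise LoS/NLoS path-loss model -/

/-- The parameters of the piecewise path-loss model.  The pieces are indexed by `Fin N`; the piece
`n : Fin N` occupies the distances `d n.castSucc < r ≤ d n.succ`, where the first breakpoint is `0`
and the last one is `+∞` (so `N ≥ 1`).  On it the LoS and NLoS path-loss functions are
`AL n * r ^ (-αL n)` and `ANL n * r ^ (-αNL n)`, and a link of length `r` is LoS with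
probability `prL n r`. -/
structure PathLossModel where
  N : ℕ
  d : Fin (N + 1) → EReal
  d_zero : d 0 = 0
  d_last : d (Fin.last N) = ⊤
  d_strictMono : StrictMono d
  AL : Fin N → ℝ
  ANL : Fin N → ℝ
  αL : Fin N → ℝ
  αNL : Fin N → ℝ
  AL_pos : ∀ n, 0 < AL n
  ANL_pos : ∀ n, 0 < ANL n
  αL_pos : ∀ n, 0 < αL n
  αNL_pos : ∀ n, 0 < αNL n
  prL : Fin N → ℝ → ℝ
  measurable_prL : ∀ n, Measurable (prL n)
  prL_mem : ∀ (n : Fin N) (r : ℝ), d n.castSucc < (r : EReal) → (r : EReal) ≤ d n.succ →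
    prL n r ∈ Icc (0 : ℝ) 1

namespace PathLossModel

variable (M : PathLossModel)

/-- The distances belonging to the `n`-th piece.  (Distance `0` is left out: almost surely no
base station is at the origin.) -/
def piece (n : Fin M.N) : Set ℝ :=
  {r : ℝ | M.d n.castSucc < (r : EReal) ∧ (r : EReal) ≤ M.d n.succ}

/-- The function on distances that equals `f n` on the `n`-th piece. -/
def stack (f : Fin M.N → ℝ → ℝ) (r : ℝ) : ℝ := ∑ n, (M.piece n).indicator (f n) r

/-- The `n`-th piece of the LoS path-loss function. -/
def zetaLPiece (n : Fin M.N) (r : ℝ) : ℝ := M.AL n * r ^ (-M.αL n)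

/-- The `n`-th piece of the NLoS path-loss function. -/
def zetaNLPiece (n : Fin M.N) (r : ℝ) : ℝ := M.ANL n * r ^ (-M.αNL n)

/-- The stacked LoS path-loss function. -/
def zetaL : ℝ → ℝ := M.stack M.zetaLPiece

/-- The stacked NLoS path-loss function. -/
def zetaNL : ℝ → ℝ := M.stack M.zetaNLPiece

/-- The stacked LoS probability function. -/
def PrL : ℝ → ℝ := M.stack M.prL

end PathLossModel

/-! ### Poisson point processes and the network -/

/-- The random counting measure of a sequence of random points. -/
def countingMeasure {Ω : Type*} (X : ℕ → Ω → Plane) (ω : Ω) : Measure Plane :=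
  Measure.sum fun i => Measure.dirac (X i ω)

/-- The points `X 0, X 1, …` (in any order) form a homogeneous Poisson point process of intensity
`lam` on the plane: the number of points in a measurable set of finite area is Poisson with mean
`lam` times the area, and the numbers of points in disjoint sets are independent. -/
structure IsHomogeneousPPP {Ω : Type*} [MeasurableSpace Ω] (μ : Measure Ω) (lam : ℝ≥0)
    (X : ℕ → Ω → Plane) : Prop where
  measurable : ∀ i, Measurable (X i)
  count_law : ∀ B : Set Plane, MeasurableSet B → volume B < ∞ → ∀ k : ℕ,
    μ {ω | countingMeasure X ω B = k} = poissonMeasure (lam * (volume B).toNNReal) {k}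
  count_indep : ∀ (m : ℕ) (B : Fin m → Set Plane), (∀ j, MeasurableSet (B j)) →
    (∀ j, volume (B j) < ∞) → Pairwise (fun j k => Disjoint (B j) (B k)) →
    iIndepFun (fun j ω => countingMeasure X ω (B j)) μ

/-- The law of the mark of one base station: a uniform variable on `[0, 1]` (which decides between
LoS and NLoS), a unit-mean exponential channel gain (Rayleigh fading), and an activity flag that
is `true` with probability `q`. -/
def markLaw (q : ℝ≥0) : Measure (ℝ × ℝ × Bool) :=
  (volume.restrict (Icc (0 : ℝ) 1)).prod
    ((expMeasure 1).prod (q • Measure.dirac true + (1 - q) • Measure.dirac false))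

/-- A network: the base stations form a homogeneous Poisson point process of intensity `lam`, and
carry i.i.d. marks, independent of the positions.  Each base station is activated independently
with probability `lamA / lam`, so that the activated ones have intensity `lamA`. -/
structure Network (lam lamA : ℝ≥0) {Ω : Type*} [MeasurableSpace Ω] (μ : Measure Ω) where
  pos : ℕ → Ω → Plane
  unif : ℕ → Ω → ℝ
  fading : ℕ → Ω → ℝ
  active : ℕ → Ω → Bool
  measurable_unif : ∀ i, Measurable (unif i)
  measurable_fading : ∀ i, Measurable (fading i)
  measurable_active : ∀ i, Measurable (active i)
  ppp : IsHomogeneousPPP μ lam pos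
  mark_law : ∀ i, HasLaw (fun ω => (unif i ω, fading i ω, active i ω)) (markLaw (lamA / lam)) μ
  mark_iIndep : iIndepFun (fun i ω => (unif i ω, fading i ω, active i ω)) μ
  pos_indep_mark : IndepFun (fun ω i => pos i ω)
    (fun ω i => (unif i ω, fading i ω, active i ω)) μ

namespace Network

variable {lam lamA : ℝ≥0} {Ω : Type*} [MeasurableSpace Ω] {μ : Measure Ω}
  (W : Network lam lamA μ) (M : PathLossModel)

/-- The link from base station `i` to the typical user is LoS; given the positions this happens
with probability `Pr^L` of the link length, independently for different base stations. -/
def IsLoS (i : ℕ) (ω : Ω) : Prop := W.unif i ω ≤ M.PrL ‖W.pos i ω‖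

open Classical in
/-- The value `ζ` for the link from base station `i` to the typical user. -/
def zeta (i : ℕ) (ω : Ω) : ℝ :=
  if W.IsLoS M i ω then M.zetaL ‖W.pos i ω‖ else M.zetaNL ‖W.pos i ω‖

/-- Base station `i` has the smallest path loss to the typical user, i.e. the largest `ζ`. -/
def IsServing (i : ℕ) (ω : Ω) : Prop := ∀ j, W.zeta M j ω ≤ W.zeta M i ω

/-- The index of the base station serving the typical user (almost surely there is exactly one
candidate). -/
def serving (ω : Ω) : ℕ := sInf {i | W.IsServing M i ω}

/-- The serving distance. -/
def servingDist (ω : Ω) : ℝ := ‖W.pos (W.serving M ω) ω‖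

/-- The serving link is LoS. -/
def ServingLoS (ω : Ω) : Prop := W.IsLoS M (W.serving M ω) ω

/-- The aggregate interference: the total power received from the activated base stations other
than the serving one; it may be `∞`. -/
def interference (P : ℝ) (ω : Ω) : ℝ≥0∞ :=
  ∑' i : {i : ℕ // W.active i ω = true ∧ i ≠ W.serving M ω},
    ENNReal.ofReal (P * W.zeta M i ω * W.fading i ω)

/-- The SINR of the typical user. -/
def SINR (P PN : ℝ) (ω : Ω) : ℝ≥0∞ :=
  ENNReal.ofReal (P * W.zeta M (W.serving M ω) ω * W.fading (W.serving M ω) ω) /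
    (W.interference M P ω + ENNReal.ofReal PN)

/-- The coverage probability. -/
def coverageProb (P PN γ : ℝ) : ℝ≥0∞ := μ {ω | ENNReal.ofReal γ < W.SINR M P PN ω}

end Network

/-! ### The explicit expressions -/

/-- `e^{-x}` for `x ∈ [0, ∞]`, with `e^{-∞} = 0`. -/
def negExp (x : ℝ≥0∞) : ℝ := if x = ∞ then 0 else Real.exp (-x.toReal)

namespace PathLossModel

variable (M : PathLossModel)

/-- The density `f_{R,n}^L(r)` (the argument `r₁` is the equivalent NLoS distance of `r`). -/
def densityL (lam : ℝ) (n : Fin M.N) (r₁ r : ℝ) : ℝ :=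
  Real.exp (-∫ u in (0 : ℝ)..r₁, (1 - M.PrL u) * (2 * Real.pi * u * lam)) *
    Real.exp (-∫ u in (0 : ℝ)..r, M.PrL u * (2 * Real.pi * u * lam)) *
    M.prL n r * (2 * Real.pi * r * lam)

/-- The density `f_{R,n}^NL(r)` (the argument `r₂` is the equivalent LoS distance of `r`). -/
def densityNL (lam : ℝ) (n : Fin M.N) (r₂ r : ℝ) : ℝ :=
  Real.exp (-∫ u in (0 : ℝ)..r₂, M.PrL u * (2 * Real.pi * u * lam)) *
    Real.exp (-∫ u in (0 : ℝ)..r, (1 - M.PrL u) * (2 * Real.pi * u * lam)) *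
    (1 - M.prL n r) * (2 * Real.pi * r * lam)

/-- `exp (-2π λ̃ ∫_a^∞ Pr^L(u) u / (1 + (s P ζ^L(u))⁻¹) du)`. -/
def laplaceFactorL (lamA P s a : ℝ) : ℝ :=
  negExp (ENNReal.ofReal (2 * Real.pi * lamA) *
    ∫⁻ u in Ioi a, ENNReal.ofReal (M.PrL u * u / (1 + (s * P * M.zetaL u)⁻¹)))

/-- `exp (-2π λ̃ ∫_a^∞ (1 - Pr^L(u)) u / (1 + (s P ζ^NL(u))⁻¹) du)`. -/
def laplaceFactorNL (lamA P s a : ℝ) : ℝ :=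
  negExp (ENNReal.ofReal (2 * Real.pi * lamA) *
    ∫⁻ u in Ioi a, ENNReal.ofReal ((1 - M.PrL u) * u / (1 + (s * P * M.zetaNL u)⁻¹)))

/-- Laplace transform at `s` of the interference, for a LoS serving link of length `r`. -/
def laplaceL (lamA P : ℝ) (r₁ r s : ℝ) : ℝ :=
  M.laplaceFactorL lamA P s r * M.laplaceFactorNL lamA P s r₁

/-- Laplace transform at `s` of the interference, for a NLoS serving link of length `r`. -/
def laplaceNL (lamA P : ℝ) (r₂ r s : ℝ) : ℝ :=
  M.laplaceFactorL lamA P s r₂ * M.laplaceFactorNL lamA P s r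

/-- `Pr[P ζ_n^L(r) h / (I_agg + P_N) > γ]` for a LoS serving link of length `r`. -/
def condCoverageL (lamA P PN γ : ℝ) (n : Fin M.N) (r₁ r : ℝ) : ℝ :=
  Real.exp (-(γ * PN / (P * M.zetaLPiece n r))) *
    M.laplaceL lamA P r₁ r (γ / (P * M.zetaLPiece n r))

/-- `Pr[P ζ_n^NL(r) h / (I_agg + P_N) > γ]` for a NLoS serving link of length `r`. -/
def condCoverageNL (lamA P PN γ : ℝ) (n : Fin M.N) (r₂ r : ℝ) : ℝ :=
  Real.exp (-(γ * PN / (P * M.zetaNLPiece n r))) *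
    M.laplaceNL lamA P r₂ r (γ / (P * M.zetaNLPiece n r))

/-- The term `T_n^L`. -/
def termL (lam lamA P PN γ : ℝ) (r₁ : ℝ → ℝ) (n : Fin M.N) : ℝ≥0∞ :=
  ∫⁻ r in M.piece n,
    ENNReal.ofReal (M.condCoverageL lamA P PN γ n (r₁ r) r * M.densityL lam n (r₁ r) r)

/-- The term `T_n^NL`. -/
def termNL (lam lamA P PN γ : ℝ) (r₂ : ℝ → ℝ) (n : Fin M.N) : ℝ≥0∞ :=
  ∫⁻ r in M.piece n,
    ENNReal.ofReal (M.condCoverageNL lamA P PN γ n (r₂ r) r * M.densityNL lam n (r₂ r) r)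

end PathLossModel

end

/-!
The proof rests on Mecke's formula for the Poisson point process of the base stations. Almost surely
exactly one base station has the largest path-loss value `ζ`: only finitely many exceed a given
level, and ties are excluded because the second factorial moment measure of the process is a
multiple of the product of the Lebesgue measures (`IsHomogeneousPPP.lintegral_countOthers`), for
which the pairs of positions with equal path-loss values are null. A functional of the serving base
station is therefore the sum over all base stations `i` of the functional times the indicator that
no other base station beats `i`.

For each candidate `i`, with path-loss value `t`, the indicator and the interference are combined in
one exponent: another base station costs `∞` if its path-loss value exceeds `t`, and otherwise
`σ t` times its received power if it is active (`PathLossModel.cost`). So `e^{-U}`, for the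
total cost `U` of the others, is the indicator that `i` serves times `e^{-σ t I_agg}`
(`Network.totalCost_serving`, `Network.totalCost_of_not_isServing`). The choice `σ t = 0` gives the
law of the serving distance, a constant `σ` the Laplace transform of the interference, and
`σ t = γ / (P t)` the coverage probability, since the channel gain of the serving link is
exponential: the gain exceeds a level `K` with probability `e^{-K}`.

The marks are independent of the positions and of each other and can be integrated out, which
turns the exponent into a sum over the other points of a function that depends on `i` only through
the threshold `t` (`Network.lintegral_typeInd_mul`). Mecke's formula for such functionals
(`IsHomogeneousPPP.mecke_threshold`) is obtained from the Poisson counts of disjoint sets in steps: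
step functions, for which it is the size-bias identity `k P(N = k) = E[N] P(N = k - 1)`; a fixed
function by monotone approximation; a function depending on the chosen point through countably
many values; and a general threshold by dyadic rounding from above, the removal probability being
decreasing and right-continuous in `t`.

In polar coordinates the resulting exponent is the integral over the distances `u` of the
probability that a base station at distance `u` is removed. Since the path-loss functions decrease
strictly, a link of a given type is stronger than `t` exactly when it is shorter than the equivalent
distance. The shorter links are removed with probability one, which gives the void probabilities in
the densities, and the longer ones give the Laplace factors (`expNeg_lintegral_removalOf`).
-/

/-! ### The exponential on `[0, ∞]` and sums over all indices but one -/

theorem negExp_nonneg (x : ℝ≥0∞) : 0 ≤ negExp x := by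
  unfold negExp
  split_ifs
  · exact le_rfl
  · exact (Real.exp_pos _).le

/-- The map `x ↦ e^{-x}` from `[0, ∞]` to `[0, 1] ⊆ [0, ∞]`, with `e^{-∞} = 0`. -/
noncomputable def expNeg (x : ℝ≥0∞) : ℝ≥0∞ := EReal.exp (-(x : EReal))

theorem expNeg_eq_ofReal_negExp (x : ℝ≥0∞) : expNeg x = ENNReal.ofReal (negExp x) := by
  induction x with
  | top => simp [expNeg, negExp]
  | coe x =>
    simp only [expNeg, negExp, ENNReal.coe_ne_top, if_false, ENNReal.coe_toReal]
    exact EReal.exp_coe (-(x : ℝ))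

@[simp] theorem expNeg_zero : expNeg 0 = 1 := by simp [expNeg]

@[simp] theorem expNeg_top : expNeg ∞ = 0 := by simp [expNeg]

theorem expNeg_add (x y : ℝ≥0∞) : expNeg (x + y) = expNeg x * expNeg y := by
  rw [expNeg, expNeg, expNeg, ← EReal.exp_add, EReal.coe_ennreal_add, EReal.neg_add, sub_eq_add_neg]
  · simp
  · simp

theorem expNeg_antitone : Antitone expNeg := fun x y h =>
  EReal.exp_monotone (by simpa using h)

theorem expNeg_le_one (x : ℝ≥0∞) : expNeg x ≤ 1 := by
  simpa using expNeg_antitone (zero_le (a := x))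

theorem expNeg_ne_top (x : ℝ≥0∞) : expNeg x ≠ ∞ :=
  ne_top_of_le_ne_top ENNReal.one_ne_top (expNeg_le_one x)

theorem continuous_expNeg : Continuous expNeg :=
  ENNReal.continuous_exp.comp (continuous_neg.comp continuous_coe_ennreal_ereal)

@[fun_prop]
theorem measurable_expNeg : Measurable expNeg := continuous_expNeg.measurable

theorem expNeg_ofReal {x : ℝ} (hx : 0 ≤ x) :
    expNeg (ENNReal.ofReal x) = ENNReal.ofReal (Real.exp (-x)) := by
  rw [expNeg_eq_ofReal_negExp, negExp, if_neg ENNReal.ofReal_ne_top, ENNReal.toReal_ofReal hx]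

theorem expNeg_iSup {ι : Sort*} [Nonempty ι] (a : ι → ℝ≥0∞) :
    expNeg (⨆ n, a n) = ⨅ n, expNeg (a n) :=
  expNeg_antitone.map_ciSup_of_continuousAt continuous_expNeg.continuousAt (OrderTop.bddAbove _)

theorem expNeg_sum {ι : Type*} (s : Finset ι) (a : ι → ℝ≥0∞) :
    expNeg (∑ k ∈ s, a k) = ∏ k ∈ s, expNeg (a k) := by
  classical
  induction s using Finset.induction_on with
  | empty => simp
  | insert k s hk ih => rw [Finset.sum_insert hk, Finset.prod_insert hk, expNeg_add, ih]

/-- `1 - e^{-x}` commutes with suprema. -/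
theorem one_sub_expNeg_iSup {ι : Sort*} [Nonempty ι] (a : ι → ℝ≥0∞) :
    1 - expNeg (⨆ n, a n) = ⨆ n, (1 - expNeg (a n)) := by
  rw [expNeg_iSup, ENNReal.sub_iInf]

/-- The function `v ↦ -log v` from `[0, 1]` to `[0, ∞]`, inverse to `expNeg`. -/
noncomputable def negLog (v : ℝ≥0∞) : ℝ≥0∞ := (-ENNReal.log v).toENNReal

theorem expNeg_negLog {v : ℝ≥0∞} (hv : v ≤ 1) : expNeg (negLog v) = v := by
  have h : 0 ≤ -ENNReal.log v := by
    rw [EReal.le_neg, neg_zero]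
    simpa using ENNReal.log_monotone hv
  rw [expNeg, negLog, EReal.coe_toENNReal h, neg_neg, ENNReal.exp_log]

theorem negLog_antitone : Antitone negLog := fun x y h =>
  EReal.toENNReal_le_toENNReal (by simpa using ENNReal.log_monotone h)

@[fun_prop]
theorem measurable_negLog : Measurable negLog := by
  unfold negLog
  exact ((continuous_neg.measurable).comp ENNReal.measurable_log).ereal_toENNReal

theorem negLog_one : negLog 1 = 0 := by simp [negLog]

/-- The sum of the terms of a sequence other than the `i`-th one. -/
noncomputable def sumOthers (i : ℕ) (a : ℕ → ℝ≥0∞) : ℝ≥0∞ := ∑' j, if j = i then 0 else a j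

theorem add_sumOthers (i : ℕ) (a : ℕ → ℝ≥0∞) : a i + sumOthers i a = ∑' j, a j := by
  rw [ENNReal.tsum_eq_add_tsum_ite i, sumOthers]
  congr!

theorem measurable_sumOthers {α : Type*} [MeasurableSpace α] {a : ℕ → α → ℝ≥0∞} (i : ℕ)
    (ha : ∀ j, Measurable (a j)) : Measurable fun x => sumOthers i fun j => a j x := by
  unfold sumOthers
  refine Measurable.tsum fun j => ?_
  split_ifs
  · exact measurable_const
  · exact ha j

theorem sumOthers_mono (i : ℕ) {a b : ℕ → ℝ≥0∞} (h : ∀ j, a j ≤ b j) :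
    sumOthers i a ≤ sumOthers i b := by
  unfold sumOthers
  refine ENNReal.tsum_le_tsum fun j => ?_
  split_ifs
  · exact le_rfl
  · exact h j

/-- Monotone convergence for sums. -/
theorem tsum_iSup_of_monotone {a : ℕ → ℕ → ℝ≥0∞} (h : ∀ j, Monotone fun n => a n j) :
    ∑' j, ⨆ n, a n j = ⨆ n, ∑' j, a n j := by
  simp_rw [← lintegral_count]
  exact lintegral_iSup (fun n => measurable_from_top) fun n m hnm j => h j hnm

theorem sumOthers_iSup (i : ℕ) {a : ℕ → ℕ → ℝ≥0∞} (h : ∀ j, Monotone fun n => a n j) :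
    sumOthers i (fun j => ⨆ n, a n j) = ⨆ n, sumOthers i (a n) := by
  unfold sumOthers
  rw [← tsum_iSup_of_monotone]
  · refine tsum_congr fun j => ?_
    split_ifs <;> simp
  · intro j n m hnm
    dsimp only
    split_ifs
    · exact le_rfl
    · exact h j hnm

theorem sumOthers_add (i : ℕ) (a b : ℕ → ℝ≥0∞) :
    sumOthers i (fun j => a j + b j) = sumOthers i a + sumOthers i b := by
  unfold sumOthers
  rw [← ENNReal.tsum_add]
  refine tsum_congr fun j => ?_
  split_ifs <;> simp

theorem sumOthers_const_mul (i : ℕ) (c : ℝ≥0∞) (a : ℕ → ℝ≥0∞) :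
    sumOthers i (fun j => c * a j) = c * sumOthers i a := by
  unfold sumOthers
  rw [← ENNReal.tsum_mul_left]
  refine tsum_congr fun j => ?_
  split_ifs <;> simp

theorem sumOthers_sum {ι : Type*} (s : Finset ι) (i : ℕ) (a : ι → ℕ → ℝ≥0∞) :
    sumOthers i (fun j => ∑ k ∈ s, a k j) = ∑ k ∈ s, sumOthers i (a k) := by
  unfold sumOthers
  rw [← Summable.tsum_finsetSum (fun _ _ => ENNReal.summable)]
  refine tsum_congr fun j => ?_
  split_ifs <;> simp

theorem sumOthers_congr {i : ℕ} {a b : ℕ → ℝ≥0∞} (h : ∀ j, j ≠ i → a j = b j) :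
    sumOthers i a = sumOthers i b := by
  unfold sumOthers
  refine tsum_congr fun j => ?_
  split_ifs with hj
  · rfl
  · exact h j hj

/-- Dominated convergence for a decreasing sequence of series of integrals. -/
theorem tsum_lintegral_iInf {Ω : Type*} [MeasurableSpace Ω] {μ : Measure Ω} [SFinite μ]
    {F : ℕ → ℕ → Ω → ℝ≥0∞} (hF : ∀ n i, Measurable (F n i))
    (hanti : ∀ i ω, Antitone fun n => F n i ω) (hfin : ∑' i, ∫⁻ ω, F 0 i ω ∂μ ≠ ∞) :
    ∑' i, ∫⁻ ω, ⨅ n, F n i ω ∂μ = ⨅ n, ∑' i, ∫⁻ ω, F n i ω ∂μ := by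
  have key : ∀ G : ℕ → Ω → ℝ≥0∞, (∀ i, Measurable (G i)) →
      ∑' i, ∫⁻ ω, G i ω ∂μ = ∫⁻ p, G p.1 p.2 ∂((Measure.count : Measure ℕ).prod μ) := by
    intro G hG
    have hG' : Measurable fun p : ℕ × Ω => G p.1 p.2 := measurable_from_prod_countable_right hG
    rw [lintegral_prod _ hG'.aemeasurable, lintegral_count]
  rw [key _ (fun i => Measurable.iInf fun n => hF n i)]
  simp_rw [key _ (hF _)]
  refine lintegral_iInf (fun n => ?_) (fun n m h p => hanti p.1 p.2 h) ?_
  · exact measurable_from_prod_countable_right (hF n)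
  · rwa [← key _ (hF 0)]

/-! ### Counts of a Poisson point process -/

theorem countingMeasure_apply {Ω : Type*} (X : ℕ → Ω → Plane) (ω : Ω) {B : Set Plane}
    (hB : MeasurableSet B) :
    countingMeasure X ω B = ∑' i, B.indicator 1 (X i ω) := by
  rw [countingMeasure, Measure.sum_apply _ hB]
  exact tsum_congr fun i => Measure.dirac_apply' _ hB

/-- The size-bias identity of the Poisson law, in terms of its weights. -/
theorem tsum_mul_poissonMeasure (a : ℝ≥0) (φ : ℕ → ℝ≥0∞) :
    ∑' k : ℕ, k * φ (k - 1) * poissonMeasure a {k} = a * ∑' k : ℕ, φ k * poissonMeasure a {k} := by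
  rw [tsum_eq_zero_add' ENNReal.summable, ← ENNReal.tsum_mul_left]
  simp only [Nat.cast_zero, zero_mul, zero_add, Nat.add_sub_cancel]
  refine tsum_congr fun k => ?_
  have hk : ((k + 1 : ℕ) : ℝ≥0∞) * poissonMeasure a {k + 1} = a * poissonMeasure a {k} := by
    rw [poissonMeasure_singleton, poissonMeasure_singleton, ← ENNReal.ofReal_natCast,
      ← ENNReal.ofReal_coe_nnreal, ← ENNReal.ofReal_mul (by positivity),
      ← ENNReal.ofReal_mul (by positivity)]
    congr 1
    rw [Nat.factorial_succ]
    push_cast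
    field_simp
    ring
  rw [mul_right_comm, hk]
  ring

theorem tsum_poissonMeasure (a : ℝ≥0) : ∑' k : ℕ, poissonMeasure a {k} = 1 := by
  rw [← measure_iUnion (fun i j hij => by simpa using hij) (fun i => measurableSet_singleton i),
    iUnion_of_singleton, measure_univ]

/-- The probability generating function of the Poisson distribution, at `e^{-c}`. -/
theorem tsum_expNeg_mul_poissonMeasure (a : ℝ≥0) (c : ℝ≥0∞) :
    ∑' k : ℕ, expNeg (c * k) * poissonMeasure a {k} = expNeg (a * (1 - expNeg c)) := by
  have h1 := expNeg_le_one c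
  obtain ⟨v, hv⟩ : ∃ v : ℝ≥0, expNeg c = v := ⟨_, (ENNReal.coe_toNNReal (expNeg_ne_top c)).symm⟩
  have hpow : ∀ k : ℕ, expNeg (c * k) = (v : ℝ≥0∞) ^ k := by
    intro k
    induction k with
    | zero => simp
    | succ k ih => rw [Nat.cast_succ, mul_add, mul_one, expNeg_add, ih, hv, pow_succ]
  have hv1 : v ≤ 1 := by rw [hv] at h1; exact_mod_cast h1
  have h2 : (a : ℝ≥0∞) * (1 - expNeg c) = ENNReal.ofReal (a * (1 - v)) := by
    rw [hv, ENNReal.ofReal_mul (by positivity), ENNReal.ofReal_coe_nnreal,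
      ENNReal.ofReal_sub _ (by positivity), ENNReal.ofReal_coe_nnreal, ENNReal.ofReal_one]
  have hv1' : (v : ℝ) ≤ 1 := hv1
  rw [h2, expNeg_ofReal (mul_nonneg (by positivity) (by linarith))]
  have h3 : HasSum (fun k : ℕ => Real.exp (-a) * ((a * v : ℝ) ^ k / (Nat.factorial k)))
      (Real.exp (-a) * Real.exp (a * v)) := by
    rw [Real.exp_eq_exp_ℝ]
    exact (NormedSpace.expSeries_div_hasSum_exp (a * v : ℝ)).mul_left _
  rw [← Real.exp_add] at h3
  have h4 : (-a + a * v : ℝ) = -(a * (1 - v)) := by ring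
  rw [h4] at h3
  rw [← h3.tsum_eq, ENNReal.ofReal_tsum_of_nonneg (fun k => by positivity) h3.summable]
  refine tsum_congr fun k => ?_
  rw [hpow, poissonMeasure_singleton, ← ENNReal.ofReal_coe_nnreal,
    ← ENNReal.ofReal_pow (by positivity), ← ENNReal.ofReal_mul (by positivity)]
  congr 1
  rw [mul_pow]
  ring

theorem tsum_natCast_mul_poissonMeasure (a : ℝ≥0) :
    ∑' k : ℕ, k * poissonMeasure a {k} = a := by
  have h := tsum_mul_poissonMeasure a fun _ => 1
  simpa [tsum_poissonMeasure] using h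

namespace IsHomogeneousPPP

variable {Ω : Type*} [MeasurableSpace Ω] {μ : Measure Ω} {lam : ℝ≥0} {X : ℕ → Ω → Plane}

theorem measurable_count (h : IsHomogeneousPPP μ lam X) {B : Set Plane} (hB : MeasurableSet B) :
    Measurable fun ω => countingMeasure X ω B := by
  simp_rw [countingMeasure_apply X _ hB]
  exact Measurable.tsum fun i => (measurable_one.indicator hB).comp (h.measurable i)

/-- A count is almost surely finite and natural, so that its expectations are series over the
Poisson weights. -/
theorem lintegral_comp_count [IsProbabilityMeasure μ] (h : IsHomogeneousPPP μ lam X)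
    {B : Set Plane} (hB : MeasurableSet B) (hfin : volume B ≠ ∞) (φ : ℝ≥0∞ → ℝ≥0∞) :
    ∫⁻ ω, φ (countingMeasure X ω B) ∂μ =
      ∑' k : ℕ, φ k * poissonMeasure (lam * (volume B).toNNReal) {k} := by
  have hm := h.measurable_count hB
  set S : ℕ → Set Ω := fun k => {ω | countingMeasure X ω B = k}
  have hS : ∀ k, MeasurableSet (S k) := fun k => hm (measurableSet_singleton (k : ℝ≥0∞))
  have hd : Pairwise (fun j k => Disjoint (S j) (S k)) := by
    intro j k hjk
    rw [Set.disjoint_left]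
    intro ω hj hk
    simp only [S, mem_ofPred_eq] at hj hk
    rw [hj] at hk
    exact hjk (by exact_mod_cast hk)
  have hlaw : ∀ k, μ (S k) = poissonMeasure (lam * (volume B).toNNReal) {k} :=
    h.count_law B hB hfin.lt_top
  have hU : μ (⋃ k, S k) = 1 := by
    rw [measure_iUnion hd hS]
    simp_rw [hlaw]
    exact tsum_poissonMeasure _
  have hU' : (⋃ k, S k) =ᵐ[μ] univ := by
    rw [ae_eq_univ, measure_compl (MeasurableSet.iUnion hS) (measure_ne_top _ _), hU]
    simp
  rw [← setLIntegral_univ, ← setLIntegral_congr hU', lintegral_iUnion hS hd]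
  refine tsum_congr fun k => ?_
  rw [setLIntegral_congr_fun (g := fun _ => φ k) (hS k) fun ω hω => by rw [show _ = _ from hω],
    setLIntegral_const, hlaw]

theorem coe_mul_toNNReal {B : Set Plane} (hfin : volume B ≠ ∞) :
    ((lam * (volume B).toNNReal : ℝ≥0) : ℝ≥0∞) = lam * volume B := by
  rw [ENNReal.coe_mul, ENNReal.coe_toNNReal hfin]

theorem lintegral_count [IsProbabilityMeasure μ] (h : IsHomogeneousPPP μ lam X)
    {B : Set Plane} (hB : MeasurableSet B)
    (hfin : volume B ≠ ∞) : ∫⁻ ω, countingMeasure X ω B ∂μ = lam * volume B := by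
  rw [h.lintegral_comp_count hB hfin fun x => x, tsum_natCast_mul_poissonMeasure,
    coe_mul_toNNReal hfin]

theorem lintegral_expNeg_count [IsProbabilityMeasure μ] (h : IsHomogeneousPPP μ lam X)
    {B : Set Plane} (hB : MeasurableSet B) (hfin : volume B ≠ ∞) (c : ℝ≥0∞) :
    ∫⁻ ω, expNeg (c * countingMeasure X ω B) ∂μ = expNeg (lam * volume B * (1 - expNeg c)) := by
  rw [h.lintegral_comp_count hB hfin fun x => expNeg (c * x), tsum_expNeg_mul_poissonMeasure,
    coe_mul_toNNReal hfin]

/-- The size-bias identity `E[N φ(N - 1)] = E[N] E[φ(N)]` of the Poisson law, for a count `N`. -/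
theorem lintegral_count_mul [IsProbabilityMeasure μ] (h : IsHomogeneousPPP μ lam X) {B : Set Plane}
    (hB : MeasurableSet B) (hfin : volume B ≠ ∞) (φ : ℝ≥0∞ → ℝ≥0∞) :
    ∫⁻ ω, countingMeasure X ω B * φ (countingMeasure X ω B - 1) ∂μ =
      lam * volume B * ∫⁻ ω, φ (countingMeasure X ω B) ∂μ := by
  rw [h.lintegral_comp_count hB hfin fun x => x * φ (x - 1), h.lintegral_comp_count hB hfin φ,
    ← coe_mul_toNNReal hfin, ← tsum_mul_poissonMeasure _ fun k => φ k]
  refine tsum_congr fun k => ?_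
  rw [ENNReal.natCast_sub, Nat.cast_one]

/-- Counts of disjoint sets are independent, for an arbitrary finite family of sets. -/
theorem lintegral_prod_count (h : IsHomogeneousPPP μ lam X) {ι : Type*} [Fintype ι]
    {B : ι → Set Plane} (hB : ∀ k, MeasurableSet (B k)) (hfin : ∀ k, volume (B k) ≠ ∞)
    (hd : Pairwise fun j k => Disjoint (B j) (B k)) {φ : ι → ℝ≥0∞ → ℝ≥0∞}
    (hφ : ∀ k, Measurable (φ k)) :
    ∫⁻ ω, ∏ k, φ k (countingMeasure X ω (B k)) ∂μ =
      ∏ k, ∫⁻ ω, φ k (countingMeasure X ω (B k)) ∂μ := by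
  let e := Fintype.equivFin ι
  have hi : iIndepFun (fun k ω => countingMeasure X ω (B k)) μ := by
    have := h.count_indep (Fintype.card ι) (fun j => B (e.symm j)) (fun j => hB _)
      (fun j => (hfin _).lt_top) (fun j k hjk => hd (e.symm.injective.ne hjk))
    simpa [Function.comp_def] using this.precomp e.injective
  exact lintegral_prod_eq_prod_lintegral_of_indepFun Finset.univ _ (hi.comp φ hφ)
    fun k => (hφ k).comp (h.measurable_count (hB k))

/-- The number of points with index different from `i` in a set. -/
noncomputable def _root_.countOthers {Ω : Type*} (X : ℕ → Ω → Plane) (i : ℕ) (ω : Ω)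
    (B : Set Plane) : ℝ≥0∞ :=
  sumOthers i fun j => B.indicator 1 (X j ω)

/-- The Mecke formula for functions of the counts of finitely many disjoint sets. -/
theorem mecke_count [IsProbabilityMeasure μ] (h : IsHomogeneousPPP μ lam X) {ι : Type*} [Fintype ι]
    {B : ι → Set Plane} (hB : ∀ k, MeasurableSet (B k)) (hfin : ∀ k, volume (B k) ≠ ∞)
    (hd : Pairwise fun j k => Disjoint (B j) (B k)) {φ : ι → ℝ≥0∞ → ℝ≥0∞}
    (hφ : ∀ k, Measurable (φ k)) (k₀ : ι) :
    ∑' i, ∫⁻ ω, (B k₀).indicator 1 (X i ω) * ∏ k, φ k (countOthers X i ω (B k)) ∂μ =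
      lam * volume (B k₀) * ∫⁻ ω, ∏ k, φ k (countingMeasure X ω (B k)) ∂μ := by
  classical
  have hmeas : ∀ i, Measurable fun ω =>
      (B k₀).indicator 1 (X i ω) * ∏ k, φ k (countOthers X i ω (B k)) := by
    intro i
    refine ((measurable_one.indicator (hB k₀)).comp (h.measurable i)).mul
      (Finset.measurable_prod _ fun k _ => (hφ k).comp ?_)
    exact measurable_sumOthers i fun j => (measurable_one.indicator (hB k)).comp (h.measurable j)
  rw [← lintegral_tsum fun i => (hmeas i).aemeasurable]
  -- the factor of `k₀` is replaced by its size-biased version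
  let ψ : ι → ℝ≥0∞ → ℝ≥0∞ := Function.update φ k₀ fun x => x * φ k₀ (x - 1)
  have hψ : ∀ k, Measurable (ψ k) := by
    intro k
    by_cases hk : k = k₀
    · subst hk
      simp only [ψ, Function.update_self]
      exact measurable_id.mul ((hφ k).comp (measurable_id.sub_const 1))
    · simp only [ψ, Function.update_of_ne hk]
      exact hφ k
  have hpt : ∀ ω, ∑' i, (B k₀).indicator 1 (X i ω) * ∏ k, φ k (countOthers X i ω (B k)) =
      ∏ k, ψ k (countingMeasure X ω (B k)) := by
    intro ω
    have hterm : ∀ i, (B k₀).indicator 1 (X i ω) * ∏ k, φ k (countOthers X i ω (B k)) =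
        (B k₀).indicator 1 (X i ω) * (φ k₀ (countingMeasure X ω (B k₀) - 1) *
          ∏ k ∈ Finset.univ.erase k₀, φ k (countingMeasure X ω (B k))) := by
      intro i
      by_cases hi : X i ω ∈ B k₀
      · rw [← Finset.mul_prod_erase _ _ (Finset.mem_univ k₀)]
        congr 2
        · rw [countingMeasure_apply X ω (hB k₀), ← add_sumOthers i, indicator_of_mem hi,
            Pi.one_apply, ENNReal.add_sub_cancel_left ENNReal.one_ne_top]
          rfl
        · refine Finset.prod_congr rfl fun k hk => ?_
          have hik : X i ω ∉ B k := fun hik =>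
            Set.disjoint_left.mp (hd (Finset.ne_of_mem_erase hk)) hik hi
          rw [countingMeasure_apply X ω (hB k), ← add_sumOthers i, indicator_of_notMem hik,
            zero_add]
          rfl
      · simp [indicator_of_notMem hi]
    simp_rw [hterm]
    rw [ENNReal.tsum_mul_right, ← countingMeasure_apply X ω (hB k₀),
      ← Finset.mul_prod_erase _ _ (Finset.mem_univ k₀), ← mul_assoc]
    congr 1
    · simp [ψ]
    · refine Finset.prod_congr rfl fun k hk => ?_
      simp [ψ, Function.update_of_ne (Finset.ne_of_mem_erase hk)]
  simp_rw [hpt]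
  rw [h.lintegral_prod_count hB hfin hd hψ, h.lintegral_prod_count hB hfin hd hφ,
    ← Finset.mul_prod_erase _ _ (Finset.mem_univ k₀),
    ← Finset.mul_prod_erase _ (fun k => ∫⁻ ω, φ k (countingMeasure X ω (B k)) ∂μ)
      (Finset.mem_univ k₀), ← mul_assoc]
  congr 1
  · simp only [ψ, Function.update_self]
    exact h.lintegral_count_mul (hB k₀) (hfin k₀) (φ k₀)
  · refine Finset.prod_congr rfl fun k hk => ?_
    simp [ψ, Function.update_of_ne (Finset.ne_of_mem_erase hk)]

end IsHomogeneousPPP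

/-! ### Pairs of points of a Poisson point process -/

/-- Linearity in the test function `f` of the expressions occurring in Mecke's formula. -/
theorem tsum_lintegral_tsum_mul {Ω ι α : Type*} [Countable ι] [MeasurableSpace Ω]
    [MeasurableSpace α] {μ : Measure Ω} {X : ℕ → Ω → α} (hX : ∀ i, Measurable (X i))
    {f : ι → α → ℝ≥0∞} (hf : ∀ v, Measurable (f v)) {w : ℕ → Ω → ℝ≥0∞}
    (hw : ∀ i, Measurable (w i)) :
    ∑' i, ∫⁻ ω, (∑' v, f v (X i ω)) * w i ω ∂μ = ∑' v, ∑' i, ∫⁻ ω, f v (X i ω) * w i ω ∂μ := by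
  rw [ENNReal.tsum_comm]
  refine tsum_congr fun i => ?_
  simp_rw [← ENNReal.tsum_mul_right]
  exact lintegral_tsum fun v => (((hf v).comp (hX i)).mul (hw i)).aemeasurable

namespace IsHomogeneousPPP

variable {Ω : Type*} [MeasurableSpace Ω] {μ : Measure Ω} {lam : ℝ≥0} {X : ℕ → Ω → Plane}

theorem measurable_countOthers (h : IsHomogeneousPPP μ lam X) (i : ℕ) {B : Set Plane}
    (hB : MeasurableSet B) : Measurable fun ω => countOthers X i ω B :=
  measurable_sumOthers i fun j => (measurable_one.indicator hB).comp (h.measurable j)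

variable [IsProbabilityMeasure μ]

/-- The second factorial moment measure, on a product of sets of which the first one either is
contained in the second one or is disjoint from it. -/
theorem lintegral_countOthers_of_subset_or_disjoint (h : IsHomogeneousPPP μ lam X) {B C : Set Plane}
    (hB : MeasurableSet B) (hC : MeasurableSet C) (hBfin : volume B ≠ ∞) (hCfin : volume C ≠ ∞)
    (hBC : B ⊆ C ∨ Disjoint B C) :
    ∑' i, ∫⁻ ω, B.indicator 1 (X i ω) * countOthers X i ω C ∂μ =
      lam * volume B * (lam * volume C) := by
  have hind : ∀ i, Measurable fun ω => B.indicator (1 : Plane → ℝ≥0∞) (X i ω) := fun i =>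
    (measurable_one.indicator hB).comp (h.measurable i)
  have hdisj : ∀ D : Set Plane, MeasurableSet D → volume D ≠ ∞ → Disjoint B D →
      ∑' i, ∫⁻ ω, B.indicator 1 (X i ω) * countOthers X i ω D ∂μ =
        lam * volume B * (lam * volume D) := by
    intro D hD hDfin hBD
    have := h.mecke_count (ι := Bool) (B := fun b => if b then B else D)
      (φ := fun b => if b then fun _ => 1 else fun x => x)
      (by rintro (_ | _) <;> simpa) (by rintro (_ | _) <;> simpa)
      (by
        rintro (_ | _) (_ | _) hjk
        · simp at hjk
        · simpa using hBD.symm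
        · simpa using hBD
        · simp at hjk)
      (by rintro (_ | _) <;> simp only [Bool.false_eq_true, if_false, if_true] <;> fun_prop) true
    simpa [h.lintegral_count hD hDfin] using this
  have hself : ∑' i, ∫⁻ ω, B.indicator 1 (X i ω) * countOthers X i ω B ∂μ =
      lam * volume B * (lam * volume B) := by
    have := h.mecke_count (ι := Unit) (B := fun _ => B) (φ := fun _ x => x)
      (fun _ => hB) (fun _ => hBfin) (fun _ _ hjk => absurd rfl hjk) (fun _ => measurable_id) ()
    simpa [h.lintegral_count hB hBfin] using this
  rcases hBC with hBC | hBC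
  · have hsplit : ∀ i ω, countOthers X i ω C = countOthers X i ω B + countOthers X i ω (C \ B) := by
      intro i ω
      unfold countOthers
      rw [← sumOthers_add]
      congr 1
      ext j
      by_cases h1 : X j ω ∈ B
      · simp [h1, hBC h1]
      · by_cases h2 : X j ω ∈ C <;> simp [h1, h2]
    simp_rw [hsplit, mul_add]
    have : ∀ i, ∫⁻ ω, B.indicator 1 (X i ω) * countOthers X i ω B +
        B.indicator 1 (X i ω) * countOthers X i ω (C \ B) ∂μ =
        ∫⁻ ω, B.indicator 1 (X i ω) * countOthers X i ω B ∂μ +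
        ∫⁻ ω, B.indicator 1 (X i ω) * countOthers X i ω (C \ B) ∂μ := fun i =>
      lintegral_add_left ((hind i).mul (h.measurable_countOthers i hB)) _
    simp_rw [this]
    rw [ENNReal.tsum_add, hself, hdisj _ (hC.diff hB) (measure_ne_top_of_subset sdiff_subset hCfin)
      disjoint_sdiff_right, ← mul_add, ← mul_add, measure_sdiff hBC hB.nullMeasurableSet hBfin,
      add_tsub_cancel_of_le (measure_mono hBC)]
  · exact hdisj C hC hCfin hBC

/-- The second factorial moment measure of a homogeneous Poisson point process on products of
sets of finite area. -/
theorem lintegral_countOthers (h : IsHomogeneousPPP μ lam X) {B C : Set Plane}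
    (hB : MeasurableSet B) (hC : MeasurableSet C) (hBfin : volume B ≠ ∞) (hCfin : volume C ≠ ∞) :
    ∑' i, ∫⁻ ω, B.indicator 1 (X i ω) * countOthers X i ω C ∂μ =
      lam * volume B * (lam * volume C) := by
  have h1 := h.lintegral_countOthers_of_subset_or_disjoint (hB.inter hC) hC
    (measure_ne_top_of_subset inter_subset_left hBfin) hCfin (Or.inl inter_subset_right)
  have h2 := h.lintegral_countOthers_of_subset_or_disjoint (hB.diff hC) hC
    (measure_ne_top_of_subset sdiff_subset hBfin) hCfin (Or.inr disjoint_sdiff_left)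
  have hsplit : ∀ i ω, B.indicator 1 (X i ω) * countOthers X i ω C =
      (B ∩ C).indicator 1 (X i ω) * countOthers X i ω C +
        (B \ C).indicator 1 (X i ω) * countOthers X i ω C := by
    intro i ω
    by_cases h1 : X i ω ∈ B <;> by_cases h2 : X i ω ∈ C <;> simp [h1, h2]
  simp_rw [hsplit]
  have hadd : ∀ i, ∫⁻ ω, (B ∩ C).indicator 1 (X i ω) * countOthers X i ω C +
      (B \ C).indicator 1 (X i ω) * countOthers X i ω C ∂μ =
      ∫⁻ ω, (B ∩ C).indicator 1 (X i ω) * countOthers X i ω C ∂μ +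
      ∫⁻ ω, (B \ C).indicator 1 (X i ω) * countOthers X i ω C ∂μ := fun i =>
    lintegral_add_left (((measurable_one.indicator (hB.inter hC)).comp (h.measurable i)).mul
      (h.measurable_countOthers i hC)) _
  simp_rw [hadd]
  rw [ENNReal.tsum_add, h1, h2, ← add_mul, ← mul_add, measure_inter_add_sdiff B hC]

/-- Almost surely no two different points of the process are in a relation that is null for the
product of the Lebesgue measures. -/
theorem ae_forall_pair_notMem (h : IsHomogeneousPPP μ lam X) {D : Set (Plane × Plane)}
    (hD : MeasurableSet D) (hD0 : (volume.prod volume) D = 0) :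
    ∀ᵐ ω ∂μ, ∀ i j, j ≠ i → (X i ω, X j ω) ∉ D := by
  have key : ∀ n : ℕ, ∀ i j, j ≠ i → ∀ᵐ ω ∂μ,
      X i ω ∈ Metric.ball 0 (n : ℝ) → X j ω ∈ Metric.ball 0 (n : ℝ) → (X i ω, X j ω) ∉ D := by
    intro n i j hij
    set K : Set Plane := Metric.ball 0 (n : ℝ)
    have hK : MeasurableSet K := measurableSet_ball
    have hKfin : volume K ≠ ∞ := measure_ball_lt_top.ne
    have : IsFiniteMeasure (volume.restrict K) := ⟨by simpa using hKfin.lt_top⟩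
    have : IsFiniteMeasure ((lam : ℝ≥0∞) • volume.restrict K) :=
      Measure.smul_finite _ ENNReal.coe_ne_top
    let ρ : ℕ → ℕ → Measure (Plane × Plane) := fun i j =>
      if j = i then 0 else (μ.map fun ω => (X i ω, X j ω)).restrict (K ×ˢ K)
    let R : Measure (Plane × Plane) := Measure.sum fun i => Measure.sum fun j => ρ i j
    have hpair : ∀ i j, Measurable fun ω => (X i ω, X j ω) := fun i j =>
      (h.measurable i).prodMk (h.measurable j)
    have hR : ((lam : ℝ≥0∞) • volume.restrict K).prod ((lam : ℝ≥0∞) • volume.restrict K) = R := by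
      refine Measure.prod_eq fun s t hs ht => ?_
      have hst : ∀ i j, (if j = i then 0 else ∫⁻ ω, (s ∩ K).indicator 1 (X i ω) *
          (t ∩ K).indicator 1 (X j ω) ∂μ) = ρ i j (s ×ˢ t) := by
        intro i j
        by_cases hij : j = i
        · simp [ρ, hij]
        · simp only [ρ, hij, if_false]
          rw [Measure.restrict_apply (hs.prod ht), prod_inter_prod,
            Measure.map_apply (hpair i j) ((hs.inter hK).prod (ht.inter hK)),
            ← lintegral_indicator_one ((hpair i j) ((hs.inter hK).prod (ht.inter hK)))]
          refine lintegral_congr fun ω => ?_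
          classical
          simp only [indicator_apply, mem_preimage, mem_prod, Pi.one_apply]
          by_cases h1 : X i ω ∈ s ∩ K <;> by_cases h2 : X j ω ∈ t ∩ K <;> simp only [h1, h2] <;>
            simp
      rw [Measure.sum_apply _ (hs.prod ht)]
      simp_rw [Measure.sum_apply _ (hs.prod ht), ← hst]
      simp only [Measure.smul_apply, smul_eq_mul, Measure.restrict_apply hs,
        Measure.restrict_apply ht]
      rw [← h.lintegral_countOthers (hs.inter hK) (ht.inter hK)
        (measure_ne_top_of_subset inter_subset_right hKfin)
        (measure_ne_top_of_subset inter_subset_right hKfin)]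
      refine tsum_congr fun i => ?_
      simp_rw [countOthers, sumOthers, ← ENNReal.tsum_mul_left]
      rw [lintegral_tsum]
      · refine tsum_congr fun j => ?_
        by_cases hij : j = i <;> simp [hij]
      · intro j
        refine Measurable.aemeasurable ?_
        refine ((measurable_one.indicator (hs.inter hK)).comp (h.measurable i)).mul ?_
        split_ifs
        · exact measurable_const
        · exact (measurable_one.indicator (ht.inter hK)).comp (h.measurable j)
    have hR0 : R D = 0 := by
      rw [← hR]
      have hac : ((lam : ℝ≥0∞) • volume.restrict K).prod ((lam : ℝ≥0∞) • volume.restrict K) ≪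
          (volume : Measure Plane).prod volume :=
        Measure.AbsolutelyContinuous.prod
          (Measure.absolutelyContinuous_of_le_smul (c := lam)
            (by gcongr; exact Measure.restrict_le_self))
          (Measure.absolutelyContinuous_of_le_smul (c := lam)
            (by gcongr; exact Measure.restrict_le_self))
      exact hac hD0
    have hρ0 : ρ i j D = 0 := by
      rw [Measure.sum_apply _ hD, ENNReal.tsum_eq_zero] at hR0
      have := hR0 i
      rw [Measure.sum_apply _ hD, ENNReal.tsum_eq_zero] at this
      exact this j
    simp only [ρ, hij, if_false] at hρ0
    rw [Measure.restrict_apply hD, Measure.map_apply (hpair i j) (hD.inter (hK.prod hK))] at hρ0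
    rw [ae_iff]
    convert hρ0 using 2
    ext ω
    simp only [mem_ofPred_eq, mem_preimage, mem_inter_iff, mem_prod]
    tauto
  have key' : ∀ᵐ ω ∂μ, ∀ n : ℕ, ∀ i j, j ≠ i →
      X i ω ∈ Metric.ball 0 (n : ℝ) → X j ω ∈ Metric.ball 0 (n : ℝ) → (X i ω, X j ω) ∉ D := by
    simp_rw [ae_all_iff]
    exact fun n i j hij => key n i j hij
  filter_upwards [key'] with ω hω i j hij
  obtain ⟨n, hn⟩ := exists_nat_gt (max ‖X i ω‖ ‖X j ω‖)
  refine hω n i j hij ?_ ?_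
  · rw [mem_ball_zero_iff]; exact (le_max_left _ _).trans_lt hn
  · rw [mem_ball_zero_iff]; exact (le_max_right _ _).trans_lt hn

end IsHomogeneousPPP

/-! ### Mecke's formula for a fixed function of the other points -/

namespace IsHomogeneousPPP

variable {Ω : Type*} [MeasurableSpace Ω] {μ : Measure Ω} {lam : ℝ≥0} {X : ℕ → Ω → Plane}
  [IsProbabilityMeasure μ]

/-- Mecke's formula for `expNeg` of a step function. -/
theorem mecke_step (h : IsHomogeneousPPP μ lam X) {ι : Type*} [Fintype ι]
    {B : ι → Set Plane} (hB : ∀ k, MeasurableSet (B k)) (hfin : ∀ k, volume (B k) ≠ ∞)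
    (hd : Pairwise fun j k => Disjoint (B j) (B k)) (c : ι → ℝ≥0∞) (k₀ : ι) :
    ∑' i, ∫⁻ ω, (B k₀).indicator 1 (X i ω) *
        expNeg (sumOthers i fun j => ∑ k, c k * (B k).indicator 1 (X j ω)) ∂μ =
      lam * volume (B k₀) * expNeg (lam * ∑ k, (1 - expNeg (c k)) * volume (B k)) := by
  have hφ : ∀ k, Measurable fun x : ℝ≥0∞ => expNeg (c k * x) := fun k => by fun_prop
  have h1 := h.mecke_count hB hfin hd hφ k₀
  rw [h.lintegral_prod_count hB hfin hd hφ] at h1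
  simp_rw [fun k => h.lintegral_expNeg_count (hB k) (hfin k) (c k)] at h1
  rw [← expNeg_sum] at h1
  simp_rw [← expNeg_sum, countOthers, ← sumOthers_const_mul, ← sumOthers_sum] at h1
  rw [h1, Finset.mul_sum]
  congr 3
  ext k
  ring

/-- Mecke's formula for `expNeg` of a simple function with support of finite area. -/
theorem mecke_simpleFunc (h : IsHomogeneousPPP μ lam X) (s : SimpleFunc Plane ℝ≥0∞)
    (hs : volume {x | s x ≠ 0} ≠ ∞) {B : Set Plane} (hB : MeasurableSet B)
    (hfin : volume B ≠ ∞) :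
    ∑' i, ∫⁻ ω, B.indicator 1 (X i ω) * expNeg (sumOthers i fun j => s (X j ω)) ∂μ =
      lam * volume B * expNeg (lam * ∫⁻ x, (1 - expNeg (s x))) := by
  classical
  -- the plane is cut into the sets on which `s` and the indicator of `B` are constant
  let t : SimpleFunc Plane (ℝ≥0∞ × Bool) :=
    s.pair (SimpleFunc.piecewise B hB (SimpleFunc.const _ true) (SimpleFunc.const _ false))
  have ht1 : ∀ x, (t x).1 = s x := fun x => rfl
  have ht2 : ∀ x, (t x).2 = if x ∈ B then true else false := fun x => by
    simp only [t, SimpleFunc.pair_apply, SimpleFunc.coe_piecewise, Set.piecewise]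
    rfl
  let R : Finset (ℝ≥0∞ × Bool) := t.range.filter fun k => k ≠ (0, false)
  let S : R → Set Plane := fun k => t ⁻¹' {k.1}
  have hS : ∀ k, MeasurableSet (S k) := fun k => t.measurableSet_fiber _
  have hSfin : ∀ k, volume (S k) ≠ ∞ := by
    rintro ⟨⟨c, b⟩, hk⟩
    have hne : (c, b) ≠ (0, false) := (Finset.mem_filter.mp hk).2
    refine ne_top_of_le_ne_top (measure_union_lt_top hs.lt_top hfin.lt_top).ne
      (measure_mono ?_)
    intro x hx
    have hx' : t x = (c, b) := hx
    have hc : s x = c := by rw [← ht1, hx']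
    have hb := ht2 x
    rw [hx'] at hb
    by_contra hcon
    simp only [mem_union, mem_ofPred_eq, not_or, not_not] at hcon
    rw [if_neg hcon.2] at hb
    exact hne (by rw [← hc, hcon.1]; simpa using hb)
  have hd : Pairwise fun j k => Disjoint (S j) (S k) := by
    intro j k hjk
    rw [Set.disjoint_left]
    intro x hj hk
    exact hjk (Subtype.ext ((show t x = j.1 from hj).symm.trans hk))
  have hexp : ∀ F : ℝ≥0∞ × Bool → ℝ≥0∞, F (0, false) = 0 → ∀ x,
      F (t x) = ∑ k : R, F k.1 * (S k).indicator 1 x := by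
    intro F hF x
    by_cases hx : t x = (0, false)
    · rw [hx, hF]
      refine (Finset.sum_eq_zero fun k _ => ?_).symm
      have : x ∉ S k := fun hk =>
        (Finset.mem_filter.mp k.2).2 ((show t x = k.1 from hk).symm.trans hx)
      rw [indicator_of_notMem this, mul_zero]
    · have hmem : t x ∈ t.range.filter fun k => k ≠ (0, false) :=
        Finset.mem_filter.mpr ⟨t.mem_range_self x, hx⟩
      rw [Finset.sum_eq_single (⟨t x, hmem⟩ : R)]
      · simp [S]
      · intro k _ hk
        have : x ∉ S k := fun hk' => hk (Subtype.ext (show t x = k.1 from hk').symm)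
        rw [indicator_of_notMem this, mul_zero]
      · intro hcon
        exact absurd (Finset.mem_univ _) hcon
  have hs' : ∀ x, s x = ∑ k : R, k.1.1 * (S k).indicator 1 x := fun x => hexp (fun p => p.1) rfl x
  have hexp' : ∀ x, 1 - expNeg (s x) = ∑ k : R, (1 - expNeg k.1.1) * (S k).indicator 1 x :=
    fun x => hexp (fun p => 1 - expNeg p.1) (by simp) x
  have hB' : ∀ x, B.indicator (1 : Plane → ℝ≥0∞) x =
      ∑ k : R, (if k.1.2 then 1 else 0) * (S k).indicator 1 x := by
    intro x
    rw [← hexp (fun p => if p.2 then 1 else 0) (by simp) x, ht2]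
    by_cases hx : x ∈ B <;> simp [hx]
  have hint : ∫⁻ x, (1 - expNeg (s x)) = ∑ k : R, (1 - expNeg k.1.1) * volume (S k) := by
    simp_rw [hexp']
    rw [lintegral_finsetSum _ fun k _ => (measurable_one.indicator (hS k)).const_mul _]
    refine Finset.sum_congr rfl fun k _ => ?_
    rw [lintegral_const_mul _ (measurable_one.indicator (hS k)), lintegral_indicator_one (hS k)]
  have hvol : volume B = ∑ k : R, (if k.1.2 then 1 else 0) * volume (S k) := by
    rw [← lintegral_indicator_one hB]
    simp_rw [hB']
    rw [lintegral_finsetSum _ fun k _ => (measurable_one.indicator (hS k)).const_mul _]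
    refine Finset.sum_congr rfl fun k _ => ?_
    rw [lintegral_const_mul _ (measurable_one.indicator (hS k)), lintegral_indicator_one (hS k)]
  have hw : ∀ i, Measurable fun ω => expNeg (sumOthers i fun j => s (X j ω)) := fun i =>
    measurable_expNeg.comp (measurable_sumOthers i fun j => s.measurable.comp (h.measurable j))
  simp_rw [hB', ← tsum_fintype (L := .unconditional _)]
  rw [tsum_lintegral_tsum_mul h.measurable
    (fun k : R => (measurable_one.indicator (hS k)).const_mul _) hw, hvol,
    ← tsum_fintype (L := .unconditional _), ← ENNReal.tsum_mul_left, ← ENNReal.tsum_mul_right]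
  refine tsum_congr fun k => ?_
  have hk := h.mecke_step hS hSfin hd (fun k => k.1.1) k
  simp_rw [← hs'] at hk
  rw [← hint] at hk
  simp_rw [mul_assoc]
  rw [mul_left_comm, ← mul_assoc (lam : ℝ≥0∞), ← hk, ← ENNReal.tsum_mul_left]
  refine tsum_congr fun i => ?_
  exact lintegral_const_mul _
    (((measurable_one.indicator (hS k)).comp (h.measurable i)).mul (hw i))

/-- Mecke's formula for `expNeg` of a fixed function `g`, on a set of finite area. -/
theorem mecke_indicator (h : IsHomogeneousPPP μ lam X) {g : Plane → ℝ≥0∞} (hg : Measurable g)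
    {B : Set Plane} (hB : MeasurableSet B) (hfin : volume B ≠ ∞) :
    ∑' i, ∫⁻ ω, B.indicator 1 (X i ω) * expNeg (sumOthers i fun j => g (X j ω)) ∂μ =
      lam * volume B * expNeg (lam * ∫⁻ x, (1 - expNeg (g x))) := by
  let s : ℕ → SimpleFunc Plane ℝ≥0∞ := fun n =>
    (SimpleFunc.eapprox g n).restrict (Metric.ball 0 (n : ℝ))
  have hs : ∀ n x, s n x = (Metric.ball 0 (n : ℝ)).indicator (SimpleFunc.eapprox g n) x :=
    fun n x => SimpleFunc.restrict_apply _ measurableSet_ball x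
  have hmono : ∀ x, Monotone fun n => s n x := by
    intro x n m hnm
    dsimp only
    rw [hs, hs]
    refine (indicator_le_indicator (SimpleFunc.monotone_eapprox g hnm x)).trans ?_
    exact indicator_le_indicator_of_subset (Metric.ball_subset_ball (by exact_mod_cast hnm))
      (fun _ => zero_le) x
  have hsup : ∀ x, ⨆ n, s n x = g x := by
    intro x
    rw [← SimpleFunc.iSup_eapprox_apply hg x]
    refine le_antisymm (iSup_mono fun n => ?_) (iSup_le fun m => ?_)
    · rw [hs]
      exact indicator_le_self _ _ _
    · obtain ⟨n, hn⟩ := exists_nat_gt ‖x‖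
      refine le_iSup_of_le (max m n) ?_
      rw [hs, indicator_of_mem]
      · exact SimpleFunc.monotone_eapprox g (le_max_left m n) x
      · rw [mem_ball_zero_iff]
        exact hn.trans_le (by exact_mod_cast le_max_right m n)
  have hsfin : ∀ n, volume {x | s n x ≠ 0} ≠ ∞ := fun n =>
    ne_top_of_le_ne_top (measure_ball_lt_top (x := 0) (r := (n : ℝ))).ne
      (measure_mono fun x hx => by
        by_contra hcon
        exact hx (by rw [hs, indicator_of_notMem hcon]))
  have hind : ∀ i ω, B.indicator (1 : Plane → ℝ≥0∞) (X i ω) ≠ ∞ := fun i ω => by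
    by_cases hx : X i ω ∈ B <;> simp [hx]
  have hL : ∀ i ω, B.indicator 1 (X i ω) * expNeg (sumOthers i fun j => g (X j ω)) =
      ⨅ n, B.indicator 1 (X i ω) * expNeg (sumOthers i fun j => s n (X j ω)) := by
    intro i ω
    rw [← ENNReal.mul_iInf' (fun hh => absurd hh (hind i ω)) (fun _ => inferInstance),
      ← expNeg_iSup, ← sumOthers_iSup i fun j => hmono (X j ω)]
    simp_rw [hsup]
  simp_rw [hL]
  rw [tsum_lintegral_iInf]
  · simp_rw [h.mecke_simpleFunc (s _) (hsfin _) hB hfin]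
    rw [← ENNReal.mul_iInf' (fun hh => absurd hh (ENNReal.mul_ne_top ENNReal.coe_ne_top hfin))
      (fun _ => inferInstance), ← expNeg_iSup, ← ENNReal.mul_iSup, ← lintegral_iSup]
    · simp_rw [← one_sub_expNeg_iSup, hsup]
    · intro n
      exact (measurable_expNeg.comp (s n).measurable).const_sub 1
    · intro n m hnm x
      exact tsub_le_tsub_left (expNeg_antitone (hmono x hnm)) 1
  · intro n i
    exact ((measurable_one.indicator hB).comp (h.measurable i)).mul
      (measurable_expNeg.comp (measurable_sumOthers i fun j =>
        (s n).measurable.comp (h.measurable j)))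
  · intro i ω n m hnm
    dsimp only
    gcongr
    exact expNeg_antitone (sumOthers_mono i fun j => hmono _ hnm)
  · rw [h.mecke_simpleFunc (s 0) (hsfin 0) hB hfin]
    exact ENNReal.mul_ne_top (ENNReal.mul_ne_top ENNReal.coe_ne_top hfin) (expNeg_ne_top _)

/-- Mecke's formula for `expNeg` of a function `g` that does not depend on the chosen point. -/
theorem mecke (h : IsHomogeneousPPP μ lam X) {g : Plane → ℝ≥0∞} (hg : Measurable g)
    {f : Plane → ℝ≥0∞} (hf : Measurable f) :
    ∑' i, ∫⁻ ω, f (X i ω) * expNeg (sumOthers i fun j => g (X j ω)) ∂μ =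
      lam * ∫⁻ x, f x * expNeg (lam * ∫⁻ y, (1 - expNeg (g y))) := by
  have hw : ∀ i, Measurable fun ω => expNeg (sumOthers i fun j => g (X j ω)) := fun i =>
    measurable_expNeg.comp (measurable_sumOthers i fun j => hg.comp (h.measurable j))
  set c := expNeg (lam * ∫⁻ y, (1 - expNeg (g y))) with hc
  let ρ : Measure Plane := Measure.sum fun i =>
    (μ.withDensity fun ω => expNeg (sumOthers i fun j => g (X j ω))).map (X i)
  have hρ : ∀ f : Plane → ℝ≥0∞, Measurable f →
      ∑' i, ∫⁻ ω, f (X i ω) * expNeg (sumOthers i fun j => g (X j ω)) ∂μ = ∫⁻ x, f x ∂ρ := by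
    intro f hf
    rw [lintegral_sum_measure]
    refine tsum_congr fun i => ?_
    rw [lintegral_map hf (h.measurable i),
      lintegral_withDensity_eq_lintegral_mul _ (hw i) (hf.fun_comp (h.measurable i))]
    exact lintegral_congr fun ω => mul_comm _ _
  have hρc : ρ = ((lam : ℝ≥0∞) * c) • volume := by
    refine Measure.ext_of_iUnion_eq_univ (s := fun n : ℕ => Metric.ball (0 : Plane) n)
      (Metric.iUnion_ball_nat 0) fun n => ?_
    ext t ht
    have hfin : volume (t ∩ Metric.ball (0 : Plane) n) ≠ ∞ :=
      measure_ne_top_of_subset inter_subset_right measure_ball_lt_top.ne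
    have hm := ht.inter (measurableSet_ball (x := (0 : Plane)) (ε := n))
    rw [Measure.restrict_apply ht, Measure.restrict_apply ht, ← lintegral_indicator_one hm,
      ← hρ _ (measurable_one.indicator hm), h.mecke_indicator hg hm hfin, Measure.smul_apply,
      smul_eq_mul, ← hc]
    ring
  rw [hρ f hf, hρc, lintegral_smul_measure, lintegral_mul_const _ hf, smul_eq_mul]
  ring

/-- Mecke's formula when `g` depends on the chosen point through a variable with countably many
values. -/
theorem mecke_countable (h : IsHomogeneousPPP μ lam X) {κ : Plane → ℤ} (hκ : Measurable κ)
    {g : ℤ → Plane → ℝ≥0∞} (hg : ∀ v, Measurable (g v)) {f : Plane → ℝ≥0∞} (hf : Measurable f) :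
    ∑' i, ∫⁻ ω, f (X i ω) * expNeg (sumOthers i fun j => g (κ (X i ω)) (X j ω)) ∂μ =
      lam * ∫⁻ x, f x * expNeg (lam * ∫⁻ y, (1 - expNeg (g (κ x) y))) := by
  let fv : ℤ → Plane → ℝ≥0∞ := fun v => (κ ⁻¹' {v}).indicator f
  have hfv : ∀ v, Measurable (fv v) := fun v => hf.indicator (hκ (measurableSet_singleton v))
  have hsum : ∀ (x : Plane) (F : ℤ → ℝ≥0∞), f x * F (κ x) = ∑' v, fv v x * F v := by
    intro x F
    rw [tsum_eq_single (κ x)]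
    · simp [fv]
    · intro v hv
      simp [fv, hv.symm]
  have hw : ∀ v i, Measurable fun ω => expNeg (sumOthers i fun j => g v (X j ω)) := fun v i =>
    measurable_expNeg.comp (measurable_sumOthers i fun j => (hg v).comp (h.measurable j))
  have h1 : ∀ i ω, f (X i ω) * expNeg (sumOthers i fun j => g (κ (X i ω)) (X j ω)) =
      ∑' v, fv v (X i ω) * expNeg (sumOthers i fun j => g v (X j ω)) := fun i ω =>
    hsum (X i ω) fun v => expNeg (sumOthers i fun j => g v (X j ω))
  have h2 : ∀ x, f x * expNeg (lam * ∫⁻ y, (1 - expNeg (g (κ x) y))) =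
      ∑' v, fv v x * expNeg (lam * ∫⁻ y, (1 - expNeg (g v y))) := fun x =>
    hsum x fun v => expNeg (lam * ∫⁻ y, (1 - expNeg (g v y)))
  simp_rw [h1, h2]
  rw [lintegral_tsum fun v => ((hfv v).mul_const _).aemeasurable, ← ENNReal.tsum_mul_left]
  simp_rw [← h.mecke (hg _) (hfv _)]
  rw [ENNReal.tsum_comm]
  exact tsum_congr fun i => lintegral_tsum fun v =>
    (((hfv v).comp (h.measurable i)).mul (hw v i)).aemeasurable

end IsHomogeneousPPP

/-! ### Mecke's formula with a threshold set by the chosen point -/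

/-- The smallest multiple of `2⁻ⁿ` that is at least `t`. -/
noncomputable def dyadicCeil (n : ℕ) (t : ℝ) : ℝ := ⌈2 ^ n * t⌉ / 2 ^ n

theorem le_dyadicCeil (n : ℕ) (t : ℝ) : t ≤ dyadicCeil n t := by
  rw [dyadicCeil, le_div_iff₀ (by positivity), mul_comm]
  exact Int.le_ceil _

theorem dyadicCeil_le (n : ℕ) (t : ℝ) : dyadicCeil n t ≤ t + (1 / 2) ^ n := by
  rw [dyadicCeil, div_le_iff₀ (by positivity), add_mul, ← mul_pow]
  norm_num
  rw [mul_comm t]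
  exact (Int.ceil_lt_add_one _).le

theorem dyadicCeil_antitone (t : ℝ) : Antitone fun n => dyadicCeil n t := by
  refine antitone_nat_of_succ_le fun n => ?_
  rw [dyadicCeil, dyadicCeil, div_le_div_iff₀ (by positivity) (by positivity), pow_succ,
    mul_comm (2 ^ n : ℝ) 2, ← mul_assoc]
  gcongr
  have : ⌈2 * 2 ^ n * t⌉ ≤ ⌈2 ^ n * t⌉ * 2 := by
    rw [Int.ceil_le]
    push_cast
    have := Int.le_ceil (2 ^ n * t)
    linarith
  exact_mod_cast this

theorem tendsto_dyadicCeil (t : ℝ) :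
    Filter.Tendsto (fun n => dyadicCeil n t) Filter.atTop (nhdsWithin t (Ici t)) := by
  refine tendsto_nhdsWithin_iff.mpr ⟨?_, Filter.Eventually.of_forall fun n => le_dyadicCeil n t⟩
  refine tendsto_of_tendsto_of_tendsto_of_le_of_le tendsto_const_nhds ?_
    (fun n => le_dyadicCeil n t) (fun n => dyadicCeil_le n t)
  simpa using (tendsto_pow_atTop_nhds_zero_of_lt_one (r := (1 / 2 : ℝ)) (by norm_num)
    (by norm_num)).const_add t

theorem measurable_dyadicCeil (n : ℕ) : Measurable (dyadicCeil n) := by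
  unfold dyadicCeil
  have : Measurable fun t : ℝ => ⌈2 ^ n * t⌉ := (measurable_id.const_mul _).ceil
  exact ((measurable_from_top (f := fun z : ℤ => (z : ℝ))).comp this).div_const _

theorem iSup_dyadicCeil {u : ℝ → ℝ≥0∞} {t : ℝ} (ht : 0 < t) (hanti : AntitoneOn u (Ioi 0))
    (hcont : ContinuousWithinAt u (Ici t) t) :
    ⨆ n, u (dyadicCeil n t) = u t :=
  tendsto_nhds_unique (tendsto_atTop_iSup fun n m hnm => hanti (ht.trans_le (le_dyadicCeil m t))
    (ht.trans_le (le_dyadicCeil n t)) (dyadicCeil_antitone t hnm))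
    (hcont.tendsto.comp (tendsto_dyadicCeil t))

namespace IsHomogeneousPPP

variable {Ω : Type*} [MeasurableSpace Ω] {μ : Measure Ω} {lam : ℝ≥0} {X : ℕ → Ω → Plane}
  [IsProbabilityMeasure μ]

/-- `mecke_threshold` for integrable `f`: the threshold is rounded up to a multiple of `2⁻ⁿ`, which
leaves countably many values, and `n → ∞` by monotone convergence. Integrability allows to pass
to the limit in the decreasing expectations. -/
theorem mecke_threshold_of_integrable (h : IsHomogeneousPPP μ lam X) {T : Plane → ℝ}
    (hT : Measurable T) {g : ℝ → Plane → ℝ≥0∞} (hg : Measurable (Function.uncurry g))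
    (hanti : ∀ y, AntitoneOn (fun t => g t y) (Ioi 0))
    (hcont : ∀ y t, 0 < t → ContinuousWithinAt (fun t => g t y) (Ici t) t)
    {f : Plane → ℝ≥0∞} (hf : Measurable f) (hfin : ∀ x, f x ≠ ∞) (hint : ∫⁻ x, f x ≠ ∞)
    (hfT : ∀ x, f x ≠ 0 → 0 < T x) :
    ∑' i, ∫⁻ ω, f (X i ω) * expNeg (sumOthers i fun j => g (T (X i ω)) (X j ω)) ∂μ =
      lam * ∫⁻ x, f x * expNeg (lam * ∫⁻ y, (1 - expNeg (g (T x) y))) := by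
  have hmono : ∀ t, 0 < t → ∀ y, Monotone fun n => g (dyadicCeil n t) y := fun t ht y n m hnm =>
    hanti y (ht.trans_le (le_dyadicCeil m t)) (ht.trans_le (le_dyadicCeil n t))
      (dyadicCeil_antitone t hnm)
  have hsup : ∀ t, 0 < t → ∀ y, ⨆ n, g (dyadicCeil n t) y = g t y := fun t ht y =>
    iSup_dyadicCeil ht (hanti y) (hcont y t ht)
  have hgt : ∀ t, Measurable (g t) := fun t => hg.of_uncurry_left
  have hgT : ∀ S : Plane → ℝ, Measurable S →
      Measurable fun p : Plane × Plane => g (S p.1) p.2 := fun S hS =>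
    hg.comp ((hS.comp measurable_fst).prodMk measurable_snd)
  have hgT' : ∀ S : Plane → ℝ, Measurable S →
      Measurable fun x => expNeg (lam * ∫⁻ y, (1 - expNeg (g (S x) y))) := fun S hS =>
    measurable_expNeg.comp
      (((measurable_expNeg.comp (hgT S hS)).const_sub 1).lintegral_prod_right'.const_mul _)
  have hdT : ∀ n, Measurable fun x => dyadicCeil n (T x) := fun n =>
    (measurable_dyadicCeil n).comp hT
  -- the formula for the discretized threshold
  have hstep : ∀ n, ∑' i, ∫⁻ ω, f (X i ω) *
        expNeg (sumOthers i fun j => g (dyadicCeil n (T (X i ω))) (X j ω)) ∂μ =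
      lam * ∫⁻ x, f x * expNeg (lam * ∫⁻ y, (1 - expNeg (g (dyadicCeil n (T x)) y))) := fun n =>
    h.mecke_countable (κ := fun x => ⌈2 ^ n * T x⌉) (hT.const_mul _).ceil
      (g := fun v => g (v / 2 ^ n)) (fun v => hgt _) hf
  have hL : ∀ i ω, f (X i ω) * expNeg (sumOthers i fun j => g (T (X i ω)) (X j ω)) =
      ⨅ n, f (X i ω) * expNeg (sumOthers i fun j => g (dyadicCeil n (T (X i ω))) (X j ω)) := by
    intro i ω
    by_cases h0 : f (X i ω) = 0
    · simp [h0]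
    · have ht := hfT _ h0
      rw [← ENNReal.mul_iInf' (fun hh => absurd hh (hfin _)) (fun _ => inferInstance),
        ← expNeg_iSup, ← sumOthers_iSup i fun j => hmono _ ht (X j ω)]
      simp_rw [hsup _ ht]
  have hR : ∀ x, f x * expNeg (lam * ∫⁻ y, (1 - expNeg (g (T x) y))) =
      ⨅ n, f x * expNeg (lam * ∫⁻ y, (1 - expNeg (g (dyadicCeil n (T x)) y))) := by
    intro x
    by_cases h0 : f x = 0
    · simp [h0]
    · have ht := hfT _ h0
      rw [← ENNReal.mul_iInf' (fun hh => absurd hh (hfin _)) (fun _ => inferInstance),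
        ← expNeg_iSup, ← ENNReal.mul_iSup, ← lintegral_iSup]
      · simp_rw [← one_sub_expNeg_iSup, hsup _ ht]
      · exact fun n => (measurable_expNeg.comp (hgt _)).const_sub 1
      · exact fun n m hnm y => tsub_le_tsub_left (expNeg_antitone (hmono _ ht y hnm)) 1
  have hLanti : ∀ i ω, Antitone fun n : ℕ => f (X i ω) *
      expNeg (sumOthers i fun j => g (dyadicCeil n (T (X i ω))) (X j ω)) := by
    intro i ω n m hnm
    by_cases h0 : f (X i ω) = 0
    · simp [h0]
    · have := sumOthers_mono i fun j => hmono (T (X i ω)) (hfT _ h0) (X j ω) hnm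
      exact mul_le_mul' le_rfl (expNeg_antitone this)
  have hRanti : Antitone fun (n : ℕ) (x : Plane) =>
      f x * expNeg (lam * ∫⁻ y, (1 - expNeg (g (dyadicCeil n (T x)) y))) := by
    intro n m hnm x
    by_cases h0 : f x = 0
    · simp [h0]
    · exact mul_le_mul' le_rfl (expNeg_antitone (mul_le_mul' le_rfl (lintegral_mono fun y =>
        tsub_le_tsub_left (expNeg_antitone (hmono _ (hfT _ h0) y hnm)) 1)))
  have hRfin : ∫⁻ x, f x * expNeg (lam * ∫⁻ y, (1 - expNeg (g (dyadicCeil 0 (T x)) y))) ≠ ∞ :=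
    ne_top_of_le_ne_top hint (lintegral_mono fun x => mul_le_of_le_one_right' (expNeg_le_one _))
  simp_rw [hL, hR]
  rw [lintegral_iInf (fun n => hf.fun_mul (hgT' _ (hdT n))) hRanti hRfin,
    ENNReal.mul_iInf' (fun hh => absurd hh ENNReal.coe_ne_top) (fun _ => inferInstance),
    tsum_lintegral_iInf]
  · simp_rw [hstep]
  · intro n i
    have hp : Measurable fun p : Plane × Plane => g (dyadicCeil n (T p.1)) p.2 :=
      hgT (fun x => dyadicCeil n (T x)) (hdT n)
    have hj : ∀ j, Measurable fun ω => g (dyadicCeil n (T (X i ω))) (X j ω) := by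
      intro j
      have hpair : Measurable fun ω => (X i ω, X j ω) := (h.measurable i).prodMk (h.measurable j)
      have := hp.comp hpair
      exact this
    exact (hf.comp (h.measurable i)).mul (measurable_expNeg.comp (measurable_sumOthers i hj))
  · exact hLanti
  · rw [hstep]
    exact ENNReal.mul_ne_top ENNReal.coe_ne_top hRfin

/-- Mecke's formula for `expNeg` of a function that depends on the chosen point `x` through a
threshold `T x > 0`, antitonely and right-continuously. -/
theorem mecke_threshold (h : IsHomogeneousPPP μ lam X) {T : Plane → ℝ}
    (hT : Measurable T) {g : ℝ → Plane → ℝ≥0∞} (hg : Measurable (Function.uncurry g))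
    (hanti : ∀ y, AntitoneOn (fun t => g t y) (Ioi 0))
    (hcont : ∀ y t, 0 < t → ContinuousWithinAt (fun t => g t y) (Ici t) t)
    {f : Plane → ℝ≥0∞} (hf : Measurable f) (hf1 : ∀ x, f x ≤ 1) (hfT : ∀ x, f x ≠ 0 → 0 < T x) :
    ∑' i, ∫⁻ ω, f (X i ω) * expNeg (sumOthers i fun j => g (T (X i ω)) (X j ω)) ∂μ =
      lam * ∫⁻ x, f x * expNeg (lam * ∫⁻ y, (1 - expNeg (g (T x) y))) := by
  -- `f` is cut along the annuli `{n ≤ ‖x‖ < n + 1}`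
  let S : ℕ → Set Plane := fun n => {x | ⌊‖x‖⌋₊ = n}
  have hS : ∀ n, MeasurableSet (S n) := fun n =>
    (Nat.measurable_floor.comp measurable_norm) (measurableSet_singleton n)
  let fv : ℕ → Plane → ℝ≥0∞ := fun n => (S n).indicator f
  have hfv : ∀ n, Measurable (fv n) := fun n => hf.indicator (hS n)
  have hsum : ∀ x, f x = ∑' n, fv n x := by
    intro x
    rw [tsum_eq_single ⌊‖x‖⌋₊]
    · simp [fv, S]
    · intro n hn
      simp [fv, S, hn.symm]
  have hfv_le : ∀ n x, fv n x ≤ f x := fun n x => indicator_le_self _ _ x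
  have hfin : ∀ n, ∫⁻ x, fv n x ≠ ∞ := by
    intro n
    have hsub : S n ⊆ Metric.ball 0 ((n : ℝ) + 1) := by
      intro x hx
      rw [mem_ball_zero_iff]
      have := Nat.lt_floor_add_one ‖x‖
      rwa [show ⌊‖x‖⌋₊ = n from hx] at this
    refine ne_top_of_le_ne_top
      (measure_ball_lt_top (μ := volume) (x := (0 : Plane)) (r := (n : ℝ) + 1)).ne ?_
    calc ∫⁻ x, fv n x ≤ ∫⁻ x, (S n).indicator 1 x :=
          lintegral_mono fun x => indicator_le_indicator (hf1 x)
      _ = volume (S n) := lintegral_indicator_one (hS n)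
      _ ≤ _ := measure_mono hsub
  have hw : ∀ i, Measurable fun ω =>
      expNeg (sumOthers i fun j => g (T (X i ω)) (X j ω)) := fun i =>
    measurable_expNeg.comp (measurable_sumOthers i fun j =>
      hg.comp ((hT.comp (h.measurable i)).prodMk (h.measurable j)))
  have hW : Measurable fun x => expNeg (lam * ∫⁻ y, (1 - expNeg (g (T x) y))) := by
    have : Measurable fun p : Plane × Plane => g (T p.1) p.2 :=
      hg.comp ((hT.comp measurable_fst).prodMk measurable_snd)
    exact measurable_expNeg.comp
      (((measurable_expNeg.comp this).const_sub 1).lintegral_prod_right'.const_mul _)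
  simp_rw [hsum]
  rw [tsum_lintegral_tsum_mul h.measurable hfv hw]
  simp_rw [← ENNReal.tsum_mul_right]
  rw [lintegral_tsum fun n => ((hfv n).fun_mul hW).aemeasurable, ← ENNReal.tsum_mul_left]
  refine tsum_congr fun n => ?_
  exact h.mecke_threshold_of_integrable hT hg hanti hcont (hfv n)
    (fun x => ne_top_of_le_ne_top ENNReal.one_ne_top ((hfv_le n x).trans (hf1 x))) (hfin n)
    fun x hx => hfT x fun h0 => hx (le_antisymm (h0 ▸ hfv_le n x) zero_le)

end IsHomogeneousPPP

/-! ### Polar coordinates and integration over the marks -/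

/-- Integration in polar coordinates of a function of the norm. -/
theorem lintegral_comp_norm_plane {f : ℝ → ℝ≥0∞} (hf : Measurable f) :
    ∫⁻ x : Plane, f ‖x‖ = ∫⁻ r in Ioi (0 : ℝ), f r * ENNReal.ofReal (2 * Real.pi * r) := by
  have hdim : Module.finrank ℝ Plane = 2 := finrank_euclideanSpace_fin
  have hnt : Nontrivial Plane := Module.nontrivial_of_finrank_pos (R := ℝ) (by rw [hdim]; norm_num)
  have hmp := (volume : Measure Plane).measurePreserving_homeomorphUnitSphereProd
  calc ∫⁻ x : Plane, f ‖x‖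
      = ∫⁻ x : ({(0)}ᶜ : Set Plane), f ‖x.1‖ ∂((volume : Measure Plane).comap Subtype.val) := by
        rw [lintegral_subtype_comap (measurableSet_singleton _).compl fun x : Plane => f ‖x‖,
          restrict_compl_singleton]
    _ = ∫⁻ p, f p.2 ∂(volume : Measure Plane).toSphere.prod
          (Measure.volumeIoiPow (Module.finrank ℝ Plane - 1)) := by
        rw [← hmp.lintegral_comp (hf.fun_comp (measurable_subtype_coe.fun_comp measurable_snd))]
        refine lintegral_congr fun x => ?_
        simp
    _ = (volume : Measure Plane).toSphere univ *
          ∫⁻ r : Ioi (0 : ℝ), f r ∂Measure.volumeIoiPow (Module.finrank ℝ Plane - 1) := by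
        rw [lintegral_prod _
          (hf.fun_comp (measurable_subtype_coe.fun_comp measurable_snd)).aemeasurable]
        dsimp only
        rw [lintegral_const, mul_comm]
    _ = _ := by
        rw [Measure.toSphere_apply_univ, hdim, EuclideanSpace.volume_ball_fin_two]
        simp only [Measure.volumeIoiPow]
        rw [lintegral_withDensity_eq_lintegral_mul _ (by fun_prop)
          (hf.fun_comp measurable_subtype_coe)]
        simp only [Pi.mul_apply]
        rw [lintegral_subtype_comap measurableSet_Ioi
          fun r : ℝ => ENNReal.ofReal (r ^ (2 - 1)) * f r, ← lintegral_const_mul _ (by fun_prop)]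
        refine setLIntegral_congr_fun measurableSet_Ioi fun r hr => ?_
        simp only [ENNReal.ofReal_one, Nat.cast_ofNat, Nat.add_one_sub_one, pow_one, one_pow,
          one_mul]
        rw [ENNReal.ofReal_mul (by positivity), ENNReal.ofReal_mul (by norm_num)]
        rw [ENNReal.ofReal_ofNat]
        ring

/-- Independence of the `i`-th member of an independent sequence from the other members. -/
theorem iIndepFun_indepFun_update {Ω E : Type*} [MeasurableSpace Ω] [MeasurableSpace E]
    {μ : Measure Ω} {Y : ℕ → Ω → E} (hY : ∀ i, Measurable (Y i)) (h : iIndepFun Y μ) (i : ℕ)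
    (c : E) : IndepFun (fun ω => Function.update (fun j => Y j ω) i c) (Y i) μ := by
  have h1 := indep_iSup_of_disjoint (fun j => (hY j).comap_le) h.iIndep
    (S := {i}ᶜ) (T := {i}) disjoint_compl_left
  rw [IndepFun_iff_Indep]
  refine indep_of_indep_of_le_left (indep_of_indep_of_le_right h1 ?_) ?_
  · simp
  · rw [MeasurableSpace.pi, MeasurableSpace.comap_iSup]
    refine iSup_le fun j => ?_
    rw [MeasurableSpace.comap_comp]
    by_cases hj : j = i
    · have : ((fun b : ℕ → E => b j) ∘ fun ω => Function.update (fun j => Y j ω) i c) =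
          fun _ => c := by
        ext ω
        simp [hj]
      rw [this, MeasurableSpace.comap_const]
      exact bot_le
    · have : ((fun b : ℕ → E => b j) ∘ fun ω => Function.update (fun j => Y j ω) i c) = Y j := by
        ext ω
        simp [hj]
      rw [this]
      exact le_iSup₂_of_le j hj le_rfl

namespace Network

variable {lam lamA : ℝ≥0} {Ω : Type*} [MeasurableSpace Ω] {μ : Measure Ω}
  (W : Network lam lamA μ)

/-- The mark of a base station: the uniform variable, the channel gain and the activity flag. -/
def mark (i : ℕ) (ω : Ω) : ℝ × ℝ × Bool := (W.unif i ω, W.fading i ω, W.active i ω)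

theorem measurable_mark (i : ℕ) : Measurable (W.mark i) :=
  (W.measurable_unif i).prodMk ((W.measurable_fading i).prodMk (W.measurable_active i))

variable [IsProbabilityMeasure μ]

theorem isProbabilityMeasure_markLaw (W : Network lam lamA μ) :
    IsProbabilityMeasure (markLaw (lamA / lam)) :=
  (W.mark_law 0).isProbabilityMeasure_iff.mp inferInstance

/-- In an expectation the mark of one base station can be integrated separately from the marks of
the others and from the positions. -/
theorem lintegral_split_mark (i : ℕ)
    {Φ : (ℕ → Plane) → (ℕ → ℝ × ℝ × Bool) → ℝ × ℝ × Bool → ℝ≥0∞}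
    (hΦ : Measurable fun p : (ℕ → Plane) × (ℕ → ℝ × ℝ × Bool) × (ℝ × ℝ × Bool) =>
      Φ p.1 p.2.1 p.2.2)
    (hupd : ∀ x m' m c, Φ x (Function.update m' i c) m = Φ x m' m) :
    ∫⁻ ω, Φ (fun j => W.pos j ω) (fun j => W.mark j ω) (W.mark i ω) ∂μ =
      ∫⁻ ω, ∫⁻ ω', ∫⁻ m, Φ (fun j => W.pos j ω) (fun j => W.mark j ω') m
        ∂markLaw (lamA / lam) ∂μ ∂μ := by
  have := W.isProbabilityMeasure_markLaw
  set ν := markLaw (lamA / lam)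
  let c : ℝ × ℝ × Bool := (0, 0, true)
  let V : Ω → ℕ → ℝ × ℝ × Bool := fun ω => Function.update (fun j => W.mark j ω) i c
  have hX : Measurable fun ω j => W.pos j ω := measurable_pi_lambda _ W.ppp.measurable
  have hm : Measurable fun ω j => W.mark j ω := measurable_pi_lambda _ W.measurable_mark
  have hu : Measurable fun m : ℕ → ℝ × ℝ × Bool => (Function.update m i c, m i) :=
    (measurable_pi_lambda _ fun j => by
      by_cases hj : j = i
      · subst hj; simp
      · simpa [Function.update_of_ne hj] using measurable_pi_apply j).prodMk (measurable_pi_apply i)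
  have hVm : Measurable fun ω => (V ω, W.mark i ω) := hu.comp hm
  have hV : Measurable V := measurable_fst.comp hVm
  have h1 : IndepFun V (W.mark i) μ := iIndepFun_indepFun_update W.measurable_mark W.mark_iIndep i c
  have h2 : IndepFun (fun ω j => W.pos j ω) (fun ω => (V ω, W.mark i ω)) μ :=
    W.pos_indep_mark.comp measurable_id hu
  have hlaw1 := (indepFun_iff_map_prod_eq_prod_map_map hV.aemeasurable
    (W.measurable_mark i).aemeasurable).mp h1
  have hlaw2 := (indepFun_iff_map_prod_eq_prod_map_map hX.aemeasurable hVm.aemeasurable).mp h2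
  have hνi : μ.map (W.mark i) = ν := (W.mark_law i).map_eq
  rw [hνi] at hlaw1
  rw [hlaw1] at hlaw2
  have hP1 : IsProbabilityMeasure (μ.map fun ω j => W.pos j ω) :=
    Measure.isProbabilityMeasure_map hX.aemeasurable
  have hP2 : IsProbabilityMeasure (μ.map V) := Measure.isProbabilityMeasure_map hV.aemeasurable
  calc ∫⁻ ω, Φ (fun j => W.pos j ω) (fun j => W.mark j ω) (W.mark i ω) ∂μ
      = ∫⁻ ω, Φ (fun j => W.pos j ω) (V ω) (W.mark i ω) ∂μ :=
        lintegral_congr fun ω => (hupd _ _ _ _).symm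
    _ = ∫⁻ p, Φ p.1 p.2.1 p.2.2 ∂(μ.map fun ω => ((fun j => W.pos j ω), (V ω, W.mark i ω))) :=
        (lintegral_map hΦ (hX.prodMk hVm)).symm
    _ = ∫⁻ x, ∫⁻ m', ∫⁻ m, Φ x m' m ∂ν ∂(μ.map V) ∂(μ.map fun ω j => W.pos j ω) := by
        rw [hlaw2, lintegral_prod _ hΦ.aemeasurable]
        refine lintegral_congr fun x => ?_
        exact lintegral_prod (fun q : (ℕ → ℝ × ℝ × Bool) × (ℝ × ℝ × Bool) => Φ x q.1 q.2)
          (hΦ.comp measurable_prodMk_left).aemeasurable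
    _ = _ := by
        have hA : Measurable fun q : (ℕ → Plane) × (ℕ → ℝ × ℝ × Bool) =>
            ∫⁻ m, Φ q.1 q.2 m ∂ν :=
          (hΦ.comp (MeasurableEquiv.prodAssoc.measurable)).lintegral_prod_right'
        have hB : Measurable fun x => ∫⁻ m', ∫⁻ m, Φ x m' m ∂ν ∂(μ.map V) :=
          hA.lintegral_prod_right'
        rw [lintegral_map hB hX]
        refine lintegral_congr fun ω => ?_
        rw [lintegral_map (hA.fun_comp measurable_prodMk_left) hV]
        simp only [V, hupd]

/-- The marks are integrated out of `expNeg` of a sum. -/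
theorem lintegral_expNeg_tsum_mark {g : ℕ → ℝ × ℝ × Bool → ℝ≥0∞} (hg : ∀ j, Measurable (g j)) :
    ∫⁻ ω, expNeg (∑' j, g j (W.mark j ω)) ∂μ =
      expNeg (∑' j, negLog (∫⁻ m, expNeg (g j m) ∂markLaw (lamA / lam))) := by
  have := W.isProbabilityMeasure_markLaw
  have hle : ∀ j, ∫⁻ m, expNeg (g j m) ∂markLaw (lamA / lam) ≤ 1 := fun j =>
    (lintegral_mono fun m => expNeg_le_one _).trans (by simp)
  have hfin : ∀ n : ℕ, ∫⁻ ω, expNeg (∑ j ∈ Finset.range n, g j (W.mark j ω)) ∂μ =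
      expNeg (∑ j ∈ Finset.range n, negLog (∫⁻ m, expNeg (g j m) ∂markLaw (lamA / lam))) := by
    intro n
    have hind : iIndepFun (fun j ω => expNeg (g j (W.mark j ω))) μ :=
      iIndepFun.comp W.mark_iIndep (fun j m => expNeg (g j m))
        fun j => measurable_expNeg.comp (hg j)
    simp_rw [expNeg_sum]
    rw [lintegral_prod_eq_prod_lintegral_of_indepFun _ _ hind
      fun j => measurable_expNeg.comp ((hg j).comp (W.measurable_mark j))]
    refine Finset.prod_congr rfl fun j _ => ?_
    rw [expNeg_negLog (hle j)]
    exact (W.mark_law j).lintegral_comp (measurable_expNeg.comp (hg j)).aemeasurable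
  simp_rw [ENNReal.tsum_eq_iSup_nat, expNeg_iSup]
  rw [lintegral_iInf]
  · simp_rw [hfin]
  · exact fun n => measurable_expNeg.comp
      (Finset.measurable_fun_sum _ fun j _ => (hg j).comp (W.measurable_mark j))
  · exact fun n m hnm ω => expNeg_antitone
      (Finset.sum_le_sum_of_subset (Finset.range_mono hnm))
  · simp

/-- The marks of all base stations but one are integrated out of `expNeg` of a sum. -/
theorem lintegral_expNeg_sumOthers_mark (i : ℕ) {g : ℕ → ℝ × ℝ × Bool → ℝ≥0∞}
    (hg : ∀ j, Measurable (g j)) :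
    ∫⁻ ω, expNeg (sumOthers i fun j => g j (W.mark j ω)) ∂μ =
      expNeg (sumOthers i fun j => negLog (∫⁻ m, expNeg (g j m) ∂markLaw (lamA / lam))) := by
  have := W.isProbabilityMeasure_markLaw
  have h := W.lintegral_expNeg_tsum_mark (g := fun j m => if j = i then 0 else g j m)
    (fun j => by split_ifs; exacts [measurable_const, hg j])
  unfold sumOthers
  rw [h]
  congr 1
  refine tsum_congr fun j => ?_
  split_ifs <;> simp [negLog_one]

end Network

/-! ### The path-loss model -/

namespace PathLossModel

variable (M : PathLossModel)

theorem N_pos : 0 < M.N := by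
  rcases Nat.eq_zero_or_pos M.N with h | h
  · have h0 : (0 : Fin (M.N + 1)) = Fin.last M.N := by
      apply Fin.ext
      simp [h]
    have := M.d_zero
    rw [h0, M.d_last] at this
    exact absurd this (by simp)
  · exact h

theorem d_nonneg (k : Fin (M.N + 1)) : 0 ≤ M.d k := by
  rw [← M.d_zero]
  exact M.d_strictMono.monotone (Fin.zero_le k)

theorem pos_of_mem_piece {n : Fin M.N} {r : ℝ} (hr : r ∈ M.piece n) : 0 < r := by
  have := (M.d_nonneg _).trans_lt hr.1
  exact_mod_cast this

theorem exists_mem_piece {r : ℝ} (hr : 0 < r) : ∃ n, r ∈ M.piece n := by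
  by_contra hcon
  have h : ∀ k : Fin (M.N + 1), M.d k < r := by
    intro k
    induction k using Fin.induction with
    | zero => rw [M.d_zero]; exact_mod_cast hr
    | succ n ih =>
      by_contra hn
      exact hcon ⟨n, ih, not_lt.mp hn⟩
  have := h (Fin.last _)
  rw [M.d_last] at this
  exact not_top_lt this

theorem piece_unique {n m : Fin M.N} {r : ℝ} (hn : r ∈ M.piece n) (hm : r ∈ M.piece m) :
    n = m := by
  have key : ∀ {n m : Fin M.N}, r ∈ M.piece n → r ∈ M.piece m → ¬ n < m := by
    intro n m hn hm hlt
    have : M.d n.succ ≤ M.d m.castSucc :=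
      M.d_strictMono.monotone (by rw [Fin.le_def]; simpa using hlt)
    exact absurd hm.1 (not_lt.mpr (hn.2.trans this))
  rcases lt_trichotomy n m with h | h | h
  · exact absurd h (key hn hm)
  · exact h
  · exact absurd h (key hm hn)

theorem measurableSet_piece (n : Fin M.N) : MeasurableSet (M.piece n) :=
  measurable_coe_real_ereal (measurableSet_Ioc (a := M.d n.castSucc) (b := M.d n.succ))

theorem stack_of_mem {f : Fin M.N → ℝ → ℝ} {n : Fin M.N} {r : ℝ} (hr : r ∈ M.piece n) :
    M.stack f r = f n r := by
  rw [stack, Finset.sum_eq_single n]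
  · exact indicator_of_mem hr _
  · intro m _ hm
    exact indicator_of_notMem (fun h => hm (M.piece_unique h hr)) _
  · simp

theorem stack_of_nonpos {f : Fin M.N → ℝ → ℝ} {r : ℝ} (hr : r ≤ 0) : M.stack f r = 0 :=
  Finset.sum_eq_zero fun _ _ =>
    indicator_of_notMem (fun h => (M.pos_of_mem_piece h).not_ge hr) _

theorem measurable_stack {f : Fin M.N → ℝ → ℝ} (hf : ∀ n, Measurable (f n)) :
    Measurable (M.stack f) :=
  Finset.measurable_fun_sum _ fun n _ => (hf n).indicator (M.measurableSet_piece n)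

@[fun_prop]
theorem measurable_PrL : Measurable M.PrL := M.measurable_stack M.measurable_prL

theorem PrL_mem (r : ℝ) : M.PrL r ∈ Icc (0 : ℝ) 1 := by
  rcases le_or_gt r 0 with h | h
  · rw [PrL, M.stack_of_nonpos h]
    simp
  · obtain ⟨n, hn⟩ := M.exists_mem_piece h
    rw [PrL, M.stack_of_mem hn]
    exact M.prL_mem n r hn.1 hn.2

/-- The path-loss function of the LoS (`true`) or NLoS (`false`) links. -/
noncomputable def zetaOf (b : Bool) : ℝ → ℝ := if b then M.zetaL else M.zetaNL

/-- The probability of a LoS (`true`) or NLoS (`false`) link, as a function of the distance. -/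
noncomputable def probOf (b : Bool) (r : ℝ) : ℝ := if b then M.PrL r else 1 - M.PrL r

theorem probOf_mem (b : Bool) (r : ℝ) : M.probOf b r ∈ Icc (0 : ℝ) 1 := by
  have := M.PrL_mem r
  cases b
  · simp only [probOf, Bool.false_eq_true, if_false, mem_Icc] at *
    constructor <;> linarith [this.1, this.2]
  · simpa [probOf] using this

@[fun_prop]
theorem measurable_probOf (b : Bool) : Measurable (M.probOf b) := by
  cases b
  · exact M.measurable_PrL.const_sub 1
  · exact M.measurable_PrL

theorem zetaOf_eq_stack (b : Bool) :
    M.zetaOf b = M.stack fun n r =>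
      (if b then M.AL n else M.ANL n) * r ^ (-(if b then M.αL n else M.αNL n)) := by
  cases b <;> rfl

@[fun_prop]
theorem measurable_zetaOf (b : Bool) : Measurable (M.zetaOf b) := by
  rw [zetaOf_eq_stack]
  exact M.measurable_stack fun n => by fun_prop

theorem zetaOf_pos (b : Bool) {r : ℝ} (hr : 0 < r) : 0 < M.zetaOf b r := by
  obtain ⟨n, hn⟩ := M.exists_mem_piece hr
  rw [zetaOf_eq_stack, M.stack_of_mem hn]
  refine mul_pos ?_ (Real.rpow_pos_of_pos hr _)
  cases b
  · exact M.ANL_pos n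
  · exact M.AL_pos n

theorem zetaOf_nonneg (b : Bool) (r : ℝ) : 0 ≤ M.zetaOf b r := by
  rcases le_or_gt r 0 with h | h
  · rw [zetaOf_eq_stack, M.stack_of_nonpos h]
  · exact (M.zetaOf_pos b h).le

/-- The path-loss functions tend to `0` at infinity. -/
theorem exists_zetaOf_lt (b : Bool) {ε : ℝ} (hε : 0 < ε) :
    ∃ K : ℝ, ∀ r, K < r → M.zetaOf b r < ε := by
  let n : Fin M.N := ⟨M.N - 1, Nat.sub_lt M.N_pos one_pos⟩
  have hsucc : n.succ = Fin.last M.N := by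
    apply Fin.ext
    simpa [n] using Nat.sub_add_cancel M.N_pos
  have hlt : M.d n.castSucc < ⊤ := by
    rw [← M.d_last]
    exact M.d_strictMono (Fin.castSucc_lt_last n)
  have hmem : ∀ r : ℝ, (M.d n.castSucc).toReal < r → r ∈ M.piece n := by
    intro r hr
    refine ⟨?_, ?_⟩
    · refine (EReal.le_coe_toReal hlt.ne).trans_lt ?_
      exact_mod_cast hr
    · rw [hsucc, M.d_last]
      exact le_top
  have hα : 0 < (if b then M.αL n else M.αNL n) := by
    cases b
    · exact M.αNL_pos n
    · exact M.αL_pos n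
  have ht := (tendsto_rpow_neg_atTop hα).const_mul (if b then M.AL n else M.ANL n)
  rw [mul_zero] at ht
  obtain ⟨K, hK⟩ := Filter.eventually_atTop.mp (ht.eventually_lt_const hε)
  refine ⟨max K (M.d n.castSucc).toReal, fun r hr => ?_⟩
  rw [zetaOf_eq_stack, M.stack_of_mem (hmem r ((le_max_right _ _).trans_lt hr))]
  exact hK r ((le_max_left _ _).trans hr.le)

end PathLossModel

/-! ### Averages over the mark of one base station -/

/-- The Laplace transform of the unit exponential distribution. -/
theorem lintegral_expMeasure_expNeg {c : ℝ} (hc : 0 ≤ c) :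
    ∫⁻ h, expNeg (ENNReal.ofReal (c * h)) ∂expMeasure 1 = ENNReal.ofReal (1 / (1 + c)) := by
  have h1 : 0 < 1 + c := by linarith
  have hlaw : expMeasure 1 = volume.withDensity (exponentialPDF 1) := rfl
  have hm : Measurable fun h => expNeg (ENNReal.ofReal (c * h)) := by fun_prop
  have hpdf : ∀ a, Measurable (exponentialPDF a) := fun a =>
    (measurable_exponentialPDFReal a).ennreal_ofReal
  rw [hlaw, lintegral_withDensity_eq_lintegral_mul _ (hpdf 1) hm,
    ← mul_one (ENNReal.ofReal _), ← lintegral_exponentialPDF_eq_one h1,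
    ← lintegral_const_mul _ (hpdf _)]
  refine lintegral_congr fun h => ?_
  rcases lt_or_ge h 0 with hh | hh
  · simp [exponentialPDF_of_neg hh]
  · rw [Pi.mul_apply, exponentialPDF_of_nonneg hh, exponentialPDF_of_nonneg hh,
      expNeg_ofReal (mul_nonneg hc hh), ← ENNReal.ofReal_mul (by positivity),
      ← ENNReal.ofReal_mul (by positivity)]
    congr 1
    have : Real.exp (-((1 + c) * h)) = Real.exp (-(1 * h)) * Real.exp (-(c * h)) := by
      rw [← Real.exp_add]
      congr 1
      ring
    rw [this]
    field_simp

/-- The tail of the unit exponential distribution, at a level in `[0, ∞]`. -/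
theorem lintegral_expMeasure_lt (K : ℝ≥0∞) :
    ∫⁻ h, (if K < ENNReal.ofReal h then 1 else 0) ∂expMeasure 1 = expNeg K := by
  have := isProbabilityMeasure_expMeasure one_pos
  induction K with
  | top => simp
  | coe k =>
    have hset : ∀ h : ℝ, (if (k : ℝ≥0∞) < ENNReal.ofReal h then (1 : ℝ≥0∞) else 0) =
        (Iic (k : ℝ))ᶜ.indicator 1 h := by
      intro h
      have : (k : ℝ≥0∞) < ENNReal.ofReal h ↔ (k : ℝ) < h := by
        rw [← ENNReal.ofReal_coe_nnreal, ENNReal.ofReal_lt_ofReal_iff_of_nonneg k.coe_nonneg]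
      simp only [this]
      by_cases hk : (k : ℝ) < h
      · simp [hk]
      · simp [hk]
    simp_rw [hset]
    rw [lintegral_indicator_one measurableSet_Iic.compl, ← ENNReal.ofReal_coe_nnreal,
      expNeg_ofReal k.coe_nonneg, ← ofReal_measureReal, probReal_compl_eq_one_sub measurableSet_Iic,
      ← cdf_eq_real, cdf_expMeasure_eq one_pos, if_pos k.coe_nonneg]
    simp

/-- Integration over the mark of a base station: the uniform variable is compared with a
threshold `p`, and the activity flag is averaged. -/
theorem lintegral_markLaw {p : ℝ} (hp : p ∈ Icc (0 : ℝ) 1) (q : ℝ≥0)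
    {F G : ℝ → Bool → ℝ≥0∞} (hF : ∀ a, Measurable fun h => F h a)
    (hG : ∀ a, Measurable fun h => G h a) :
    ∫⁻ m, (if m.1 ≤ p then F m.2.1 m.2.2 else G m.2.1 m.2.2) ∂markLaw q =
      ENNReal.ofReal p * ∫⁻ h, (q * F h true + (1 - q) * F h false) ∂expMeasure 1 +
      ENNReal.ofReal (1 - p) * ∫⁻ h, (q * G h true + (1 - q) * G h false) ∂expMeasure 1 := by
  have := isProbabilityMeasure_expMeasure one_pos
  have hm : ∀ {F : ℝ → Bool → ℝ≥0∞}, (∀ a, Measurable fun h => F h a) →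
      Measurable fun x : ℝ × Bool => F x.1 x.2 := fun hF =>
    measurable_from_prod_countable_left hF
  have hmain : Measurable fun m : ℝ × ℝ × Bool =>
      if m.1 ≤ p then F m.2.1 m.2.2 else G m.2.1 m.2.2 :=
    Measurable.ite (measurable_fst measurableSet_Iic) ((hm hF).comp measurable_snd)
      ((hm hG).comp measurable_snd)
  have hint : ∀ {F : ℝ → Bool → ℝ≥0∞}, (∀ a, Measurable fun h => F h a) →
      ∫⁻ x, F x.1 x.2
          ∂((expMeasure 1).prod (q • Measure.dirac true + (1 - q) • Measure.dirac false)) =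
        ∫⁻ h, (q * F h true + (1 - q) * F h false) ∂expMeasure 1 := by
    intro F hF
    rw [lintegral_prod _ (hm hF).aemeasurable]
    refine lintegral_congr fun h => ?_
    rw [lintegral_add_measure, lintegral_smul_measure, lintegral_smul_measure,
      lintegral_dirac, lintegral_dirac]
    simp [ENNReal.smul_def]
  rw [markLaw, lintegral_prod _ hmain.aemeasurable]
  have hinner : ∀ u : ℝ, ∫⁻ x : ℝ × Bool, (if u ≤ p then F x.1 x.2 else G x.1 x.2)
        ∂((expMeasure 1).prod (q • Measure.dirac true + (1 - q) • Measure.dirac false)) =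
      (Iic p).indicator (fun _ => ∫⁻ h, (q * F h true + (1 - q) * F h false) ∂expMeasure 1) u +
      (Ioi p).indicator (fun _ => ∫⁻ h, (q * G h true + (1 - q) * G h false) ∂expMeasure 1) u := by
    intro u
    by_cases hu : u ≤ p
    · simp [hu, hint hF, hu.not_gt]
    · simp [hu, hint hG, not_le.mp hu]
  simp_rw [hinner]
  rw [lintegral_add_left (measurable_const.indicator measurableSet_Iic),
    lintegral_indicator_const measurableSet_Iic, lintegral_indicator_const measurableSet_Ioi,
    Measure.restrict_apply measurableSet_Iic, Measure.restrict_apply measurableSet_Ioi]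
  have e1 : Iic p ∩ Icc (0 : ℝ) 1 = Icc 0 p := by
    ext u
    simp only [mem_inter_iff, mem_Iic, mem_Icc]
    constructor
    · rintro ⟨h1, h2, h3⟩; exact ⟨h2, h1⟩
    · rintro ⟨h1, h2⟩; exact ⟨h2, h1, h2.trans hp.2⟩
  have e2 : Ioi p ∩ Icc (0 : ℝ) 1 = Ioc p 1 := by
    ext u
    simp only [mem_inter_iff, mem_Ioi, mem_Icc, mem_Ioc]
    constructor
    · rintro ⟨h1, h2, h3⟩; exact ⟨h1, h3⟩
    · rintro ⟨h1, h2⟩; exact ⟨h1, hp.1.trans h1.le, h2⟩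
  rw [e1, e2, Real.volume_Icc, Real.volume_Ioc, sub_zero]
  ring

/-- The probability that a base station with path-loss value `z` is removed by the thinning that
keeps it with probability `0` if `z` exceeds the threshold `t`, and otherwise with probability
`E[e^{-σ t P z h 1{active}}]`. -/
noncomputable def removalOf (q P : ℝ) (σ : ℝ → ℝ) (t z : ℝ) : ℝ :=
  if t < z then 1 else q * (1 - 1 / (1 + σ t * (P * z)))

theorem removalOf_mem {q P : ℝ} {σ : ℝ → ℝ} (hq : q ∈ Icc (0 : ℝ) 1) (hP : 0 < P) {t z : ℝ}
    (hσ : 0 ≤ σ t) (hz : 0 ≤ z) : removalOf q P σ t z ∈ Icc (0 : ℝ) 1 := by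
  unfold removalOf
  split_ifs
  · simp
  · have h1 : 0 ≤ σ t * (P * z) := by positivity
    have h2 : 1 / (1 + σ t * (P * z)) ≤ 1 := by
      rw [div_le_one (by linarith)]
      linarith
    have h3 : 0 ≤ 1 / (1 + σ t * (P * z)) := by positivity
    constructor
    · exact mul_nonneg hq.1 (by linarith)
    · exact mul_le_one₀ hq.2 (by linarith) (by linarith)

theorem removalOf_antitoneOn {q P : ℝ} {σ : ℝ → ℝ} (hq : q ∈ Icc (0 : ℝ) 1) (hP : 0 < P)
    (hσ : ∀ t, 0 < t → 0 ≤ σ t) (hanti : AntitoneOn σ (Ioi 0)) {z : ℝ} (hz : 0 ≤ z) :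
    AntitoneOn (fun t => removalOf q P σ t z) (Ioi 0) := by
  intro t ht t' ht' htt'
  by_cases h : t < z
  · have : removalOf q P σ t z = 1 := if_pos h
    dsimp only
    rw [this]
    exact (removalOf_mem hq hP (hσ t' ht') hz).2
  · have h' : ¬ t' < z := fun hh => h (htt'.trans_lt hh)
    simp only [removalOf, if_neg h, if_neg h']
    have h0 : 0 ≤ σ t' * (P * z) := mul_nonneg (hσ t' ht') (by positivity)
    have := hq.1
    gcongr
    exact hanti ht ht' htt'

theorem removalOf_continuousWithinAt {q P : ℝ} {σ : ℝ → ℝ} (hP : 0 < P) {t z : ℝ}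
    (hσ : 0 ≤ σ t) (hcont : ContinuousAt σ t) (hz : 0 ≤ z) :
    ContinuousWithinAt (fun t => removalOf q P σ t z) (Ici t) t := by
  by_cases h : t < z
  · refine (continuousAt_const (y := (1 : ℝ))).congr ?_ |>.continuousWithinAt
    filter_upwards [eventually_lt_nhds h] with t' ht'
    exact (if_pos ht').symm
  · have h0 : 0 ≤ σ t * (P * z) := mul_nonneg hσ (by positivity)
    have hc : ContinuousAt (fun t => q * (1 - 1 / (1 + σ t * (P * z)))) t := by
      refine continuousAt_const.mul (continuousAt_const.sub (continuousAt_const.div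
        (continuousAt_const.add (hcont.mul continuousAt_const)) (by linarith)))
    refine hc.continuousWithinAt.congr (fun t' ht' => ?_) ?_
    · exact if_neg fun hh => h ((mem_Ici.mp ht').trans_lt hh)
    · exact if_neg h

theorem measurable_removalOf {q P : ℝ} {σ : ℝ → ℝ} (hσ : Measurable σ) :
    Measurable fun p : ℝ × ℝ => removalOf q P σ p.1 p.2 := by
  unfold removalOf
  refine Measurable.ite (measurableSet_lt measurable_fst measurable_snd) measurable_const ?_
  fun_prop

namespace PathLossModel

variable (M : PathLossModel)

/-- The path-loss value of the link from a base station at `x` with mark `m`. -/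
noncomputable def zetaMark (x : Plane) (m : ℝ × ℝ × Bool) : ℝ :=
  if m.1 ≤ M.PrL ‖x‖ then M.zetaL ‖x‖ else M.zetaNL ‖x‖

@[fun_prop]
theorem measurable_zetaMark : Measurable fun p : Plane × ℝ × ℝ × Bool => M.zetaMark p.1 p.2 := by
  unfold zetaMark
  refine Measurable.ite (measurableSet_le (by fun_prop) (by fun_prop)) ?_ ?_
  · exact (M.measurable_zetaOf true).comp (measurable_norm.comp measurable_fst)
  · exact (M.measurable_zetaOf false).comp (measurable_norm.comp measurable_fst)

/-- The contribution of a base station to the exponent: `∞` if its path-loss value exceeds the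
threshold `t`, so that `expNeg` of the sum vanishes when some base station beats the threshold,
and `σ t` times its interference otherwise. -/
noncomputable def cost (P : ℝ) (σ : ℝ → ℝ) (t : ℝ) (x : Plane) (m : ℝ × ℝ × Bool) : ℝ≥0∞ :=
  if t < M.zetaMark x m then ∞
  else if m.2.2 then ENNReal.ofReal (σ t * (P * M.zetaMark x m * m.2.1)) else 0

theorem measurable_cost {P : ℝ} {σ : ℝ → ℝ} (hσ : Measurable σ) :
    Measurable fun p : ℝ × Plane × ℝ × ℝ × Bool => M.cost P σ p.1 p.2.1 p.2.2 := by
  unfold cost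
  refine Measurable.ite (measurableSet_lt (by fun_prop) (by fun_prop)) measurable_const
    (Measurable.ite ?_ (by fun_prop) measurable_const)
  exact (measurable_snd.comp (measurable_snd.comp (measurable_snd.comp measurable_snd)))
    (measurableSet_singleton true)

/-- The probability that a base station at distance `r` is removed by the thinning of
`removalOf`, averaged over the type of its link. -/
noncomputable def removal (q P : ℝ) (σ : ℝ → ℝ) (t r : ℝ) : ℝ :=
  M.PrL r * removalOf q P σ t (M.zetaL r) + (1 - M.PrL r) * removalOf q P σ t (M.zetaNL r)

theorem removal_mem {q P : ℝ} {σ : ℝ → ℝ} (hq : q ∈ Icc (0 : ℝ) 1) (hP : 0 < P) {t : ℝ}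
    (hσ : 0 ≤ σ t) (r : ℝ) : M.removal q P σ t r ∈ Icc (0 : ℝ) 1 := by
  have h1 := M.PrL_mem r
  have h2 := removalOf_mem hq hP hσ (M.zetaOf_nonneg true r)
  have h3 := removalOf_mem hq hP hσ (M.zetaOf_nonneg false r)
  simp only [zetaOf, Bool.false_eq_true, if_false, if_true] at h2 h3
  exact (convex_Icc (0 : ℝ) 1) h2 h3 h1.1 (by linarith [h1.2]) (by ring)

theorem measurable_removal {q P : ℝ} {σ : ℝ → ℝ} (hσ : Measurable σ) :
    Measurable fun p : ℝ × ℝ => M.removal q P σ p.1 p.2 := by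
  have h := measurable_removalOf (q := q) (P := P) hσ
  have h1 : Measurable fun p : ℝ × ℝ => removalOf q P σ p.1 (M.zetaOf true p.2) :=
    h.comp (measurable_fst.prodMk ((M.measurable_zetaOf true).comp measurable_snd))
  have h2 : Measurable fun p : ℝ × ℝ => removalOf q P σ p.1 (M.zetaOf false p.2) :=
    h.comp (measurable_fst.prodMk ((M.measurable_zetaOf false).comp measurable_snd))
  have h3 : Measurable fun p : ℝ × ℝ => M.PrL p.2 := by fun_prop
  exact (h3.mul h1).add ((h3.const_sub 1).mul h2)

/-- Averaged over its mark, a base station contributes to `expNeg` of the total cost the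
probability of being kept by the thinning of `removal`. -/
theorem lintegral_markLaw_expNeg_cost {q : ℝ≥0} (hq : q ≤ 1) {P : ℝ} (hP : 0 < P) {σ : ℝ → ℝ}
    {t : ℝ} (hσ : 0 ≤ σ t) (x : Plane) :
    ∫⁻ m, expNeg (M.cost P σ t x m) ∂markLaw q = ENNReal.ofReal (1 - M.removal q P σ t ‖x‖) := by
  have := isProbabilityMeasure_expMeasure one_pos
  have hq' : (q : ℝ) ∈ Icc (0 : ℝ) 1 := ⟨q.coe_nonneg, hq⟩
  let F : ℝ → ℝ → Bool → ℝ≥0∞ := fun z h a =>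
    expNeg (if t < z then ∞ else if a then ENNReal.ofReal (σ t * (P * z * h)) else 0)
  have hF : ∀ z a, Measurable fun h => F z h a := by
    intro z a
    refine measurable_expNeg.comp ?_
    split_ifs <;> fun_prop
  have hcost : ∀ m : ℝ × ℝ × Bool, expNeg (M.cost P σ t x m) =
      if m.1 ≤ M.PrL ‖x‖ then F (M.zetaL ‖x‖) m.2.1 m.2.2 else F (M.zetaNL ‖x‖) m.2.1 m.2.2 := by
    intro m
    by_cases h : m.1 ≤ M.PrL ‖x‖
    · simp only [cost, zetaMark, if_pos h, F]
    · simp only [cost, zetaMark, if_neg h, F]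
  have hint : ∀ z, 0 ≤ z → ∫⁻ h, (q * F z h true + (1 - q) * F z h false) ∂expMeasure 1 =
      ENNReal.ofReal (1 - removalOf q P σ t z) := by
    intro z hz
    by_cases h : t < z
    · simp [F, removalOf, h]
    · have h0 : 0 ≤ σ t * (P * z) := mul_nonneg hσ (by positivity)
      have h1 : ∀ y : ℝ, σ t * (P * z * y) = σ t * (P * z) * y := fun y => by ring
      simp only [F, removalOf, h, if_false, if_true, Bool.false_eq_true, expNeg_zero, mul_one, h1]
      rw [lintegral_add_right _ measurable_const, lintegral_const_mul _ (by fun_prop),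
        lintegral_expMeasure_expNeg h0, lintegral_const, measure_univ, mul_one]
      have h2 : (1 : ℝ≥0∞) - q = ENNReal.ofReal (1 - q) := by
        rw [ENNReal.ofReal_sub _ q.coe_nonneg, ENNReal.ofReal_one, ENNReal.ofReal_coe_nnreal]
      rw [h2, ← ENNReal.ofReal_coe_nnreal, ← ENNReal.ofReal_mul q.coe_nonneg,
        ← ENNReal.ofReal_add (by positivity) (by linarith [hq'.2])]
      congr 1
      ring
  have hp := M.PrL_mem ‖x‖
  simp_rw [hcost]
  rw [lintegral_markLaw hp q (hF _) (hF _), hint (M.zetaL ‖x‖) (M.zetaOf_nonneg true _),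
    hint (M.zetaNL ‖x‖) (M.zetaOf_nonneg false _)]
  have h2 := removalOf_mem hq' hP hσ (M.zetaOf_nonneg true ‖x‖)
  have h3 := removalOf_mem hq' hP hσ (M.zetaOf_nonneg false ‖x‖)
  simp only [zetaOf, Bool.false_eq_true, if_false, if_true] at h2 h3
  rw [← ENNReal.ofReal_mul hp.1, ← ENNReal.ofReal_mul (by linarith [hp.2]), ← ENNReal.ofReal_add
    (mul_nonneg hp.1 (by linarith [h2.2])) (mul_nonneg (by linarith [hp.2]) (by linarith [h3.2]))]
  congr 1
  rw [removal]
  ring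

end PathLossModel

/-! ### Expectations over all candidates for the serving base station -/

theorem one_sub_ofReal_one_sub {x : ℝ} (hx : x ∈ Icc (0 : ℝ) 1) :
    1 - ENNReal.ofReal (1 - x) = ENNReal.ofReal x := by
  rw [← ENNReal.ofReal_one, ← ENNReal.ofReal_sub _ (by linarith [hx.2])]
  congr 1
  ring

namespace PathLossModel

variable (M : PathLossModel)

/-- The indicator of the event that the link of a base station at `x` with mark `m` is of type
`b`, LoS (`true`) or NLoS (`false`). -/
noncomputable def typeInd (b : Bool) (x : Plane) (m : ℝ × ℝ × Bool) : ℝ≥0∞ :=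
  if m.1 ≤ M.PrL ‖x‖ then (if b then 1 else 0) else (if b then 0 else 1)

@[fun_prop]
theorem measurable_typeInd (b : Bool) :
    Measurable fun p : Plane × ℝ × ℝ × Bool => M.typeInd b p.1 p.2 :=
  Measurable.ite (measurableSet_le (by fun_prop) (by fun_prop)) measurable_const measurable_const

theorem lintegral_markLaw_typeInd_mul {q : ℝ≥0} (hq : q ≤ 1) (b : Bool) (x : Plane)
    {F : ℝ → ℝ≥0∞} (hF : Measurable F) :
    ∫⁻ m, M.typeInd b x m * F m.2.1 ∂markLaw q =
      ENNReal.ofReal (M.probOf b ‖x‖) * ∫⁻ h, F h ∂expMeasure 1 := by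
  have hp := M.PrL_mem ‖x‖
  have hq1 : (q : ℝ≥0∞) + (1 - q) = 1 := add_tsub_cancel_of_le (by exact_mod_cast hq)
  have key : ∀ m : ℝ × ℝ × Bool, M.typeInd b x m * F m.2.1 =
      if m.1 ≤ M.PrL ‖x‖ then (fun h (_ : Bool) => if b then F h else 0) m.2.1 m.2.2
      else (fun h (_ : Bool) => if b then 0 else F h) m.2.1 m.2.2 := by
    intro m
    rw [typeInd]
    by_cases h : m.1 ≤ M.PrL ‖x‖ <;> cases b <;> simp [h]
  refine (lintegral_congr key).trans ((lintegral_markLaw hp q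
    (F := fun h _ => if b then F h else 0) (G := fun h _ => if b then 0 else F h)
    (fun _ => by cases b <;> simp [hF]) (fun _ => by cases b <;> simp [hF])).trans ?_)
  simp_rw [← add_mul, hq1, one_mul]
  cases b <;> simp [probOf]

end PathLossModel

namespace Network

variable {lam lamA : ℝ≥0} {Ω : Type*} [MeasurableSpace Ω] {μ : Measure Ω}
  (W : Network lam lamA μ) (M : PathLossModel)

/-- The total cost of the base stations other than the `i`-th one, for the threshold `t`. -/
noncomputable def totalCost (P : ℝ) (σ : ℝ → ℝ) (t : ℝ) (i : ℕ) (ω : Ω) : ℝ≥0∞ :=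
  sumOthers i fun j => M.cost P σ t (W.pos j ω) (W.mark j ω)

variable [IsProbabilityMeasure μ]

/-- The other marks and the fading of one base station are integrated out. -/
theorem lintegral_typeInd_mul (hlamA : lamA ≤ lam)
    {P : ℝ} (hP : 0 < P) {σ : ℝ → ℝ} (hσm : Measurable σ) (hσ : ∀ t, 0 < t → 0 ≤ σ t)
    (b : Bool) {A : Set ℝ} (hA : MeasurableSet A) (hA0 : A ⊆ Ioi 0)
    {c : ℝ → ℝ} {F : ℝ → ℝ≥0∞ → ℝ → ℝ≥0∞}
    (hF : Measurable fun p : ℝ × ℝ≥0∞ × ℝ => F p.1 p.2.1 p.2.2)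
    (hFint : ∀ t U, 0 < t →
      ∫⁻ h, F t U h ∂expMeasure 1 = expNeg (ENNReal.ofReal (c t)) * expNeg U) (i : ℕ) :
    ∫⁻ ω, A.indicator 1 ‖W.pos i ω‖ * (M.typeInd b (W.pos i ω) (W.mark i ω) *
        F (M.zetaOf b ‖W.pos i ω‖) (W.totalCost M P σ (M.zetaOf b ‖W.pos i ω‖) i ω)
          (W.fading i ω)) ∂μ =
      ∫⁻ ω, (A.indicator 1 ‖W.pos i ω‖ * (ENNReal.ofReal (M.probOf b ‖W.pos i ω‖) *
          expNeg (ENNReal.ofReal (c (M.zetaOf b ‖W.pos i ω‖))))) *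
        expNeg (sumOthers i fun j => negLog (ENNReal.ofReal
          (1 - M.removal (lamA / lam : ℝ≥0) P σ (M.zetaOf b ‖W.pos i ω‖) ‖W.pos j ω‖))) ∂μ := by
  have hq : lamA / lam ≤ 1 := div_le_one_of_le₀ hlamA zero_le
  let U : (ℕ → Plane) → (ℕ → ℝ × ℝ × Bool) → ℝ≥0∞ := fun x m' =>
    sumOthers i fun j => M.cost P σ (M.zetaOf b ‖x i‖) (x j) (m' j)
  let Φ : (ℕ → Plane) → (ℕ → ℝ × ℝ × Bool) → ℝ × ℝ × Bool → ℝ≥0∞ := fun x m' m =>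
    A.indicator 1 ‖x i‖ * (M.typeInd b (x i) m * F (M.zetaOf b ‖x i‖) (U x m') m.2.1)
  have hU : Measurable fun p : (ℕ → Plane) × (ℕ → ℝ × ℝ × Bool) => U p.1 p.2 := by
    refine measurable_sumOthers i fun j => ?_
    have hj : Measurable fun p : (ℕ → Plane) × (ℕ → ℝ × ℝ × Bool) =>
        (M.zetaOf b ‖p.1 i‖, p.1 j, p.2 j) := by fun_prop
    have := (M.measurable_cost (P := P) hσm).comp hj
    exact this
  have hΦ : Measurable fun p : (ℕ → Plane) × (ℕ → ℝ × ℝ × Bool) × (ℝ × ℝ × Bool) =>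
      Φ p.1 p.2.1 p.2.2 := by
    have h1 : Measurable fun p : (ℕ → Plane) × (ℕ → ℝ × ℝ × Bool) × (ℝ × ℝ × Bool) =>
        A.indicator (1 : ℝ → ℝ≥0∞) ‖p.1 i‖ :=
      (measurable_one.indicator hA).comp (by fun_prop)
    have h2 : Measurable fun p : (ℕ → Plane) × (ℕ → ℝ × ℝ × Bool) × (ℝ × ℝ × Bool) =>
        M.typeInd b (p.1 i) p.2.2 :=
      (M.measurable_typeInd b).comp (f := fun p : (ℕ → Plane) × (ℕ → ℝ × ℝ × Bool) ×
        (ℝ × ℝ × Bool) => (p.1 i, p.2.2)) (by fun_prop)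
    have h3 : Measurable fun p : (ℕ → Plane) × (ℕ → ℝ × ℝ × Bool) × (ℝ × ℝ × Bool) =>
        U p.1 p.2.1 :=
      hU.comp (f := fun p : (ℕ → Plane) × (ℕ → ℝ × ℝ × Bool) ×
        (ℝ × ℝ × Bool) => (p.1, p.2.1)) (by fun_prop)
    have h4 : Measurable fun p : (ℕ → Plane) × (ℕ → ℝ × ℝ × Bool) × (ℝ × ℝ × Bool) =>
        (M.zetaOf b ‖p.1 i‖, U p.1 p.2.1, p.2.2.2.1) :=
      Measurable.prodMk (by fun_prop) (h3.prodMk (by fun_prop))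
    exact h1.mul (h2.mul (hF.comp h4))
  have hUupd : ∀ x m' c, U x (Function.update m' i c) = U x m' := fun x m' c =>
    sumOthers_congr fun j hj => by rw [Function.update_of_ne hj]
  have hsplit := W.lintegral_split_mark i hΦ (fun x m' m c => by simp only [Φ, hUupd])
  change ∫⁻ ω, Φ (fun j => W.pos j ω) (fun j => W.mark j ω) (W.mark i ω) ∂μ = _
  rw [hsplit]
  refine lintegral_congr fun ω => ?_
  by_cases hx : ‖W.pos i ω‖ ∈ A
  · have ht : 0 < M.zetaOf b ‖W.pos i ω‖ := M.zetaOf_pos b (hA0 hx)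
    set t := M.zetaOf b ‖W.pos i ω‖ with ht_def
    have hcost : ∀ x, ∫⁻ m, expNeg (M.cost P σ t x m) ∂markLaw (lamA / lam) =
        ENNReal.ofReal (1 - M.removal (lamA / lam : ℝ≥0) P σ t ‖x‖) := fun x =>
      M.lintegral_markLaw_expNeg_cost hq hP (hσ t ht) x
    have hmark : ∀ ω', ∫⁻ m, Φ (fun j => W.pos j ω) (fun j => W.mark j ω') m ∂markLaw (lamA / lam) =
        ENNReal.ofReal (M.probOf b ‖W.pos i ω‖) * expNeg (ENNReal.ofReal (c t)) *
          expNeg (sumOthers i fun j => M.cost P σ t (W.pos j ω) (W.mark j ω')) := by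
      intro ω'
      simp only [Φ, indicator_of_mem hx, Pi.one_apply, one_mul]
      rw [M.lintegral_markLaw_typeInd_mul hq b (W.pos i ω) (F := fun h => F (M.zetaOf b ‖W.pos i ω‖)
        (U (fun j => W.pos j ω) fun j => W.mark j ω') h) (hF.comp (by fun_prop :
          Measurable fun h : ℝ => (M.zetaOf b ‖W.pos i ω‖,
            U (fun j => W.pos j ω) (fun j => W.mark j ω'), h))), hFint _ _ ht, ← mul_assoc]
    have hcm : ∀ x, Measurable fun m => M.cost P σ t x m := fun x =>
      (M.measurable_cost (P := P) hσm).comp (measurable_const.prodMk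
        (measurable_const.prodMk measurable_id))
    have hUm : Measurable fun ω' =>
        expNeg (sumOthers i fun j => M.cost P σ t (W.pos j ω) (W.mark j ω')) :=
      measurable_expNeg.comp (measurable_sumOthers i fun j =>
        (hcm (W.pos j ω)).comp (W.measurable_mark j))
    simp_rw [hmark]
    rw [lintegral_const_mul _ hUm, W.lintegral_expNeg_sumOthers_mark i
        (g := fun j m => M.cost P σ t (W.pos j ω) m) (fun j => hcm _)]
    simp_rw [hcost]
    simp [indicator_of_mem hx]
  · simp [Φ, indicator_of_notMem hx]

/-- The sum over all base stations of the expectation of a functional of the base station, in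
which the other base stations enter through their total cost only. -/
theorem tsum_lintegral_typeInd_mul (hlamA : lamA ≤ lam)
    {P : ℝ} (hP : 0 < P) {σ : ℝ → ℝ} (hσm : Measurable σ) (hσ : ∀ t, 0 < t → 0 ≤ σ t)
    (hσanti : AntitoneOn σ (Ioi 0)) (hσcont : ∀ t, 0 < t → ContinuousAt σ t)
    (b : Bool) {A : Set ℝ} (hA : MeasurableSet A) (hA0 : A ⊆ Ioi 0)
    {c : ℝ → ℝ} (hcm : Measurable c) {F : ℝ → ℝ≥0∞ → ℝ → ℝ≥0∞}
    (hF : Measurable fun p : ℝ × ℝ≥0∞ × ℝ => F p.1 p.2.1 p.2.2)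
    (hFint : ∀ t U, 0 < t →
      ∫⁻ h, F t U h ∂expMeasure 1 = expNeg (ENNReal.ofReal (c t)) * expNeg U) :
    ∑' i, ∫⁻ ω, A.indicator 1 ‖W.pos i ω‖ * (M.typeInd b (W.pos i ω) (W.mark i ω) *
        F (M.zetaOf b ‖W.pos i ω‖) (W.totalCost M P σ (M.zetaOf b ‖W.pos i ω‖) i ω)
          (W.fading i ω)) ∂μ =
      ∫⁻ r in A, ENNReal.ofReal (M.probOf b r * (2 * Real.pi * r * lam)) *
        (expNeg (ENNReal.ofReal (c (M.zetaOf b r))) *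
        expNeg (∫⁻ u in Ioi (0 : ℝ), ENNReal.ofReal
          (M.removal (lamA / lam : ℝ≥0) P σ (M.zetaOf b r) u * (2 * Real.pi * u * lam)))) := by
  have hq : lamA / lam ≤ 1 := div_le_one_of_le₀ hlamA zero_le
  have hq' : ((lamA / lam : ℝ≥0) : ℝ) ∈ Icc (0 : ℝ) 1 := ⟨NNReal.coe_nonneg _, hq⟩
  set q : ℝ := ((lamA / lam : ℝ≥0) : ℝ) with hq_def
  simp_rw [W.lintegral_typeInd_mul M hlamA hP hσm hσ b hA hA0 hF hFint]
  let g : ℝ → Plane → ℝ≥0∞ := fun t y => negLog (ENNReal.ofReal (1 - M.removal q P σ t ‖y‖))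
  have hgr : ∀ t, 0 < t → ∀ y, 1 - expNeg (g t y) = ENNReal.ofReal (M.removal q P σ t ‖y‖) := by
    intro t ht y
    have hr := M.removal_mem hq' hP (hσ t ht) ‖y‖
    rw [expNeg_negLog, one_sub_ofReal_one_sub hr]
    rw [← ENNReal.ofReal_one]
    exact ENNReal.ofReal_le_ofReal (by linarith [hr.1])
  have hrm := M.measurable_removal (q := q) (P := P) hσm
  have hg : Measurable (Function.uncurry g) := by
    have h1 : Measurable fun p : ℝ × Plane => M.removal q P σ p.1 ‖p.2‖ :=
      hrm.comp (f := fun p : ℝ × Plane => (p.1, ‖p.2‖)) (by fun_prop)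
    exact measurable_negLog.comp (h1.const_sub 1).ennreal_ofReal
  have hanti : ∀ y, AntitoneOn (fun t => g t y) (Ioi 0) := by
    intro y t ht t' ht' htt'
    refine negLog_antitone (ENNReal.ofReal_le_ofReal (sub_le_sub_left ?_ 1))
    have h1 := M.PrL_mem ‖y‖
    refine add_le_add (mul_le_mul_of_nonneg_left ?_ h1.1)
      (mul_le_mul_of_nonneg_left ?_ (by linarith [h1.2]))
    · exact removalOf_antitoneOn hq' hP hσ hσanti (M.zetaOf_nonneg true _) ht ht' htt'
    · exact removalOf_antitoneOn hq' hP hσ hσanti (M.zetaOf_nonneg false _) ht ht' htt'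
  have hcont : ∀ y t, 0 < t → ContinuousWithinAt (fun t => g t y) (Ici t) t := by
    intro y t ht
    have hnl : Continuous negLog := by
      unfold negLog
      exact EReal.continuous_toENNReal.comp (continuous_neg.comp ENNReal.continuous_log)
    refine hnl.continuousAt.comp_continuousWithinAt
      (ENNReal.continuous_ofReal.continuousAt.comp_continuousWithinAt
        (continuousWithinAt_const.sub ((continuousWithinAt_const.mul ?_).add
          (continuousWithinAt_const.mul ?_))))
    · exact removalOf_continuousWithinAt hP (hσ t ht) (hσcont t ht) (M.zetaOf_nonneg true _)
    · exact removalOf_continuousWithinAt hP (hσ t ht) (hσcont t ht) (M.zetaOf_nonneg false _)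
  let f₀ : ℝ → ℝ≥0∞ := fun r => A.indicator 1 r *
    (ENNReal.ofReal (M.probOf b r) * expNeg (ENNReal.ofReal (c (M.zetaOf b r))))
  have hf₀ : Measurable f₀ := (measurable_one.indicator hA).mul (by fun_prop)
  have hmecke := W.ppp.mecke_threshold (T := fun x => M.zetaOf b ‖x‖) (by fun_prop) hg hanti hcont
    (f := fun x => f₀ ‖x‖) (hf₀.comp measurable_norm)
    (fun x => by
      refine mul_le_one' ?_ (mul_le_one' ?_ (expNeg_le_one _))
      · exact indicator_le_self _ _ _
      · rw [← ENNReal.ofReal_one]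
        exact ENNReal.ofReal_le_ofReal (M.probOf_mem b _).2)
    (fun x hx => by
      refine M.zetaOf_pos b (hA0 ?_)
      by_contra hcon
      exact hx (by simp [f₀, indicator_of_notMem hcon]))
  rw [hmecke]
  -- polar coordinates in the inner and in the outer integral
  have hinner : ∀ t, 0 < t → (lam : ℝ≥0∞) * ∫⁻ y, (1 - expNeg (g t y)) =
      ∫⁻ u in Ioi (0 : ℝ), ENNReal.ofReal (M.removal q P σ t u * (2 * Real.pi * u * lam)) := by
    intro t ht
    have hm : Measurable fun u => ENNReal.ofReal (M.removal q P σ t u) :=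
      (hrm.comp (f := fun u : ℝ => (t, u)) (by fun_prop)).ennreal_ofReal
    simp_rw [hgr t ht]
    rw [lintegral_comp_norm_plane hm, ← lintegral_const_mul _ (by fun_prop)]
    refine setLIntegral_congr_fun measurableSet_Ioi fun u hu => ?_
    have hr := M.removal_mem hq' hP (hσ t ht) u
    have hu' : (0 : ℝ) < u := hu
    rw [← ENNReal.ofReal_coe_nnreal, ← ENNReal.ofReal_mul hr.1, ← ENNReal.ofReal_mul lam.coe_nonneg]
    congr 1
    ring
  have houter : ∀ x : Plane, f₀ ‖x‖ * expNeg (lam * ∫⁻ y, (1 - expNeg (g (M.zetaOf b ‖x‖) y))) =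
      (fun r => f₀ r * expNeg (∫⁻ u in Ioi (0 : ℝ), ENNReal.ofReal
        (M.removal q P σ (M.zetaOf b r) u * (2 * Real.pi * u * lam)))) ‖x‖ := by
    intro x
    by_cases hx : ‖x‖ ∈ A
    · rw [hinner _ (M.zetaOf_pos b (hA0 hx))]
    · simp [f₀, indicator_of_notMem hx]
  simp_rw [houter]
  have hm : Measurable fun r => f₀ r * expNeg (∫⁻ u in Ioi (0 : ℝ), ENNReal.ofReal
      (M.removal q P σ (M.zetaOf b r) u * (2 * Real.pi * u * lam))) := by
    refine hf₀.mul (measurable_expNeg.comp ?_)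
    have h1 : Measurable fun p : ℝ × ℝ => M.removal q P σ (M.zetaOf b p.1) p.2 :=
      hrm.comp (f := fun p : ℝ × ℝ => (M.zetaOf b p.1, p.2)) (by fun_prop)
    have h2 : Measurable fun p : ℝ × ℝ => ENNReal.ofReal
      (M.removal q P σ (M.zetaOf b p.1) p.2 * (2 * Real.pi * p.2 * lam)) := by fun_prop
    exact h2.lintegral_prod_right'
  rw [lintegral_comp_norm_plane hm, ← lintegral_const_mul _ (by fun_prop),
    ← lintegral_indicator measurableSet_Ioi, ← lintegral_indicator hA]
  refine lintegral_congr fun r => ?_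
  by_cases hr : r ∈ A
  · have hr0 : (0 : ℝ) < r := hA0 hr
    have hp := (M.probOf_mem b r).1
    rw [indicator_of_mem (show r ∈ Ioi (0 : ℝ) from hr0), indicator_of_mem hr]
    simp only [f₀, indicator_of_mem hr, Pi.one_apply, one_mul]
    rw [ENNReal.ofReal_mul hp,
      ENNReal.ofReal_mul (p := 2 * Real.pi * r) (q := (lam : ℝ)) (by positivity),
      ENNReal.ofReal_coe_nnreal]
    ring
  · rw [indicator_of_notMem hr]
    simp [f₀, indicator_of_notMem hr]

end Network

/-! ### The serving base station -/

namespace IsHomogeneousPPP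

variable {Ω : Type*} [MeasurableSpace Ω] {μ : Measure Ω} {lam : ℝ≥0} {X : ℕ → Ω → Plane}
  [IsProbabilityMeasure μ]

theorem ae_forall_ne_zero (h : IsHomogeneousPPP μ lam X) : ∀ᵐ ω ∂μ, ∀ i, X i ω ≠ 0 := by
  have hm : MeasurableSet ({0} : Set Plane) := measurableSet_singleton 0
  have h1 := h.lintegral_count hm (by simp)
  rw [measure_singleton, mul_zero, lintegral_eq_zero_iff (h.measurable_count hm)] at h1
  filter_upwards [h1] with ω hω i hi
  rw [countingMeasure_apply X ω hm, Pi.zero_apply, ENNReal.tsum_eq_zero] at hω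
  have := hω i
  simp [hi] at this

/-- The points of the process are almost surely locally finite. -/
theorem ae_forall_finite_norm_lt (h : IsHomogeneousPPP μ lam X) :
    ∀ᵐ ω ∂μ, ∀ n : ℕ, {i | ‖X i ω‖ < n}.Finite := by
  rw [ae_all_iff]
  intro n
  have hm : MeasurableSet (Metric.ball (0 : Plane) n) := measurableSet_ball
  have hfin : volume (Metric.ball (0 : Plane) n) ≠ ∞ := measure_ball_lt_top.ne
  have h1 := ae_lt_top (h.measurable_count hm) (by
    rw [h.lintegral_count hm hfin]
    exact ENNReal.mul_ne_top ENNReal.coe_ne_top hfin)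
  filter_upwards [h1] with ω hω
  rw [countingMeasure_apply X ω hm] at hω
  refine (ENNReal.finite_const_le_of_tsum_ne_top hω.ne one_ne_zero).subset fun i hi => ?_
  have : X i ω ∈ Metric.ball (0 : Plane) n := by
    rw [mem_ball_zero_iff]
    exact hi
  simp [indicator_of_mem this]

end IsHomogeneousPPP

namespace Network

variable {lam lamA : ℝ≥0} {Ω : Type*} [MeasurableSpace Ω] {μ : Measure Ω}
  (W : Network lam lamA μ) (M : PathLossModel)

theorem zeta_eq_zetaMark (i : ℕ) (ω : Ω) :
    W.zeta M i ω = M.zetaMark (W.pos i ω) (W.mark i ω) := by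
  unfold zeta PathLossModel.zetaMark IsLoS mark
  congr

theorem zeta_eq_zetaOf {i : ℕ} {ω : Ω} {b : Bool} (h : W.IsLoS M i ω ↔ b = true) :
    W.zeta M i ω = M.zetaOf b ‖W.pos i ω‖ := by
  unfold zeta PathLossModel.zetaOf
  cases b <;> simp_all

theorem exists_zeta_eq_zetaOf (i : ℕ) (ω : Ω) : ∃ b, W.zeta M i ω = M.zetaOf b ‖W.pos i ω‖ := by
  by_cases h : W.IsLoS M i ω
  · exact ⟨true, W.zeta_eq_zetaOf M (by simp [h])⟩
  · exact ⟨false, W.zeta_eq_zetaOf M (by simp [h])⟩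

theorem typeInd_eq (b : Bool) (i : ℕ) (ω : Ω) [Decidable (W.IsLoS M i ω ↔ b = true)] :
    M.typeInd b (W.pos i ω) (W.mark i ω) = if W.IsLoS M i ω ↔ b = true then 1 else 0 := by
  unfold PathLossModel.typeInd
  have : (W.mark i ω).1 ≤ M.PrL ‖W.pos i ω‖ ↔ W.IsLoS M i ω := Iff.rfl
  by_cases h : W.IsLoS M i ω <;> cases b <;> simp [this, h]

/-- Two different links have different path-loss values: the pairs of positions for which they
could agree form a null set, as the path-loss functions are injective on `(0, ∞)`. -/
theorem ae_forall_zeta_ne [IsProbabilityMeasure μ]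
    (hζ : ∀ b, StrictAntiOn (M.zetaOf b) (Ioi 0)) :
    ∀ᵐ ω ∂μ, ∀ i j, j ≠ i → W.zeta M i ω ≠ W.zeta M j ω := by
  let D : Bool → Bool → Set (Plane × Plane) := fun a b =>
    {p | p.2 ≠ 0 ∧ M.zetaOf a ‖p.1‖ = M.zetaOf b ‖p.2‖}
  have hD : ∀ a b, MeasurableSet (D a b) := by
    intro a b
    refine MeasurableSet.inter ?_ ?_
    · exact (measurable_snd (measurableSet_singleton 0)).compl
    · exact measurableSet_eq_fun (by fun_prop) (by fun_prop)
  have hD0 : ∀ a b, ((volume : Measure Plane).prod volume) (D a b) = 0 := by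
    intro a b
    rw [Measure.measure_prod_null (hD a b)]
    refine Filter.Eventually.of_forall fun x => ?_
    by_cases hne : (Prod.mk x ⁻¹' D a b).Nonempty
    · obtain ⟨y₀, hy₀⟩ := hne
      have hsub : Prod.mk x ⁻¹' D a b ⊆ Metric.sphere 0 ‖y₀‖ := by
        intro y hy
        rw [mem_sphere_zero_iff_norm]
        exact (hζ b).injOn (norm_pos_iff.mpr hy.1) (norm_pos_iff.mpr hy₀.1)
          (hy.2.symm.trans hy₀.2)
      refine measure_mono_null hsub (Measure.addHaar_sphere_of_ne_zero _ _ ?_)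
      exact norm_ne_zero_iff.mpr hy₀.1
    · simp [not_nonempty_iff_eq_empty.mp hne]
  have h1 : ∀ᵐ ω ∂μ, ∀ a b, ∀ i j, j ≠ i → (W.pos i ω, W.pos j ω) ∉ D a b := by
    simp_rw [ae_all_iff (ι := Bool)]
    exact fun a b => W.ppp.ae_forall_pair_notMem (hD a b) (hD0 a b)
  filter_upwards [h1, W.ppp.ae_forall_ne_zero] with ω hω h0 i j hij heq
  obtain ⟨a, ha⟩ := W.exists_zeta_eq_zetaOf M i ω
  obtain ⟨b, hb⟩ := W.exists_zeta_eq_zetaOf M j ω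
  exact hω a b i j hij ⟨h0 j, by rw [← ha, ← hb, heq]⟩

/-- Almost surely there is exactly one serving base station: the path-loss values of only finitely
many base stations exceed a given positive level, and they are pairwise different. -/
theorem ae_existsUnique_isServing [IsProbabilityMeasure μ]
    (hζ : ∀ b, StrictAntiOn (M.zetaOf b) (Ioi 0)) :
    ∀ᵐ ω ∂μ, ∃! i, W.IsServing M i ω := by
  filter_upwards [W.ae_forall_zeta_ne M hζ, W.ppp.ae_forall_ne_zero,
    W.ppp.ae_forall_finite_norm_lt] with ω hne h0 hfin
  have hpos : 0 < W.zeta M 0 ω := by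
    obtain ⟨b, hb⟩ := W.exists_zeta_eq_zetaOf M 0 ω
    rw [hb]
    exact M.zetaOf_pos b (norm_pos_iff.mpr (h0 0))
  choose K hK using fun b => M.exists_zetaOf_lt b hpos
  obtain ⟨n, hn⟩ := exists_nat_gt (max (K true) (K false))
  have hS : {i | W.zeta M 0 ω ≤ W.zeta M i ω}.Finite := by
    refine (hfin n).subset fun i hi => ?_
    by_contra hcon
    have hcon' : (n : ℝ) ≤ ‖W.pos i ω‖ := not_lt.mp hcon
    obtain ⟨b, hb⟩ := W.exists_zeta_eq_zetaOf M i ω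
    have hKb : K b ≤ max (K true) (K false) := by cases b <;> simp
    have := hK b ‖W.pos i ω‖ ((hKb.trans_lt hn).trans_le hcon')
    rw [← hb] at this
    exact absurd hi (not_le.mpr this)
  obtain ⟨i, hi, hmax⟩ := exists_max_image _ (fun i => W.zeta M i ω) hS ⟨0, le_refl (W.zeta M 0 ω)⟩
  have hserv : W.IsServing M i ω := by
    intro j
    rcases le_or_gt (W.zeta M 0 ω) (W.zeta M j ω) with h | h
    · exact hmax j h
    · exact h.le.trans hi
  refine ⟨i, hserv, fun j hj => ?_⟩
  by_contra hij
  exact hne i j hij (le_antisymm (hj i) (hserv j))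

theorem serving_eq {ω : Ω} (hu : ∃! i, W.IsServing M i ω) {i : ℕ} (hi : W.IsServing M i ω) :
    W.serving M ω = i := by
  have : {j | W.IsServing M j ω} = {i} := by
    ext j
    simp only [mem_ofPred_eq, mem_singleton_iff]
    exact ⟨fun hj => hu.unique hj hi, fun h => h ▸ hi⟩
  rw [serving, this, csInf_singleton]

/-- A base station beaten by another one has infinite total cost at the threshold of its own
path-loss value, hence contributes nothing to a functional vanishing at `∞`. -/
theorem totalCost_of_not_isServing {P : ℝ} {σ : ℝ → ℝ} {i : ℕ} {ω : Ω}
    (h : ¬ W.IsServing M i ω) : W.totalCost M P σ (W.zeta M i ω) i ω = ∞ := by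
  simp only [IsServing, not_forall, not_le] at h
  obtain ⟨j, hj⟩ := h
  have hji : j ≠ i := fun hh => by rw [hh] at hj; exact lt_irrefl _ hj
  rw [zeta_eq_zetaMark W M j] at hj
  refine ENNReal.tsum_eq_top_of_eq_top ⟨j, ?_⟩
  simp [hji, PathLossModel.cost, hj]

/-- For the serving base station the total cost at the threshold of its own path-loss value is a
multiple of the interference. -/
theorem totalCost_serving {P : ℝ} {σ : ℝ → ℝ} {ω : Ω}
    (h : W.IsServing M (W.serving M ω) ω) (hσ : 0 ≤ σ (W.zeta M (W.serving M ω) ω)) :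
    W.totalCost M P σ (W.zeta M (W.serving M ω) ω) (W.serving M ω) ω =
      ENNReal.ofReal (σ (W.zeta M (W.serving M ω) ω)) * W.interference M P ω := by
  set i := W.serving M ω
  have hI : W.interference M P ω = sumOthers i fun j =>
      if W.active j ω then ENNReal.ofReal (P * W.zeta M j ω * W.fading j ω) else 0 := by
    unfold interference sumOthers
    refine (tsum_subtype {j | W.active j ω = true ∧ j ≠ W.serving M ω}
      fun j => ENNReal.ofReal (P * W.zeta M j ω * W.fading j ω)).trans (tsum_congr fun j => ?_)
    by_cases h1 : j = i <;> by_cases h2 : W.active j ω = true <;>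
      simp [h1, h2, i, indicator]
  rw [hI, ← sumOthers_const_mul]
  refine sumOthers_congr fun j _ => ?_
  have hj := h j
  rw [PathLossModel.cost, ← W.zeta_eq_zetaMark M j, if_neg (not_lt.mpr hj)]
  have : (W.mark j ω).2.2 = W.active j ω := rfl
  rw [this]
  by_cases h2 : W.active j ω = true
  · rw [if_pos h2, if_pos h2, ENNReal.ofReal_mul hσ]
    rfl
  · rw [if_neg h2, if_neg h2, mul_zero]

/-- A functional of the serving base station, its distance being in `A` and its link being of type
`b`, is almost surely equal to a measurable function whose integral is explicit. -/
theorem exists_ae_eq_indicator_serving [IsProbabilityMeasure μ]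
    (hζ : ∀ b, StrictAntiOn (M.zetaOf b) (Ioi 0)) (hlamA : lamA ≤ lam)
    {P : ℝ} (hP : 0 < P) {σ : ℝ → ℝ} (hσm : Measurable σ) (hσ : ∀ t, 0 < t → 0 ≤ σ t)
    (hσanti : AntitoneOn σ (Ioi 0)) (hσcont : ∀ t, 0 < t → ContinuousAt σ t)
    (b : Bool) {A : Set ℝ} (hA : MeasurableSet A) (hA0 : A ⊆ Ioi 0)
    {c : ℝ → ℝ} (hcm : Measurable c) {F : ℝ → ℝ≥0∞ → ℝ → ℝ≥0∞}
    (hF : Measurable fun p : ℝ × ℝ≥0∞ × ℝ => F p.1 p.2.1 p.2.2)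
    (hFint : ∀ t U, 0 < t →
      ∫⁻ h, F t U h ∂expMeasure 1 = expNeg (ENNReal.ofReal (c t)) * expNeg U)
    (hFtop : ∀ t h, F t ∞ h = 0) :
    ∃ G : Ω → ℝ≥0∞, Measurable G ∧
      ({ω | (W.ServingLoS M ω ↔ b = true) ∧ W.servingDist M ω ∈ A}.indicator fun ω =>
        F (W.zeta M (W.serving M ω) ω)
          (ENNReal.ofReal (σ (W.zeta M (W.serving M ω) ω)) * W.interference M P ω)
          (W.fading (W.serving M ω) ω)) =ᵐ[μ] G ∧
      ∫⁻ ω, G ω ∂μ =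
        ∫⁻ r in A, ENNReal.ofReal (M.probOf b r * (2 * Real.pi * r * lam)) *
          (expNeg (ENNReal.ofReal (c (M.zetaOf b r))) *
          expNeg (∫⁻ u in Ioi (0 : ℝ), ENNReal.ofReal
            (M.removal (lamA / lam : ℝ≥0) P σ (M.zetaOf b r) u * (2 * Real.pi * u * lam)))) := by
  classical
  let term : ℕ → Ω → ℝ≥0∞ := fun i ω =>
    A.indicator 1 ‖W.pos i ω‖ * (M.typeInd b (W.pos i ω) (W.mark i ω) *
      F (M.zetaOf b ‖W.pos i ω‖) (W.totalCost M P σ (M.zetaOf b ‖W.pos i ω‖) i ω)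
        (W.fading i ω))
  have hterm : ∀ i, Measurable (term i) := by
    intro i
    have hpos : ∀ j, Measurable (W.pos j) := W.ppp.measurable
    have ht : Measurable fun ω => M.zetaOf b ‖W.pos i ω‖ :=
      (M.measurable_zetaOf b).comp (hpos i).norm
    have h2 : Measurable fun ω => M.typeInd b (W.pos i ω) (W.mark i ω) :=
      (M.measurable_typeInd b).comp ((hpos i).prodMk (W.measurable_mark i))
    have h3 : Measurable fun ω => W.totalCost M P σ (M.zetaOf b ‖W.pos i ω‖) i ω :=
      measurable_sumOthers i fun j => (M.measurable_cost (P := P) hσm).comp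
        (ht.prodMk ((hpos j).prodMk (W.measurable_mark j)))
    exact ((measurable_one.indicator hA).comp (hpos i).norm).mul
      (h2.mul (hF.comp (ht.prodMk (h3.prodMk (W.measurable_fading i)))))
  refine ⟨fun ω => ∑' i, term i ω, Measurable.tsum hterm, ?_, ?_⟩
  · filter_upwards [W.ae_existsUnique_isServing M hζ, W.ppp.ae_forall_ne_zero] with ω hu h0
    obtain ⟨i, hi, -⟩ := id hu
    have hs := W.serving_eq M hu hi
    rw [tsum_eq_single i]
    · by_cases hdist : ‖W.pos i ω‖ ∈ A
      · by_cases htype : W.IsLoS M i ω ↔ b = true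
        · have hmem : ω ∈ {ω | (W.ServingLoS M ω ↔ b = true) ∧ W.servingDist M ω ∈ A} := by
            rw [mem_ofPred_eq, ServingLoS, servingDist, hs]
            exact ⟨htype, hdist⟩
          have hz := W.zeta_eq_zetaOf M htype
          have hzpos : 0 < W.zeta M i ω := by
            rw [hz]
            exact M.zetaOf_pos b (hA0 hdist)
          have hcost := W.totalCost_serving M (P := P) (σ := σ) (ω := ω) (by rwa [hs])
            (by rw [hs]; exact hσ _ hzpos)
          rw [indicator_of_mem hmem]
          simp only [term]
          rw [indicator_of_mem hdist, W.typeInd_eq, if_pos htype, Pi.one_apply, one_mul, one_mul,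
            ← hz, ← hcost, hs]
        · have hmem : ω ∉ {ω | (W.ServingLoS M ω ↔ b = true) ∧ W.servingDist M ω ∈ A} := by
            rw [mem_ofPred_eq, ServingLoS, hs]
            exact fun h => htype h.1
          rw [indicator_of_notMem hmem]
          simp only [term]
          rw [W.typeInd_eq, if_neg htype, zero_mul, mul_zero]
      · have hmem : ω ∉ {ω | (W.ServingLoS M ω ↔ b = true) ∧ W.servingDist M ω ∈ A} := by
          rw [mem_ofPred_eq, servingDist, hs]
          exact fun h => hdist h.2
        rw [indicator_of_notMem hmem]
        simp only [term]
        rw [indicator_of_notMem hdist, zero_mul]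
    · intro j hj
      have hnot : ¬ W.IsServing M j ω := fun h => hj (hu.unique h hi)
      simp only [term]
      rw [W.typeInd_eq]
      by_cases htype : W.IsLoS M j ω ↔ b = true
      · rw [← W.zeta_eq_zetaOf M htype, W.totalCost_of_not_isServing M hnot, hFtop]
        simp
      · rw [if_neg htype]
        simp
  · rw [lintegral_tsum fun i => (hterm i).aemeasurable]
    exact W.tsum_lintegral_typeInd_mul M hlamA hP hσm hσ hσanti hσcont b hA hA0 hcm hF hFint

end Network

/-! ### Void probabilities and Laplace factors -/

/-- For a path-loss function `z` that decreases and takes the value `t` at `a`, the links shorter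
than `a` are removed with probability one, which yields a void probability, and the longer ones
yield a factor of the Laplace transform of the interference. -/
theorem expNeg_lintegral_removalOf {w z σ : ℝ → ℝ} (hw : Measurable w)
    (hw01 : ∀ u, w u ∈ Icc (0 : ℝ) 1) (hz : Measurable z)
    (hanti : StrictAntiOn z (Ioi 0)) {a t P : ℝ} (ha : 0 < a) (hza : z a = t)
    {lam lamA : ℝ≥0} (hlam : 0 < lam) :
    expNeg (∫⁻ u in Ioi (0 : ℝ), ENNReal.ofReal
      (w u * removalOf (lamA / lam : ℝ≥0) P σ t (z u) * (2 * Real.pi * u * lam))) =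
    ENNReal.ofReal (Real.exp (-∫ u in (0 : ℝ)..a, w u * (2 * Real.pi * u * lam))) *
      expNeg (ENNReal.ofReal (2 * Real.pi * lamA) *
        ∫⁻ u in Ioi a, ENNReal.ofReal (w u * u * (1 - 1 / (1 + σ t * (P * z u))))) := by
  have hlam' : (0 : ℝ) < lam := by exact_mod_cast hlam
  have hunion : Ioi (0 : ℝ) = Iio a ∩ Ioi 0 ∪ Ici a := by
    ext u
    simp only [mem_Ioi, mem_union, mem_inter_iff, mem_Iio, mem_Ici]
    constructor
    · intro h
      rcases lt_or_ge u a with h' | h'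
      · exact Or.inl ⟨h', h⟩
      · exact Or.inr h'
    · rintro (h | h)
      · exact h.2
      · exact ha.trans_le h
  have hdisj : Disjoint (Iio a ∩ Ioi (0 : ℝ)) (Ici a) :=
    disjoint_left.mpr fun u hu hu' => (mem_Ici.mp hu').not_gt hu.1
  rw [hunion, lintegral_union measurableSet_Ici hdisj, expNeg_add]
  congr 1
  · have h1 : ∫⁻ u in Iio a ∩ Ioi (0 : ℝ), ENNReal.ofReal
        (w u * removalOf (lamA / lam : ℝ≥0) P σ t (z u) * (2 * Real.pi * u * lam)) =
        ∫⁻ u in Ioo 0 a, ENNReal.ofReal (w u * (2 * Real.pi * u * lam)) := by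
      have hset : Iio a ∩ Ioi (0 : ℝ) = Ioo 0 a := by rw [inter_comm]; rfl
      rw [hset]
      refine setLIntegral_congr_fun measurableSet_Ioo fun u hu => ?_
      have : t < z u := by
        rw [← hza]
        exact hanti hu.1 ha hu.2
      simp only [removalOf, if_pos this, mul_one]
    have hint : IntegrableOn (fun u => w u * (2 * Real.pi * u * lam)) (Ioc 0 a) := by
      refine (Measure.integrableOn_of_bounded (s := Ioc (0 : ℝ) a)
        (M := 2 * Real.pi * a * lam) (by simp) ?_ ?_)
      · exact (hw.mul (by fun_prop)).aestronglyMeasurable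
      · refine (ae_restrict_iff' measurableSet_Ioc).mpr (Filter.Eventually.of_forall fun u hu => ?_)
        have h0 := hw01 u
        have hu0 : 0 < u := hu.1
        have hua : u ≤ a := hu.2
        rw [Real.norm_of_nonneg (mul_nonneg h0.1 (by positivity))]
        calc w u * (2 * Real.pi * u * lam) ≤ 1 * (2 * Real.pi * u * lam) := by
              gcongr
              exact h0.2
          _ ≤ 2 * Real.pi * a * lam := by
              rw [one_mul]
              gcongr
    have hnn : ∀ u ∈ Ioc (0 : ℝ) a, 0 ≤ w u * (2 * Real.pi * u * lam) := fun u hu => by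
      have hu0 : 0 < u := hu.1
      exact mul_nonneg (hw01 u).1 (by positivity)
    rw [h1, setLIntegral_congr Ioo_ae_eq_Ioc, ← ofReal_integral_eq_lintegral_ofReal hint
      ((ae_restrict_iff' measurableSet_Ioc).mpr (Filter.Eventually.of_forall hnn)),
      expNeg_ofReal (setIntegral_nonneg measurableSet_Ioc hnn),
      intervalIntegral.integral_of_le ha.le]
  · rw [setLIntegral_congr Ioi_ae_eq_Ici.symm, ← lintegral_const_mul _ (by fun_prop)]
    congr 1
    refine setLIntegral_congr_fun measurableSet_Ioi fun u hu => ?_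
    have hu0 : 0 < u := ha.trans hu
    have : ¬ t < z u := by
      rw [← hza]
      exact (hanti ha hu0 hu).not_gt
    rw [removalOf, if_neg this, ← ENNReal.ofReal_mul (by positivity)]
    congr 1
    push_cast
    field_simp

namespace PathLossModel

variable (M : PathLossModel)

/-- The void probabilities of the LoS and NLoS links that are stronger than the level `t`, reached
by the two path-loss functions at `aL` and `aNL`, times the Laplace transform of the
interference from the weaker ones. -/
theorem expNeg_lintegral_removal (hζ : ∀ b, StrictAntiOn (M.zetaOf b) (Ioi 0))
    {σ : ℝ → ℝ} {aL aNL t P : ℝ} (haL : 0 < aL) (haNL : 0 < aNL) (hL : M.zetaL aL = t)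
    (hNL : M.zetaNL aNL = t) (hP : 0 < P) (hσm : Measurable σ) (hσ : 0 ≤ σ t) {lam lamA : ℝ≥0}
    (hlam : 0 < lam) :
    expNeg (∫⁻ u in Ioi (0 : ℝ), ENNReal.ofReal
      (M.removal (lamA / lam : ℝ≥0) P σ t u * (2 * Real.pi * u * lam))) =
    ENNReal.ofReal (Real.exp (-∫ u in (0 : ℝ)..aL, M.PrL u * (2 * Real.pi * u * lam)) *
        Real.exp (-∫ u in (0 : ℝ)..aNL, (1 - M.PrL u) * (2 * Real.pi * u * lam))) *
      ENNReal.ofReal (if σ t = 0 then 1 else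
        M.laplaceFactorL lamA P (σ t) aL * M.laplaceFactorNL lamA P (σ t) aNL) := by
  have hL0 := M.probOf_mem true
  have hN0 := M.probOf_mem false
  have hzL := M.zetaOf_nonneg true
  have hzN := M.zetaOf_nonneg false
  have hzLm := M.measurable_zetaOf true
  have hzNm := M.measurable_zetaOf false
  have hzL' := fun {u : ℝ} => M.zetaOf_pos true (r := u)
  have hzN' := fun {u : ℝ} => M.zetaOf_pos false (r := u)
  have hwm := M.measurable_probOf false
  have hζL := hζ true
  have hζN := hζ false
  have hlam' : (0 : ℝ) ≤ lam := lam.coe_nonneg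
  change ∀ r, M.PrL r ∈ _ at hL0
  change ∀ r, 1 - M.PrL r ∈ _ at hN0
  change ∀ r, 0 ≤ M.zetaL r at hzL
  change ∀ r, 0 ≤ M.zetaNL r at hzN
  change Measurable M.zetaL at hzLm
  change Measurable M.zetaNL at hzNm
  change ∀ {r}, 0 < r → 0 < M.zetaL r at hzL'
  change ∀ {r}, 0 < r → 0 < M.zetaNL r at hzN'
  change Measurable fun u => 1 - M.PrL u at hwm
  change StrictAntiOn M.zetaL _ at hζL
  change StrictAntiOn M.zetaNL _ at hζN
  have hrm : ∀ {z : ℝ → ℝ}, Measurable z →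
      Measurable fun u => removalOf (lamA / lam : ℝ≥0) P σ t (z u) := fun hz =>
    (measurable_removalOf (q := (lamA / lam : ℝ≥0)) (P := P) hσm).comp (measurable_const.prodMk hz)
  have hr0 : ∀ z, 0 ≤ z → 0 ≤ removalOf (lamA / lam : ℝ≥0) P σ t z := by
    intro z hz
    unfold removalOf
    split_ifs
    · exact zero_le_one
    · have h1 : 0 ≤ σ t * (P * z) := by positivity
      have h2 : 1 / (1 + σ t * (P * z)) ≤ 1 := by
        rw [div_le_one (by linarith)]
        linarith
      exact mul_nonneg (NNReal.coe_nonneg _) (by linarith)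
  have hsplit : ∫⁻ u in Ioi (0 : ℝ), ENNReal.ofReal
      (M.removal (lamA / lam : ℝ≥0) P σ t u * (2 * Real.pi * u * lam)) =
      (∫⁻ u in Ioi (0 : ℝ), ENNReal.ofReal (M.PrL u *
        removalOf (lamA / lam : ℝ≥0) P σ t (M.zetaL u) * (2 * Real.pi * u * lam))) +
      ∫⁻ u in Ioi (0 : ℝ), ENNReal.ofReal ((1 - M.PrL u) *
        removalOf (lamA / lam : ℝ≥0) P σ t (M.zetaNL u) * (2 * Real.pi * u * lam)) := by
    have hm1 := hrm hzLm
    rw [← lintegral_add_left (by fun_prop)]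
    refine setLIntegral_congr_fun measurableSet_Ioi fun u hu => ?_
    have hu0 : (0 : ℝ) < u := hu
    rw [← ENNReal.ofReal_add (mul_nonneg (mul_nonneg (hL0 u).1 (hr0 _ (hzL u))) (by positivity))
      (mul_nonneg (mul_nonneg (hN0 u).1 (hr0 _ (hzN u))) (by positivity)), removal, add_mul]
  rw [hsplit, expNeg_add,
    expNeg_lintegral_removalOf M.measurable_PrL hL0 hzLm hζL haL hL hlam,
    expNeg_lintegral_removalOf hwm hN0 hzNm hζN haNL hNL hlam,
    ENNReal.ofReal_mul (Real.exp_pos _).le, mul_mul_mul_comm]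
  congr 1
  split_ifs with h0
  · simp [h0]
  · have hs : 0 < σ t := lt_of_le_of_ne hσ (Ne.symm h0)
    have hform : ∀ w z : ℝ, 0 < z →
        w * (1 - 1 / (1 + σ t * (P * z))) = w / (1 + (σ t * P * z)⁻¹) := by
      intro w z hz
      have : 0 < σ t * (P * z) := by positivity
      field_simp
      ring
    rw [laplaceFactorL, laplaceFactorNL, ENNReal.ofReal_mul (negExp_nonneg _),
      expNeg_eq_ofReal_negExp, expNeg_eq_ofReal_negExp]
    congr 4
    · refine setLIntegral_congr_fun measurableSet_Ioi fun u hu => ?_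
      rw [hform _ _ (hzL' (haL.trans hu))]
    · refine setLIntegral_congr_fun measurableSet_Ioi fun u hu => ?_
      rw [hform _ _ (hzN' (haNL.trans hu))]

end PathLossModel

/-! ### Law, coverage and interference for a serving link of a given type -/

/-- The `SINR` condition is a lower bound on the channel gain `h`. -/
theorem ofReal_lt_div_iff {a γ h PN : ℝ} (ha : 0 < a) (hγ : 0 < γ) (I : ℝ≥0∞) :
    ENNReal.ofReal γ < ENNReal.ofReal (a * h) / (I + ENNReal.ofReal PN) ↔
      ENNReal.ofReal (γ / a) * I + ENNReal.ofReal (γ / a * PN) < ENNReal.ofReal h := by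
  have ha0 : ENNReal.ofReal a ≠ 0 := by simpa using ha
  have h1 : ENNReal.ofReal γ = ENNReal.ofReal a * ENNReal.ofReal (γ / a) := by
    rw [← ENNReal.ofReal_mul ha.le]
    congr 1
    field_simp
  rw [ENNReal.lt_div_iff_mul_lt (Or.inr ENNReal.ofReal_ne_top) (Or.inr (by simpa using hγ)),
    ENNReal.ofReal_mul ha.le, h1, mul_assoc, ENNReal.mul_lt_mul_iff_right ha0
    ENNReal.ofReal_ne_top, mul_add, ← ENNReal.ofReal_mul (by positivity)]

namespace PathLossModel

variable (M : PathLossModel)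

/-- The density of the serving distance on the event that the serving link is of type `b`, the
path-loss functions taking the value `M.zetaOf b r` at `aL r` and `aNL r`. -/
noncomputable def density (b : Bool) (lam : ℝ) (aL aNL : ℝ → ℝ) (r : ℝ) : ℝ :=
  Real.exp (-∫ u in (0 : ℝ)..aL r, M.PrL u * (2 * Real.pi * u * lam)) *
    Real.exp (-∫ u in (0 : ℝ)..aNL r, (1 - M.PrL u) * (2 * Real.pi * u * lam)) *
    (M.probOf b r * (2 * Real.pi * r * lam))

/-- The distances `aL r` and `aNL r` at which the path-loss functions take the same value as that
of type `b` at `r`. -/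
structure IsEquivalentDist (b : Bool) (A : Set ℝ) (aL aNL : ℝ → ℝ) : Prop where
  pos_L : ∀ r ∈ A, 0 < aL r
  pos_NL : ∀ r ∈ A, 0 < aNL r
  zetaL_eq : ∀ r ∈ A, M.zetaL (aL r) = M.zetaOf b r
  zetaNL_eq : ∀ r ∈ A, M.zetaNL (aNL r) = M.zetaOf b r

end PathLossModel

namespace Network

variable {lam lamA : ℝ≥0} {Ω : Type*} [MeasurableSpace Ω] {μ : Measure Ω}
  (W : Network lam lamA μ) (M : PathLossModel) [IsProbabilityMeasure μ]

/-- The event that the serving link is of type `b` and the serving distance belongs to `A`. -/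
def servingEvent (b : Bool) (A : Set ℝ) : Set Ω :=
  {ω | (W.ServingLoS M ω ↔ b = true) ∧ W.servingDist M ω ∈ A}

/-- `exists_ae_eq_indicator_serving` with the explicit density and Laplace factors. For `σ t = 0`
the interference does not enter, so that the Laplace factors are replaced by `1`: the explicit
formula, evaluated at `0⁻¹ = 0`, would not give this value. -/
theorem exists_ae_eq_indicator_servingEvent
    (hζ : ∀ b, StrictAntiOn (M.zetaOf b) (Ioi 0)) (hlam : 0 < lam) (hlamA : lamA ≤ lam)
    {P : ℝ} (hP : 0 < P) {σ : ℝ → ℝ} (hσm : Measurable σ) (hσ : ∀ t, 0 < t → 0 ≤ σ t)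
    (hσanti : AntitoneOn σ (Ioi 0)) (hσcont : ∀ t, 0 < t → ContinuousAt σ t)
    (b : Bool) {A : Set ℝ} (hA : MeasurableSet A) (hA0 : A ⊆ Ioi 0) {aL aNL : ℝ → ℝ}
    (ha : M.IsEquivalentDist b A aL aNL)
    {c : ℝ → ℝ} (hcm : Measurable c) (hc : ∀ t, 0 < t → 0 ≤ c t) {F : ℝ → ℝ≥0∞ → ℝ → ℝ≥0∞}
    (hF : Measurable fun p : ℝ × ℝ≥0∞ × ℝ => F p.1 p.2.1 p.2.2)
    (hFint : ∀ t U, 0 < t →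
      ∫⁻ h, F t U h ∂expMeasure 1 = expNeg (ENNReal.ofReal (c t)) * expNeg U)
    (hFtop : ∀ t h, F t ∞ h = 0) :
    ∃ G : Ω → ℝ≥0∞, Measurable G ∧
      ((W.servingEvent M b A).indicator fun ω =>
        F (W.zeta M (W.serving M ω) ω)
          (ENNReal.ofReal (σ (W.zeta M (W.serving M ω) ω)) * W.interference M P ω)
          (W.fading (W.serving M ω) ω)) =ᵐ[μ] G ∧
      ∫⁻ ω, G ω ∂μ = ∫⁻ r in A, ENNReal.ofReal (Real.exp (-c (M.zetaOf b r)) *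
        (if σ (M.zetaOf b r) = 0 then 1 else
          M.laplaceFactorL lamA P (σ (M.zetaOf b r)) (aL r) *
            M.laplaceFactorNL lamA P (σ (M.zetaOf b r)) (aNL r)) *
        M.density b lam aL aNL r) := by
  obtain ⟨G, hG, hGE, hGint⟩ := W.exists_ae_eq_indicator_serving M hζ hlamA hP hσm hσ hσanti
    hσcont b hA hA0 hcm hF hFint hFtop
  refine ⟨G, hG, hGE, hGint.trans (setLIntegral_congr_fun hA fun r hr => ?_)⟩
  have hr0 : 0 < r := hA0 hr
  have ht := M.zetaOf_pos b hr0
  have hprob := (M.probOf_mem b r).1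
  have hlap : 0 ≤ (if σ (M.zetaOf b r) = 0 then 1 else
      M.laplaceFactorL lamA P (σ (M.zetaOf b r)) (aL r) *
        M.laplaceFactorNL lamA P (σ (M.zetaOf b r)) (aNL r)) := by
    split_ifs
    · exact zero_le_one
    · exact mul_nonneg (negExp_nonneg _) (negExp_nonneg _)
  rw [M.expNeg_lintegral_removal hζ (ha.pos_L r hr) (ha.pos_NL r hr) (ha.zetaL_eq r hr)
    (ha.zetaNL_eq r hr) hP hσm (hσ _ ht) hlam, expNeg_ofReal (hc _ ht),
    ← ENNReal.ofReal_mul (by positivity), ← ENNReal.ofReal_mul (by positivity),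
    ← ENNReal.ofReal_mul (mul_nonneg hprob (by positivity)), PathLossModel.density]
  congr 1
  ring

/-- The law of the serving distance on the event that the serving link is of type `b`. -/
theorem nullMeasurableSet_servingEvent_and_measure
    (hζ : ∀ b, StrictAntiOn (M.zetaOf b) (Ioi 0)) (hlam : 0 < lam) (hlamA : lamA ≤ lam)
    (b : Bool) {A : Set ℝ} (hA : MeasurableSet A) (hA0 : A ⊆ Ioi 0) {aL aNL : ℝ → ℝ}
    (ha : M.IsEquivalentDist b A aL aNL) :
    NullMeasurableSet (W.servingEvent M b A) μ ∧
      μ (W.servingEvent M b A) = ∫⁻ r in A, ENNReal.ofReal (M.density b lam aL aNL r) := by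
  have := isProbabilityMeasure_expMeasure one_pos
  -- `σ = 0` removes the interference from the exponent, also an infinite one as `0 * ∞ = 0`
  obtain ⟨G, hG, hGE, hGint⟩ := W.exists_ae_eq_indicator_servingEvent M hζ hlam hlamA one_pos
    (σ := fun _ => 0) measurable_const (fun _ _ => le_rfl) (fun _ _ _ _ _ => le_rfl)
    (fun _ _ => continuousAt_const) b hA hA0 ha (c := fun _ => 0) measurable_const
    (fun _ _ => le_rfl) (F := fun _ U _ => expNeg U) (by fun_prop)
    (fun t U _ => by simp) (fun _ _ => expNeg_top)
  simp only [ENNReal.ofReal_zero, zero_mul, expNeg_zero, neg_zero, Real.exp_zero, if_true,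
    one_mul] at hGE hGint
  have hnull : NullMeasurableSet (W.servingEvent M b A) μ :=
    (aemeasurable_indicator_const_iff (1 : ℝ≥0∞)).mp ⟨G, hG, hGE⟩
  refine ⟨hnull, ?_⟩
  rw [← hGint, ← lintegral_congr_ae hGE, lintegral_indicator₀ hnull, setLIntegral_one]

/-- The conditional Laplace transform of the interference, given the serving distance and the type
of the serving link. -/
theorem setLIntegral_servingEvent_negExp_interference
    (hζ : ∀ b, StrictAntiOn (M.zetaOf b) (Ioi 0)) (hlam : 0 < lam) (hlamA : lamA ≤ lam)
    {P : ℝ} (hP : 0 < P) (b : Bool) {A : Set ℝ} (hA : MeasurableSet A) (hA0 : A ⊆ Ioi 0)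
    {aL aNL : ℝ → ℝ} (ha : M.IsEquivalentDist b A aL aNL) {s : ℝ} (hs : 0 < s) :
    ∫⁻ ω in W.servingEvent M b A,
        ENNReal.ofReal (negExp (ENNReal.ofReal s * W.interference M P ω)) ∂μ =
      ∫⁻ r in A, ENNReal.ofReal
        (M.laplaceFactorL lamA P s (aL r) * M.laplaceFactorNL lamA P s (aNL r) *
          M.density b lam aL aNL r) := by
  have := isProbabilityMeasure_expMeasure one_pos
  obtain ⟨G, -, hGE, hGint⟩ := W.exists_ae_eq_indicator_servingEvent M hζ hlam hlamA hP
    (σ := fun _ => s) measurable_const (fun _ _ => hs.le) (fun _ _ _ _ _ => le_rfl)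
    (fun _ _ => continuousAt_const) b hA hA0 ha (c := fun _ => 0) measurable_const
    (fun _ _ => le_rfl) (F := fun _ U _ => expNeg U) (by fun_prop)
    (fun t U _ => by simp) (fun _ _ => expNeg_top)
  simp only [neg_zero, Real.exp_zero, if_neg hs.ne', one_mul] at hGint
  rw [← hGint, ← lintegral_congr_ae hGE, lintegral_indicator₀
    (W.nullMeasurableSet_servingEvent_and_measure M hζ hlam hlamA b hA hA0 ha).1]
  simp_rw [expNeg_eq_ofReal_negExp]

/-- The conditional coverage probability, given the serving distance and the type of the serving
link. -/
theorem nullMeasurableSet_covered_and_measure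
    (hζ : ∀ b, StrictAntiOn (M.zetaOf b) (Ioi 0)) (hlam : 0 < lam) (hlamA : lamA ≤ lam)
    {P PN γ : ℝ} (hP : 0 < P) (hPN : 0 ≤ PN) (hγ : 0 < γ) (b : Bool) {A : Set ℝ}
    (hA : MeasurableSet A) (hA0 : A ⊆ Ioi 0) {aL aNL : ℝ → ℝ}
    (ha : M.IsEquivalentDist b A aL aNL) :
    NullMeasurableSet (W.servingEvent M b A ∩ {ω | ENNReal.ofReal γ < W.SINR M P PN ω}) μ ∧
    μ (W.servingEvent M b A ∩ {ω | ENNReal.ofReal γ < W.SINR M P PN ω}) =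
      ∫⁻ r in A, ENNReal.ofReal
        (Real.exp (-(γ * PN / (P * M.zetaOf b r))) *
          (M.laplaceFactorL lamA P (γ / (P * M.zetaOf b r)) (aL r) *
            M.laplaceFactorNL lamA P (γ / (P * M.zetaOf b r)) (aNL r)) *
          M.density b lam aL aNL r) := by
  obtain ⟨G, hG, hGE, hGint⟩ := W.exists_ae_eq_indicator_servingEvent M hζ hlam hlamA hP
    (σ := fun t => γ / (P * t)) (by fun_prop) (fun t ht => by positivity)
    (fun t ht t' _ htt' => by
      have : (0 : ℝ) < t := ht
      dsimp only
      gcongr)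
    (fun t ht => continuousAt_const.div (by fun_prop) (by positivity)) b hA hA0 ha
    (c := fun t => γ / (P * t) * PN) (by fun_prop) (fun t ht => by positivity)
    (F := fun t U h => if U + ENNReal.ofReal (γ / (P * t) * PN) < ENNReal.ofReal h then 1 else 0)
    (Measurable.ite (measurableSet_lt (by fun_prop) (by fun_prop)) measurable_const
      measurable_const)
    (fun t U _ => by rw [lintegral_expMeasure_lt, expNeg_add, mul_comm]) (fun _ _ => by simp)
  set S := W.servingEvent M b A ∩ {ω | ENNReal.ofReal γ < W.SINR M P PN ω}
  have hS : S.indicator 1 =ᵐ[μ] G := by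
    refine Filter.EventuallyEq.trans ?_ hGE
    filter_upwards [W.ppp.ae_forall_ne_zero] with ω h0
    have hz : 0 < W.zeta M (W.serving M ω) ω := by
      obtain ⟨a, ha⟩ := W.exists_zeta_eq_zetaOf M (W.serving M ω) ω
      rw [ha]
      exact M.zetaOf_pos a (norm_pos_iff.mpr (h0 _))
    have hiff := ofReal_lt_div_iff (h := W.fading (W.serving M ω) ω) (PN := PN) (mul_pos hP hz) hγ
      (W.interference M P ω)
    by_cases hE : ω ∈ W.servingEvent M b A
    · rw [indicator_of_mem hE]
      by_cases hsinr : ENNReal.ofReal γ < W.SINR M P PN ω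
      · rw [indicator_of_mem (show ω ∈ S from ⟨hE, hsinr⟩)]
        exact (if_pos (hiff.mp hsinr)).symm
      · rw [indicator_of_notMem (fun h : ω ∈ S => hsinr h.2)]
        exact (if_neg (hiff.not.mp hsinr)).symm
    · rw [indicator_of_notMem hE, indicator_of_notMem fun h : ω ∈ S => hE h.1]
  have hnull : NullMeasurableSet S μ :=
    (aemeasurable_indicator_const_iff (1 : ℝ≥0∞)).mp ⟨G, hG, hS⟩
  refine ⟨hnull, ?_⟩
  rw [← lintegral_indicator_one₀ hnull, lintegral_congr_ae hS, hGint]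
  refine setLIntegral_congr_fun hA fun r hr => ?_
  have ht := M.zetaOf_pos b (hA0 hr)
  have : γ / (P * M.zetaOf b r) ≠ 0 := by positivity
  simp only [if_neg this]
  congr 4
  ring

end Network

/-! ### The coverage probability -/

namespace Network

variable {lam lamA : ℝ≥0} {Ω : Type*} [MeasurableSpace Ω] {μ : Measure Ω}
  (W : Network lam lamA μ) (M : PathLossModel)

theorem servingEvent_true (A : Set ℝ) :
    W.servingEvent M true A = {ω | W.ServingLoS M ω ∧ W.servingDist M ω ∈ A} := by
  simp [servingEvent]

theorem servingEvent_false (A : Set ℝ) :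
    W.servingEvent M false A = {ω | ¬ W.ServingLoS M ω ∧ W.servingDist M ω ∈ A} := by
  simp [servingEvent]

/-- The coverage event is split according to the type of the serving link and the piece to which
the serving distance belongs. -/
theorem coverageProb_eq_sum [IsProbabilityMeasure μ] {P PN γ : ℝ}
    (h : ∀ b n, NullMeasurableSet
      (W.servingEvent M b (M.piece n) ∩ {ω | ENNReal.ofReal γ < W.SINR M P PN ω}) μ) :
    W.coverageProb M P PN γ = ∑ n,
      (μ (W.servingEvent M true (M.piece n) ∩ {ω | ENNReal.ofReal γ < W.SINR M P PN ω}) +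
        μ (W.servingEvent M false (M.piece n) ∩ {ω | ENNReal.ofReal γ < W.SINR M P PN ω})) := by
  classical
  set S := {ω | ENNReal.ofReal γ < W.SINR M P PN ω}
  have hS : S =ᵐ[μ] ⋃ p : Fin M.N × Bool, W.servingEvent M p.2 (M.piece p.1) ∩ S := by
    filter_upwards [W.ppp.ae_forall_ne_zero] with ω h0
    refine propext ⟨fun hω => ?_, fun hω => ?_⟩
    · obtain ⟨n, hn⟩ := M.exists_mem_piece (norm_pos_iff.mpr (h0 (W.serving M ω)))
      refine mem_iUnion.mpr ⟨(n, decide (W.ServingLoS M ω)), ⟨?_, hn⟩, hω⟩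
      simp
    · obtain ⟨p, hp⟩ := mem_iUnion.mp hω
      exact hp.2
  have hdisj : Pairwise (fun p q : Fin M.N × Bool =>
      Disjoint (W.servingEvent M p.2 (M.piece p.1) ∩ S)
        (W.servingEvent M q.2 (M.piece q.1) ∩ S)) := by
    intro p q hpq
    refine disjoint_left.mpr fun ω hp hq => hpq (Prod.ext ?_ ?_)
    · exact M.piece_unique hp.1.2 hq.1.2
    · exact Bool.eq_iff_iff.mpr (hp.1.1.symm.trans hq.1.1)
  change μ S = _
  rw [measure_congr hS, measure_iUnion₀ (fun p q hpq => (hdisj hpq).aedisjoint)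
    (fun p => h p.2 p.1), tsum_fintype, Fintype.sum_prod_type]
  simp

end Network

theorem theorem1 (M : PathLossModel)
    (hζL : StrictAntiOn M.zetaL (Ioi 0)) (hζNL : StrictAntiOn M.zetaNL (Ioi 0))
    (r₁ r₂ : ℝ → ℝ)
    (hr₁ : ∀ n, ∀ r ∈ M.piece n, 0 < r₁ r ∧ M.zetaNL (r₁ r) = M.zetaLPiece n r)
    (hr₂ : ∀ n, ∀ r ∈ M.piece n, 0 < r₂ r ∧ M.zetaL (r₂ r) = M.zetaNLPiece n r)
    (lam lamA : ℝ≥0) (hlam : 0 < lam) (hlamA : lamA ≤ lam)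
    (P PN γ : ℝ) (hP : 0 < P) (hPN : 0 ≤ PN) (hγ : 0 < γ)
    {Ω : Type*} [MeasurableSpace Ω] (μ : Measure Ω) [IsProbabilityMeasure μ]
    (W : Network lam lamA μ) :
    -- almost surely there is exactly one serving base station
    (∀ᵐ ω ∂μ, ∃! i, W.IsServing M i ω) ∧
    -- the coverage probability
    W.coverageProb M P PN γ =
      ∑ n, (M.termL lam lamA P PN γ r₁ n + M.termNL lam lamA P PN γ r₂ n) ∧
    -- the meaning of the ingredients, on each piece, for a LoS serving link
    (∀ (n : Fin M.N) (A : Set ℝ), MeasurableSet A → A ⊆ M.piece n →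
      -- density of the serving distance
      μ {ω | W.ServingLoS M ω ∧ W.servingDist M ω ∈ A} =
          ∫⁻ r in A, ENNReal.ofReal (M.densityL lam n (r₁ r) r) ∧
      -- conditional coverage probability given the serving distance
      μ {ω | (W.ServingLoS M ω ∧ W.servingDist M ω ∈ A) ∧
            ENNReal.ofReal γ < W.SINR M P PN ω} =
          ∫⁻ r in A, ENNReal.ofReal
            (M.condCoverageL lamA P PN γ n (r₁ r) r * M.densityL lam n (r₁ r) r) ∧
      -- conditional Laplace transform of the interference given the serving distance
      ∀ s : ℝ, 0 < s →
        ∫⁻ ω in {ω | W.ServingLoS M ω ∧ W.servingDist M ω ∈ A},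
            ENNReal.ofReal (negExp (ENNReal.ofReal s * W.interference M P ω)) ∂μ =
          ∫⁻ r in A, ENNReal.ofReal
            (M.laplaceL lamA P (r₁ r) r s * M.densityL lam n (r₁ r) r)) ∧
    -- the same for a NLoS serving link
    (∀ (n : Fin M.N) (A : Set ℝ), MeasurableSet A → A ⊆ M.piece n →
      μ {ω | ¬ W.ServingLoS M ω ∧ W.servingDist M ω ∈ A} =
          ∫⁻ r in A, ENNReal.ofReal (M.densityNL lam n (r₂ r) r) ∧
      μ {ω | (¬ W.ServingLoS M ω ∧ W.servingDist M ω ∈ A) ∧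
            ENNReal.ofReal γ < W.SINR M P PN ω} =
          ∫⁻ r in A, ENNReal.ofReal
            (M.condCoverageNL lamA P PN γ n (r₂ r) r * M.densityNL lam n (r₂ r) r) ∧
      ∀ s : ℝ, 0 < s →
        ∫⁻ ω in {ω | ¬ W.ServingLoS M ω ∧ W.servingDist M ω ∈ A},
            ENNReal.ofReal (negExp (ENNReal.ofReal s * W.interference M P ω)) ∂μ =
          ∫⁻ r in A, ENNReal.ofReal
            (M.laplaceNL lamA P (r₂ r) r s * M.densityNL lam n (r₂ r) r)) := by
  have hζ : ∀ b, StrictAntiOn (M.zetaOf b) (Ioi 0) := by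
    rintro (_ | _)
    · exact hζNL
    · exact hζL
  have hA0 : ∀ {n : Fin M.N} {A : Set ℝ}, A ⊆ M.piece n → A ⊆ Ioi 0 := fun hA r hr =>
    M.pos_of_mem_piece (hA hr)
  have hzL : ∀ {n : Fin M.N} {r : ℝ}, r ∈ M.piece n → M.zetaOf true r = M.zetaLPiece n r :=
    fun hr => M.stack_of_mem hr
  have hzNL : ∀ {n : Fin M.N} {r : ℝ}, r ∈ M.piece n → M.zetaOf false r = M.zetaNLPiece n r :=
    fun hr => M.stack_of_mem hr
  have hL : ∀ {n : Fin M.N} {A : Set ℝ}, A ⊆ M.piece n →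
      M.IsEquivalentDist true A (fun r => r) r₁ := fun hA =>
    ⟨fun _ hr => hA0 hA hr, fun r hr => (hr₁ _ r (hA hr)).1, fun _ _ => rfl,
      fun r hr => (hr₁ _ r (hA hr)).2.trans (hzL (hA hr)).symm⟩
  have hNL : ∀ {n : Fin M.N} {A : Set ℝ}, A ⊆ M.piece n →
      M.IsEquivalentDist false A r₂ (fun r => r) := fun hA =>
    ⟨fun r hr => (hr₂ _ r (hA hr)).1, fun _ hr => hA0 hA hr,
      fun r hr => (hr₂ _ r (hA hr)).2.trans (hzNL (hA hr)).symm, fun _ _ => rfl⟩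
  have hdL : ∀ {n : Fin M.N} {r : ℝ}, r ∈ M.piece n →
      M.density true lam (fun r => r) r₁ r = M.densityL lam n (r₁ r) r := by
    intro n r hr
    have : M.probOf true r = M.prL n r := M.stack_of_mem hr
    rw [PathLossModel.density, PathLossModel.densityL, this]
    ring
  have hdNL : ∀ {n : Fin M.N} {r : ℝ}, r ∈ M.piece n →
      M.density false lam r₂ (fun r => r) r = M.densityNL lam n (r₂ r) r := by
    intro n r hr
    have : M.probOf false r = 1 - M.prL n r := congrArg (1 - ·) (M.stack_of_mem hr)
    rw [PathLossModel.density, PathLossModel.densityNL, this]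
    ring
  have hcovL : ∀ (n : Fin M.N) (A : Set ℝ), MeasurableSet A → A ⊆ M.piece n →
      μ (W.servingEvent M true A ∩ {ω | ENNReal.ofReal γ < W.SINR M P PN ω}) =
        ∫⁻ r in A, ENNReal.ofReal
          (M.condCoverageL lamA P PN γ n (r₁ r) r * M.densityL lam n (r₁ r) r) := by
    intro n A hAm hA
    rw [(W.nullMeasurableSet_covered_and_measure M hζ hlam hlamA hP hPN hγ true hAm (hA0 hA)
      (hL hA)).2]
    refine setLIntegral_congr_fun hAm fun r hr => ?_
    rw [hdL (hA hr), hzL (hA hr)]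
    rfl
  have hcovNL : ∀ (n : Fin M.N) (A : Set ℝ), MeasurableSet A → A ⊆ M.piece n →
      μ (W.servingEvent M false A ∩ {ω | ENNReal.ofReal γ < W.SINR M P PN ω}) =
        ∫⁻ r in A, ENNReal.ofReal
          (M.condCoverageNL lamA P PN γ n (r₂ r) r * M.densityNL lam n (r₂ r) r) := by
    intro n A hAm hA
    rw [(W.nullMeasurableSet_covered_and_measure M hζ hlam hlamA hP hPN hγ false hAm (hA0 hA)
      (hNL hA)).2]
    refine setLIntegral_congr_fun hAm fun r hr => ?_
    rw [hdNL (hA hr), hzNL (hA hr)]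
    rfl
  refine ⟨W.ae_existsUnique_isServing M hζ, ?_, fun n A hAm hA => ⟨?_, ?_, fun s hs => ?_⟩,
    fun n A hAm hA => ⟨?_, ?_, fun s hs => ?_⟩⟩
  · rw [W.coverageProb_eq_sum M]
    · refine Finset.sum_congr rfl fun n _ => ?_
      rw [hcovL n _ (M.measurableSet_piece n) subset_rfl,
        hcovNL n _ (M.measurableSet_piece n) subset_rfl]
      rfl
    · rintro (_ | _) n
      · exact (W.nullMeasurableSet_covered_and_measure M hζ hlam hlamA hP hPN hγ false
          (M.measurableSet_piece n) (hA0 subset_rfl) (hNL subset_rfl)).1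
      · exact (W.nullMeasurableSet_covered_and_measure M hζ hlam hlamA hP hPN hγ true
          (M.measurableSet_piece n) (hA0 subset_rfl) (hL subset_rfl)).1
  · rw [← W.servingEvent_true, (W.nullMeasurableSet_servingEvent_and_measure M hζ hlam hlamA true
      hAm (hA0 hA) (hL hA)).2]
    exact setLIntegral_congr_fun hAm fun r hr => congrArg ENNReal.ofReal (hdL (hA hr))
  · rw [← hcovL n A hAm hA, W.servingEvent_true]
    rfl
  · rw [← W.servingEvent_true, W.setLIntegral_servingEvent_negExp_interference M hζ hlam hlamA hP
      true hAm (hA0 hA) (hL hA) hs]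
    exact setLIntegral_congr_fun hAm fun r hr => by rw [hdL (hA hr)]; rfl
  · rw [← W.servingEvent_false, (W.nullMeasurableSet_servingEvent_and_measure M hζ hlam hlamA false
      hAm (hA0 hA) (hNL hA)).2]
    exact setLIntegral_congr_fun hAm fun r hr => congrArg ENNReal.ofReal (hdNL (hA hr))
  · rw [← hcovNL n A hAm hA, W.servingEvent_false]
    rfl
  · rw [← W.servingEvent_false, W.setLIntegral_servingEvent_negExp_interference M hζ hlam hlamA hP
      false hAm (hA0 hA) (hNL hA) hs]
    exact setLIntegral_congr_fun hAm fun r hr => by rw [hdNL (hA hr)]; rfl
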